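/- Let $\Omega\subset\mathbb R^d$ be a bounded open polytopal set (polygonal if $d=2$, polyhedral if $d=3$; i.e. the interior of a finite union of convex polytopes), and let $\mathcal M$ be a mesh of $\Omega$, that is, a finite family of nonempty, pairwise disjoint open polytopal subsets (cells) of $\Omega$ whose closures cover $\Omega$. Let $T>0$ and assume that: * $\phi$ is piecewise smooth on $\mathcal M$ (on each cell it is the restriction of a $C^\infty$ function on $\mathbb R^d$) and $\phi_*\le\phi\le\phi^*$ on $\Omega$ with $\phi_*>0$; * $\mathbf V\in H_{\mathrm{div}}(\Omega)$ is piecewise polynomial on $\mathcal M$, $|\mathrm{div}\,\mathbf V|\le\Gamma_{\mathrm{div}}$ a.e. on $\Omega$, and $\mathbf V\cdot\mathbf n=0$ on $\partial\Omega$ (that is, $\int_\Omega(\mathbf V\cdot\nabla\psi+\psi\,\mathrm{div}\mathbf V)=0$ for all $\psi\in C^\infty_c(\mathbb R^d)$). Let $F_t$ be the flow of $\mathbf V/\phi$: for a.e. $x\in\Omega$, the map $t\in[-T,T]\mapsto F_t(x)\in\Omega$ is Lipschitz continuous, $F_0(x)=x$, and, for all but at most countably many $t$, $F_t(x)$ lies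 in a cell of $\mathcal M$ and $$\frac{dF_t(x)}{dt}=\frac{\mathbf V(F_t(x))}{\phi(F_t(x))}.$$ Let $r,\alpha\in[1,\infty]$ be such that $\frac1\alpha=\frac12+\frac1r$. Then, for any $f\in W^{1,r}(\Omega)$ and $s\in[-T,T]$, the function $f(F_s)-f$ belongs to $L^\alpha(\Omega)$ and $$\|f(F_s)-f\|_{L^\alpha(\Omega)}\le\frac{C_1(T)^{1/\alpha}}{\phi_*}\,|s|\,\|\mathbf V\|_{L^2(\Omega)}\,\|\nabla f\|_{L^r(\Omega)},\qquad\text{where } C_1(T)=\frac{\phi^*}{\phi_*}\exp\Big(\frac{\Gamma_{\mathrm{div}}T}{\phi_*}\Big).$$ -/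

import Mathlib

open MeasureTheory Set
open scoped ENNReal NNReal ContDiff

noncomputable section

/-- Smooth functions on the whole space with compact support contained in `U`. -/
def IsTestFun {d : ℕ} (U : Set (EuclideanSpace ℝ (Fin d)))
    (ψ : EuclideanSpace ℝ (Fin d) → ℝ) : Prop :=
  ContDiff ℝ ∞ ψ ∧ HasCompactSupport ψ ∧ tsupport ψ ⊆ U

/-- `g` is the weak gradient of `f` on the open set `Ω`. -/
def IsWeakGrad {d : ℕ} (Ω : Set (EuclideanSpace ℝ (Fin d)))
    (f : EuclideanSpace ℝ (Fin d) → ℝ)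
    (g : EuclideanSpace ℝ (Fin d) → EuclideanSpace ℝ (Fin d)) : Prop :=
  LocallyIntegrableOn f Ω ∧ LocallyIntegrableOn g Ω ∧
    ∀ ψ : EuclideanSpace ℝ (Fin d) → ℝ, IsTestFun Ω ψ → ∀ i : Fin d,
      ∫ x in Ω, f x * fderiv ℝ ψ x (EuclideanSpace.single i 1) = -∫ x in Ω, g x i * ψ x

/-- `f ∈ W^{1,r}(Ω)`, with weak gradient `g`. -/
structure IsSobolev {d : ℕ} (Ω : Set (EuclideanSpace ℝ (Fin d))) (r : ℝ≥0∞)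
    (f : EuclideanSpace ℝ (Fin d) → ℝ)
    (g : EuclideanSpace ℝ (Fin d) → EuclideanSpace ℝ (Fin d)) : Prop where
  memLp_fun : MemLp f r (volume.restrict Ω)
  memLp_grad : MemLp g r (volume.restrict Ω)
  weakGrad : IsWeakGrad Ω f g

/-- `V ∈ H_div(Ω)`, with weak divergence `δ`. -/
structure IsHDiv {d : ℕ} (Ω : Set (EuclideanSpace ℝ (Fin d)))
    (V : EuclideanSpace ℝ (Fin d) → EuclideanSpace ℝ (Fin d))
    (δ : EuclideanSpace ℝ (Fin d) → ℝ) : Prop where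
  memLp_field : MemLp V 2 (volume.restrict Ω)
  memLp_div : MemLp δ 2 (volume.restrict Ω)
  weakDiv : ∀ ψ : EuclideanSpace ℝ (Fin d) → ℝ, IsTestFun Ω ψ →
    ∫ x in Ω, fderiv ℝ ψ x (V x) = -∫ x in Ω, δ x * ψ x

/-- `V · n = 0` on `∂Ω` for `V ∈ H_div(Ω)` with divergence `δ`: the normal trace, which is the
functional `ψ ↦ ∫_Ω (V · ∇ψ + ψ div V)` on (traces of) smooth functions up to the boundary,
vanishes. -/
def ZeroNormalTrace {d : ℕ} (Ω : Set (EuclideanSpace ℝ (Fin d)))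
    (V : EuclideanSpace ℝ (Fin d) → EuclideanSpace ℝ (Fin d))
    (δ : EuclideanSpace ℝ (Fin d) → ℝ) : Prop :=
  ∀ ψ : EuclideanSpace ℝ (Fin d) → ℝ, IsTestFun univ ψ →
    ∫ x in Ω, (fderiv ℝ ψ x (V x) + δ x * ψ x) = 0

/-- Bounded open polytopal (polygonal in 2D, polyhedral in 3D) sets, not necessarily convex:
interiors of finite unions of convex polytopes. -/
def IsPolytopal {d : ℕ} (K : Set (EuclideanSpace ℝ (Fin d))) : Prop :=
  ∃ S : Finset (Finset (EuclideanSpace ℝ (Fin d))),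
    K = interior (⋃ P ∈ S, convexHull ℝ (P : Set (EuclideanSpace ℝ (Fin d))))

/-- `M` is a finite partition of the polytopal open set `Ω` into open polytopal cells
(up to the faces of the cells). -/
structure IsPolytopalMesh {d : ℕ} (Ω : Set (EuclideanSpace ℝ (Fin d)))
    (M : Finset (Set (EuclideanSpace ℝ (Fin d)))) : Prop where
  domain : IsPolytopal Ω
  polytopal : ∀ K ∈ M, IsPolytopal K
  nonempty : ∀ K ∈ M, K.Nonempty
  subset : ∀ K ∈ M, K ⊆ Ω
  disjoint : ∀ K ∈ M, ∀ L ∈ M, K ≠ L → Disjoint K L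
  cover : Ω ⊆ ⋃ K ∈ M, closure K

/-- On each open cell, `φ` coincides with a function that is smooth on the whole space
(so `φ` is smooth up to the boundary of the cell, from inside the cell). -/
def IsPiecewiseSmooth {d : ℕ} (M : Finset (Set (EuclideanSpace ℝ (Fin d))))
    (φ : EuclideanSpace ℝ (Fin d) → ℝ) : Prop :=
  ∀ K ∈ M, ∃ φK : EuclideanSpace ℝ (Fin d) → ℝ, ContDiff ℝ ∞ φK ∧ EqOn φ φK K

/-- On each open cell, the components of `V` are polynomials in the coordinates. -/
def IsPiecewisePolynomial {d : ℕ} (M : Finset (Set (EuclideanSpace ℝ (Fin d))))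
    (V : EuclideanSpace ℝ (Fin d) → EuclideanSpace ℝ (Fin d)) : Prop :=
  ∀ K ∈ M, ∃ p : Fin d → MvPolynomial (Fin d) ℝ,
    ∀ x ∈ K, ∀ i, V x i = MvPolynomial.eval (fun j => x j) (p i)

/-- `γ : [-T,T] → Ω` is a characteristic of `V/φ` starting from `x` at time `0`: it is Lipschitz
continuous and satisfies `γ' = V(γ)/φ(γ)` except at an at most countable number of times, which
include the times where `γ` meets the faces of the mesh `M`
(on which `V` and `φ` need not have a meaningful value). -/
structure IsCharacteristic {d : ℕ} (Ω : Set (EuclideanSpace ℝ (Fin d)))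
    (M : Finset (Set (EuclideanSpace ℝ (Fin d))))
    (φ : EuclideanSpace ℝ (Fin d) → ℝ)
    (V : EuclideanSpace ℝ (Fin d) → EuclideanSpace ℝ (Fin d)) (T : ℝ)
    (x : EuclideanSpace ℝ (Fin d)) (γ : ℝ → EuclideanSpace ℝ (Fin d)) : Prop where
  init : γ 0 = x
  mem : ∀ t ∈ Icc (-T) T, γ t ∈ Ω
  lipschitz : ∃ L : ℝ≥0, LipschitzOnWith L γ (Icc (-T) T)
  ode : ∃ N : Set ℝ, N.Countable ∧ ∀ t ∈ Ioo (-T) T, t ∉ N →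
    (∃ K ∈ M, γ t ∈ K) ∧ HasDerivAt γ ((φ (γ t))⁻¹ • V (γ t)) t

/-- `F` is the flow of `V/φ`: for a.e. `x ∈ Ω`, `t ↦ F t x` is a characteristic starting
from `x`. -/
def IsFlow {d : ℕ} (Ω : Set (EuclideanSpace ℝ (Fin d)))
    (M : Finset (Set (EuclideanSpace ℝ (Fin d))))
    (φ : EuclideanSpace ℝ (Fin d) → ℝ)
    (V : EuclideanSpace ℝ (Fin d) → EuclideanSpace ℝ (Fin d)) (T : ℝ)
    (F : ℝ → EuclideanSpace ℝ (Fin d) → EuclideanSpace ℝ (Fin d)) : Prop :=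
  ∀ᵐ x ∂(volume.restrict Ω), IsCharacteristic Ω M φ V T x (fun t => F t x)

/-- `C₁(T) = (φ^* / φ_*) exp(Γ T / φ_*)`. -/
def flowConst (φmin φmax Γ T : ℝ) : ℝ := φmax / φmin * Real.exp (Γ * T / φmin)

end

/-! Put `b = V/φ`. Along a characteristic, `f (F s x) - f x` is the time integral of `∇f · b` at `F
t x`. Jensen's inequality in time, Fubini's theorem, a bound on the image of Lebesgue measure under
`F t`, and Hölder's inequality with exponents `2` and `r` give the estimate. The substance is the
bound on the image measure.

Formally, for `ψ ≥ 0` the integral of `ψ ∘ F t` against `φ dx` has derivative `∫ ∇(ψ ∘ F t) · V = -∫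
(div V) ψ ∘ F t`, at most `Γ / φmin` times the integral itself, and Grönwall's lemma gives the
exponential in `C₁`. Comparing `φ dx` with `dx` gives the factor `φmax / φmin`. This computation
needs `ψ ∘ F t` to be Lipschitz, whereas `b` jumps across the faces and `F` is assumed neither
measurable nor a group.

The computation is therefore done locally, near good points, where characteristics depend in a
Lipschitz way on their starting point both forward and backward in time. Points of cells are good,
as `b` is Lipschitz on each cell. On a single face the weak divergence forces the normal component
of `V` to be continuous (`normal_trace_eq`). If it does not vanish, all characteristics cross in the
same direction and the point is good (`crossing_stability`). The remaining points lie on two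
transverse hyperplanes, or are points of tangency.

Almost no trajectory reaches a bad point. As long as trajectories stay in the good set, their
transport expands measure by a bounded factor (`weighted_goodReach_le`). During the last `ε` units
of time before a bad point is reached, a trajectory lies in a set of measure `O(ε²)`: either two
transverse slabs of width `O(ε)`, or one slab of width `O(ε²)` because the normal speed is itself
`O(ε)`. Summing over the `O(1/ε)` time steps leaves `O(ε)` (`weighted_exitReach_eq_zero`).

The measure bound then holds for the flow itself. It also allows a Sobolev function to be replaced
by mollifications in the formula along characteristics (`ae_enorm_increment_le`). Negative times
follow by reversing the field. -/

namespace PolyFlow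
open Filter Topology Metric
open scoped Convolution
set_option linter.unusedSectionVars false

/-! ### Differential equations satisfied off a countable set of times. -/

section Ode

variable {F : Type*} [NormedAddCommGroup F] [NormedSpace ℝ F] [CompleteSpace F]

/-- Fundamental theorem of calculus for a bounded derivative that exists off a countable set. -/
lemma integral_bounded_deriv_off_countable {γ v : ℝ → F} {a c C : ℝ} (hac : a ≤ c)
    (hγ : ContinuousOn γ (Icc a c)) {N : Set ℝ} (hN : N.Countable)
    (hd : ∀ t ∈ Ioo a c, t ∉ N → HasDerivAt γ (v t) t ∧ ‖v t‖ ≤ C) :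
    IntervalIntegrable v volume a c ∧ ∫ t in a..c, v t = γ c - γ a := by
  have hae : ∀ᵐ t ∂(volume.restrict (Ioc a c)), t ∈ Ioo a c ∧ t ∉ N := by
    rw [← restrict_Ioo_eq_restrict_Ioc]
    filter_upwards [ae_restrict_mem measurableSet_Ioo,
      ae_restrict_of_ae (hN.ae_notMem volume)] with t h1 h2 using ⟨h1, h2⟩
  have hi : IntervalIntegrable v volume a c := by
    rw [intervalIntegrable_iff_integrableOn_Ioc_of_le hac]
    have : IsFiniteMeasure (volume.restrict (Ioc a c)) := ⟨by simp⟩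
    refine Integrable.of_bound (C := C) ?_ ?_
    · refine (aestronglyMeasurable_deriv γ _).congr ?_
      filter_upwards [hae] with t ht using (hd t ht.1 ht.2).1.deriv
    · filter_upwards [hae] with t ht using (hd t ht.1 ht.2).2
  exact ⟨hi, integral_eq_of_hasDerivAt_off_countable_of_le γ v hac hN hγ
    (fun t ht => (hd t ht.1 ht.2).1) hi⟩

lemma norm_sub_le_of_bounded_deriv_off_countable {γ v : ℝ → F} {a c C : ℝ} (hac : a ≤ c)
    (hγ : ContinuousOn γ (Icc a c)) {N : Set ℝ} (hN : N.Countable)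
    (hd : ∀ t ∈ Ioo a c, t ∉ N → HasDerivAt γ (v t) t ∧ ‖v t‖ ≤ C) :
    ‖γ c - γ a‖ ≤ C * (c - a) := by
  obtain ⟨-, h⟩ := integral_bounded_deriv_off_countable hac hγ hN hd
  rw [← h, ← abs_of_nonneg (sub_nonneg.2 hac)]
  refine intervalIntegral.norm_integral_le_of_norm_le_const_ae ?_
  filter_upwards [hN.ae_notMem volume, (countable_singleton c).ae_notMem volume] with t h1 h2 h3
  rw [uIoc_of_le hac] at h3
  exact (hd t ⟨h3.1, lt_of_le_of_ne h3.2 h2⟩ h1).2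

lemma mul_le_sub_of_deriv_off_countable {z v : ℝ → ℝ} {a c C κ : ℝ} (hac : a ≤ c)
    (hz : ContinuousOn z (Icc a c)) {N : Set ℝ} (hN : N.Countable)
    (hd : ∀ t ∈ Ioo a c, t ∉ N → HasDerivAt z (v t) t ∧ ‖v t‖ ≤ C)
    (hκ : ∀ t ∈ Ioo a c, t ∉ N → κ ≤ v t) :
    κ * (c - a) ≤ z c - z a := by
  obtain ⟨hi, h⟩ := integral_bounded_deriv_off_countable hac hz hN hd
  rw [← h]
  have : ∫ t in a..c, κ = κ * (c - a) := by
    rw [intervalIntegral.integral_const, smul_eq_mul, mul_comm]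
  rw [← this]
  refine intervalIntegral.integral_mono_ae_restrict hac (by simp) hi ?_
  have h1 : ∀ᵐ t ∂(volume : Measure ℝ), t ∉ N := hN.ae_notMem volume
  have h2 : ∀ᵐ t ∂(volume : Measure ℝ), t ∉ ({a, c} : Set ℝ) :=
    ((countable_singleton c).insert a).ae_notMem volume
  have h3 : ∀ᵐ t ∂(volume.restrict (Icc a c)), κ ≤ v t := by
    filter_upwards [ae_restrict_mem measurableSet_Icc, ae_restrict_of_ae h1,
      ae_restrict_of_ae h2] with t ht h4 h5
    simp only [mem_insert_iff, mem_singleton_iff, not_or] at h5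
    exact hκ t ⟨lt_of_le_of_ne ht.1 (Ne.symm h5.1), lt_of_le_of_ne ht.2 h5.2⟩ h4
  exact h3

/-- For a continuous velocity the exceptional times are spurious: `γ` is a primitive of `v`, hence
differentiable everywhere. This makes the classical Grönwall comparison of trajectories available.
-/
lemma hasDerivWithinAt_of_off_countable {γ v : ℝ → F} {a c : ℝ} (hac : a ≤ c)
    (hγ : ContinuousOn γ (Icc a c)) {N : Set ℝ} (hN : N.Countable)
    (hd : ∀ t ∈ Ioo a c, t ∉ N → HasDerivAt γ (v t) t) (hv : ContinuousOn v (Icc a c)) :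
    ∀ t ∈ Icc a c, HasDerivWithinAt γ (v t) (Icc a c) t := by
  obtain ⟨C, hC⟩ := isCompact_Icc.exists_bound_of_continuousOn hv
  have hi : IntervalIntegrable v volume a c := hv.intervalIntegrable_of_Icc hac
  have key : ∀ t ∈ Icc a c, γ t = γ a + ∫ u in a..t, v u := by
    intro t ht
    have := (integral_bounded_deriv_off_countable (C := C) ht.1
      (hγ.mono (Icc_subset_Icc_right ht.2)) hN (fun u hu hn =>
        ⟨hd u ⟨hu.1, hu.2.trans_le ht.2⟩ hn, hC u ⟨hu.1.le, hu.2.le.trans ht.2⟩⟩)).2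
    rw [this]; abel
  intro t ht
  have hcont : ContinuousWithinAt v (Icc a c) t := hv t ht
  have : Fact (t ∈ Icc a c) := ⟨ht⟩
  have hsub : IntervalIntegrable v volume a t :=
    hi.mono_set (by rw [uIcc_of_le ht.1, uIcc_of_le hac]; exact Icc_subset_Icc_right ht.2)
  have hder : HasDerivWithinAt (fun u => ∫ x in a..u, v x) (v t) (Icc a c) t :=
    intervalIntegral.integral_hasDerivWithinAt_right hsub
      (hv.stronglyMeasurableAtFilter_nhdsWithin measurableSet_Icc t) hcont
  exact (hder.const_add (γ a)).congr key (key t ht)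

/-- Two trajectories of a common Lipschitz field. -/
lemma dist_le_of_trajectories_off_countable {η₁ η₂ : ℝ → F} {w : F → F} {L : ℝ≥0}
    (hw : LipschitzWith L w) {a c : ℝ} (hac : a ≤ c)
    (h₁ : ContinuousOn η₁ (Icc a c)) (h₂ : ContinuousOn η₂ (Icc a c))
    {N₁ N₂ : Set ℝ} (hN₁ : N₁.Countable) (hN₂ : N₂.Countable)
    (hd₁ : ∀ t ∈ Ioo a c, t ∉ N₁ → HasDerivAt η₁ (w (η₁ t)) t)
    (hd₂ : ∀ t ∈ Ioo a c, t ∉ N₂ → HasDerivAt η₂ (w (η₂ t)) t) :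
    dist (η₁ c) (η₂ c) ≤ dist (η₁ a) (η₂ a) * Real.exp (L * (c - a)) := by
  have k₁ := hasDerivWithinAt_of_off_countable hac h₁ hN₁ hd₁
    (hw.continuous.comp_continuousOn h₁)
  have k₂ := hasDerivWithinAt_of_off_countable hac h₂ hN₂ hd₂
    (hw.continuous.comp_continuousOn h₂)
  have conv : ∀ (η : ℝ → F), (∀ t ∈ Icc a c, HasDerivWithinAt η (w (η t)) (Icc a c) t) →
      ∀ t ∈ Ico a c, HasDerivWithinAt η (w (η t)) (Ici t) t := by
    intro η h t ht
    refine (h t ⟨ht.1, ht.2.le⟩).mono_of_mem_nhdsWithin ?_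
    exact mem_of_superset (Icc_mem_nhdsGE ht.2) (Icc_subset_Icc_left ht.1)
  exact dist_le_of_trajectories_ODE (v := fun _ => w) (K := L) (fun _ => hw) h₁
    (conv η₁ k₁) h₂ (conv η₂ k₂) le_rfl c ⟨hac, le_rfl⟩

end Ode

/-! ### Stability of trajectories that cross a hyperplane. -/

section Crossing

variable {E : Type*} [NormedAddCommGroup E] [InnerProductSpace ℝ E] [CompleteSpace E]

/-- If `z` does not change sign, an endpoint serves as crossing time. The sign of `z τ` is then
known on one side only, hence the last two conditional clauses. -/
lemma exists_crossing_time {z : ℝ → ℝ} {u : ℝ} (hu : 0 ≤ u) (hz : ContinuousOn z (Icc 0 u))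
    (hmono : ∀ s t, 0 ≤ s → s < t → t ≤ u → z s < z t) :
    ∃ τ ∈ Icc 0 u, (∀ t, 0 ≤ t → t < τ → z t < 0) ∧ (∀ t, τ < t → t ≤ u → 0 < z t) ∧
      (τ < u → 0 ≤ z τ) ∧ (0 < τ → z τ ≤ 0) := by
  by_cases h0 : 0 ≤ z 0
  · exact ⟨0, ⟨le_rfl, hu⟩, fun t h1 h2 => absurd h1 (not_le.2 h2),
      fun t h1 h2 => h0.trans_lt (hmono 0 t le_rfl h1 h2), fun _ => h0, fun h => absurd h (lt_irrefl _)⟩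
  by_cases h1 : z u ≤ 0
  · exact ⟨u, ⟨hu, le_rfl⟩, fun t h2 h3 => (hmono t u h2 h3 le_rfl).trans_le h1,
      fun t h2 h3 => absurd h2 (not_lt.2 h3), fun h => absurd h (lt_irrefl _), fun _ => h1⟩
  push Not at h0 h1
  obtain ⟨τ, hτ, hz0⟩ := intermediate_value_Icc hu hz ⟨h0.le, h1.le⟩
  exact ⟨τ, hτ, fun t h2 h3 => hz0 ▸ hmono t τ h2 h3 hτ.2,
    fun t h2 h3 => hz0 ▸ hmono τ t hτ.1 h2 h3, fun _ => hz0.ge, fun _ => hz0.le⟩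

/-- Trajectories crossing a hyperplane with positive normal speed on both sides depend in a
Lipschitz continuous way on their starting point. -/
lemma crossing_stability {n : E} (hn : ‖n‖ = 1) {c₀ κ C : ℝ} (hκ : 0 < κ) {L : ℝ≥0}
    {wp wm b : E → E} (hwp : LipschitzWith L wp) (hwm : LipschitzWith L wm) {u : ℝ} (hu : 0 ≤ u)
    {η₁ η₂ : ℝ → E} {N₁ N₂ : Set ℝ} (hN₁ : N₁.Countable) (hN₂ : N₂.Countable)
    (h₁ : ContinuousOn η₁ (Icc 0 u)) (h₂ : ContinuousOn η₂ (Icc 0 u))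
    (hd₁ : ∀ t ∈ Ioo 0 u, t ∉ N₁ → HasDerivAt η₁ (b (η₁ t)) t ∧ ‖b (η₁ t)‖ ≤ C ∧
      κ ≤ inner ℝ n (b (η₁ t)) ∧ (c₀ < inner ℝ n (η₁ t) → b (η₁ t) = wp (η₁ t)) ∧
      (inner ℝ n (η₁ t) < c₀ → b (η₁ t) = wm (η₁ t)))
    (hd₂ : ∀ t ∈ Ioo 0 u, t ∉ N₂ → HasDerivAt η₂ (b (η₂ t)) t ∧ ‖b (η₂ t)‖ ≤ C ∧
      κ ≤ inner ℝ n (b (η₂ t)) ∧ (c₀ < inner ℝ n (η₂ t) → b (η₂ t) = wp (η₂ t)) ∧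
      (inner ℝ n (η₂ t) < c₀ → b (η₂ t) = wm (η₂ t))) :
    dist (η₁ u) (η₂ u) ≤ (1 + 2 * |C| / κ) * Real.exp (L * u) * dist (η₁ 0) (η₂ 0) := by
  have key : ∀ (η : ℝ → E) (N : Set ℝ), N.Countable → ContinuousOn η (Icc 0 u) →
      (∀ t ∈ Ioo 0 u, t ∉ N → HasDerivAt η (b (η t)) t ∧ ‖b (η t)‖ ≤ C ∧
      κ ≤ inner ℝ n (b (η t)) ∧ (c₀ < inner ℝ n (η t) → b (η t) = wp (η t)) ∧
      (inner ℝ n (η t) < c₀ → b (η t) = wm (η t))) →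
      ∀ s t, 0 ≤ s → s ≤ t → t ≤ u → κ * (t - s) ≤ inner ℝ n (η t) - inner ℝ n (η s) ∧
        ‖η t - η s‖ ≤ |C| * (t - s) := by
    intro η N hN hc hd s t hs hst ht
    have hsub : ∀ r ∈ Ioo s t, r ∈ Ioo 0 u := fun r hr => ⟨hs.trans_lt hr.1, hr.2.trans_le ht⟩
    have hc' : ContinuousOn η (Icc s t) := hc.mono (Icc_subset_Icc hs ht)
    constructor
    · refine mul_le_sub_of_deriv_off_countable (z := fun r => inner ℝ n (η r))
        (v := fun r => inner ℝ n (b (η r))) (C := C) hst (by fun_prop) hN ?_ ?_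
      · intro r hr hrn
        obtain ⟨k1, k2, -⟩ := hd r (hsub r hr) hrn
        refine ⟨?_, ?_⟩
        · have := (innerSL ℝ n).hasFDerivAt.comp_hasDerivAt r k1
          exact this
        · refine (norm_inner_le_norm _ _).trans ?_
          rw [hn, one_mul]; exact k2
      · exact fun r hr hrn => (hd r (hsub r hr) hrn).2.2.1
    · refine norm_sub_le_of_bounded_deriv_off_countable (v := fun r => b (η r)) hst hc' hN ?_
      exact fun r hr hrn => ⟨(hd r (hsub r hr) hrn).1, ((hd r (hsub r hr) hrn).2.1).trans (le_abs_self C)⟩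
  -- By symmetry `η₁` crosses first. Before `τ₁` both curves follow `wm` and after `τ₂` both follow
  -- `wp`. In between they are on opposite sides, and no common Lipschitz field compares them.
  wlog hle : ∃ τ₁ τ₂ : ℝ, τ₁ ≤ τ₂ ∧
      (τ₁ ∈ Icc 0 u ∧ (∀ t, 0 ≤ t → t < τ₁ → inner ℝ n (η₁ t) < c₀) ∧
        (∀ t, τ₁ < t → t ≤ u → c₀ < inner ℝ n (η₁ t)) ∧
        (τ₁ < u → c₀ ≤ inner ℝ n (η₁ τ₁)) ∧ (0 < τ₁ → inner ℝ n (η₁ τ₁) ≤ c₀)) ∧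
      (τ₂ ∈ Icc 0 u ∧ (∀ t, 0 ≤ t → t < τ₂ → inner ℝ n (η₂ t) < c₀) ∧
        (∀ t, τ₂ < t → t ≤ u → c₀ < inner ℝ n (η₂ t)) ∧
        (τ₂ < u → c₀ ≤ inner ℝ n (η₂ τ₂)) ∧ (0 < τ₂ → inner ℝ n (η₂ τ₂) ≤ c₀))
    generalizing η₁ η₂ N₁ N₂ with H
  · have cr : ∀ (η : ℝ → E) (N : Set ℝ), N.Countable → ContinuousOn η (Icc 0 u) →
      (∀ t ∈ Ioo 0 u, t ∉ N → HasDerivAt η (b (η t)) t ∧ ‖b (η t)‖ ≤ C ∧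
      κ ≤ inner ℝ n (b (η t)) ∧ (c₀ < inner ℝ n (η t) → b (η t) = wp (η t)) ∧
      (inner ℝ n (η t) < c₀ → b (η t) = wm (η t))) → ∃ τ : ℝ,
      (τ ∈ Icc 0 u ∧ (∀ t, 0 ≤ t → t < τ → inner ℝ n (η t) < c₀) ∧
        (∀ t, τ < t → t ≤ u → c₀ < inner ℝ n (η t)) ∧
        (τ < u → c₀ ≤ inner ℝ n (η τ)) ∧ (0 < τ → inner ℝ n (η τ) ≤ c₀)) := by
      intro η N hN hc hd
      obtain ⟨τ, h1, h2, h3, h4, h5⟩ := exists_crossing_time (z := fun t => inner ℝ n (η t) - c₀) hu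
        (by fun_prop) (fun s t hs hst ht => by
          have := (key η N hN hc hd s t hs hst.le ht).1
          have := mul_pos hκ (sub_pos.2 hst)
          linarith)
      exact ⟨τ, h1, fun t a b => by linarith [h2 t a b], fun t a b => by linarith [h3 t a b],
        fun a => by linarith [h4 a], fun a => by linarith [h5 a]⟩
    obtain ⟨τ₁, hτ₁⟩ := cr η₁ N₁ hN₁ h₁ hd₁
    obtain ⟨τ₂, hτ₂⟩ := cr η₂ N₂ hN₂ h₂ hd₂
    rcases le_total τ₁ τ₂ with h | h
    · exact H hN₁ hN₂ h₁ h₂ hd₁ hd₂ ⟨τ₁, τ₂, h, hτ₁, hτ₂⟩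
    · have := H hN₂ hN₁ h₂ h₁ hd₂ hd₁ ⟨τ₂, τ₁, h, hτ₂, hτ₁⟩
      rwa [dist_comm, dist_comm (η₂ 0)] at this
  obtain ⟨τ₁, τ₂, h12, ⟨a1, a2, a3, a4, a5⟩, ⟨b1, b2, b3, b4, b5⟩⟩ := hle
  have s1 : dist (η₁ τ₁) (η₂ τ₁) ≤ dist (η₁ 0) (η₂ 0) * Real.exp (L * (τ₁ - 0)) := by
    refine dist_le_of_trajectories_off_countable hwm a1.1
      (h₁.mono (Icc_subset_Icc_right a1.2)) (h₂.mono (Icc_subset_Icc_right a1.2)) hN₁ hN₂ ?_ ?_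
    · intro t ht hn'
      obtain ⟨k1, -, -, -, k5⟩ := hd₁ t ⟨ht.1, ht.2.trans_le a1.2⟩ hn'
      rw [← k5 (a2 t ht.1.le ht.2)]; exact k1
    · intro t ht hn'
      obtain ⟨k1, -, -, -, k5⟩ := hd₂ t ⟨ht.1, ht.2.trans_le a1.2⟩ hn'
      rw [← k5 (b2 t ht.1.le (ht.2.trans_le h12))]; exact k1
  have s3 : dist (η₁ u) (η₂ u) ≤ dist (η₁ τ₂) (η₂ τ₂) * Real.exp (L * (u - τ₂)) := by
    refine dist_le_of_trajectories_off_countable hwp b1.2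
      (h₁.mono (Icc_subset_Icc_left b1.1)) (h₂.mono (Icc_subset_Icc_left b1.1)) hN₁ hN₂ ?_ ?_
    · intro t ht hn'
      obtain ⟨k1, -, -, k5, -⟩ := hd₁ t ⟨b1.1.trans_lt ht.1, ht.2⟩ hn'
      rw [← k5 (a3 t (h12.trans_lt ht.1) ht.2.le)]; exact k1
    · intro t ht hn'
      obtain ⟨k1, -, -, k5, -⟩ := hd₂ t ⟨b1.1.trans_lt ht.1, ht.2⟩ hn'
      rw [← k5 (b3 t ht.1 ht.2.le)]; exact k1
  -- At time `τ₁` the curve `η₂` is below the hyperplane by at most the distance of the two curves,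
  -- and it climbs at speed at least `κ`. The gap `τ₂ - τ₁` is thus at most this distance over `κ`,
  -- and meanwhile each curve moves at speed at most `|C|`.
  have s2 : dist (η₁ τ₂) (η₂ τ₂) ≤ (1 + 2 * |C| / κ) * dist (η₁ τ₁) (η₂ τ₁) := by
    rcases h12.eq_or_lt with rfl | hlt
    · refine le_mul_of_one_le_left dist_nonneg ?_
      have : 0 ≤ 2 * |C| / κ := by positivity
      linarith
    · have k1 := (key η₁ N₁ hN₁ h₁ hd₁ τ₁ τ₂ a1.1 hlt.le b1.2).2
      obtain ⟨k2, k3⟩ := key η₂ N₂ hN₂ h₂ hd₂ τ₁ τ₂ a1.1 hlt.le b1.2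
      have p1 := a4 (hlt.trans_le b1.2)
      have p2 := b5 (a1.1.trans_lt hlt)
      have p3 : inner ℝ n (η₁ τ₁) - inner ℝ n (η₂ τ₁) ≤ dist (η₁ τ₁) (η₂ τ₁) := by
        rw [← inner_sub_right, dist_eq_norm]
        refine (real_inner_le_norm _ _).trans ?_
        rw [hn, one_mul]
      have p4 : τ₂ - τ₁ ≤ dist (η₁ τ₁) (η₂ τ₁) / κ := by
        rw [le_div_iff₀ hκ]; linarith
      have p5 : dist (η₁ τ₂) (η₂ τ₂) ≤ ‖η₁ τ₂ - η₁ τ₁‖ + dist (η₁ τ₁) (η₂ τ₁) + ‖η₂ τ₂ - η₂ τ₁‖ := by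
        rw [← dist_eq_norm, ← dist_eq_norm, dist_comm (η₂ τ₂)]
        exact dist_triangle4 _ _ _ _
      calc dist (η₁ τ₂) (η₂ τ₂) ≤ dist (η₁ τ₁) (η₂ τ₁) + 2 * |C| * (τ₂ - τ₁) := by linarith
        _ ≤ dist (η₁ τ₁) (η₂ τ₁) + 2 * |C| * (dist (η₁ τ₁) (η₂ τ₁) / κ) := by gcongr
        _ = _ := by ring
  have hB : 0 ≤ 1 + 2 * |C| / κ := by positivity
  calc dist (η₁ u) (η₂ u) ≤ dist (η₁ τ₂) (η₂ τ₂) * Real.exp (L * (u - τ₂)) := s3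
    _ ≤ ((1 + 2 * |C| / κ) * (dist (η₁ 0) (η₂ 0) * Real.exp (L * (τ₁ - 0)))) *
        Real.exp (L * (u - τ₂)) := by
      gcongr; exact s2.trans (by gcongr)
    _ = (1 + 2 * |C| / κ) * dist (η₁ 0) (η₂ 0) * Real.exp (L * (u - (τ₂ - τ₁))) := by
      rw [show (L : ℝ) * (u - (τ₂ - τ₁)) = L * (τ₁ - 0) + L * (u - τ₂) by ring, Real.exp_add]; ring
    _ ≤ (1 + 2 * |C| / κ) * dist (η₁ 0) (η₂ 0) * Real.exp (L * u) := by
      gcongr; linarith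
    _ = _ := by ring

end Crossing

/-! ### Characteristics as curves, and their time shifts and reversals. -/

section Char

variable {E : Type*} [NormedAddCommGroup E] [NormedSpace ℝ E]

/-- Continuous curves which, at all but countably many times of `[a, c]`, lie in `C` and have
velocity `b`. -/
structure IsChar (C : Set E) (b : E → E) (a c : ℝ) (γ : ℝ → E) : Prop where
  cont : ContinuousOn γ (Icc a c)
  ode : ∃ N : Set ℝ, N.Countable ∧ ∀ t ∈ Ioo a c, t ∉ N → γ t ∈ C ∧ HasDerivAt γ (b (γ t)) t

variable {C : Set E} {b : E → E} {a c : ℝ} {γ : ℝ → E}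

lemma IsChar.shift (h : IsChar C b a c γ) {s u : ℝ} (hs : a ≤ s) (hu : s + u ≤ c) :
    IsChar C b 0 u (fun t => γ (s + t)) := by
  obtain ⟨hc, N, hN, hd⟩ := h
  refine ⟨hc.comp (by fun_prop) (fun t ht => ⟨by linarith [ht.1], by linarith [ht.2]⟩),
    (fun t => s + t) ⁻¹' N, hN.preimage (add_right_injective s), fun t ht hn => ?_⟩
  obtain ⟨h1, h2⟩ := hd (s + t) ⟨by linarith [ht.1], by linarith [ht.2]⟩ hn
  exact ⟨h1, h2.comp_const_add s t⟩

lemma IsChar.sub (h : IsChar C b a c γ) {a' c' : ℝ} (ha : a ≤ a') (hc : c' ≤ c) :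
    IsChar C b a' c' γ := by
  obtain ⟨hc', N, hN, hd⟩ := h
  exact ⟨hc'.mono (Icc_subset_Icc ha hc), N, hN, fun t ht =>
    hd t ⟨ha.trans_lt ht.1, ht.2.trans_le hc⟩⟩

/-- Reversal exchanges initial and terminal points, so forward estimates for `-b` locate the
starting points of characteristics of `b`. -/
lemma IsChar.reverse {u : ℝ} (h : IsChar C b 0 u γ) :
    IsChar C (-b) 0 u (fun t => γ (u - t)) := by
  obtain ⟨hc, N, hN, hd⟩ := h
  refine ⟨hc.comp (by fun_prop) (fun t ht => ⟨by linarith [ht.2], by linarith [ht.1]⟩),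
    (fun t => u - t) ⁻¹' N, hN.preimage sub_right_injective, fun t ht hn => ?_⟩
  obtain ⟨h1, h2⟩ := hd (u - t) ⟨by linarith [ht.2], by linarith [ht.1]⟩ hn
  exact ⟨h1, h2.comp_const_sub u t⟩

lemma IsChar.neg_time {T : ℝ} (h : IsChar C b (-T) T γ) :
    IsChar C (-b) (-T) T (fun t => γ (-t)) := by
  obtain ⟨hc, N, hN, hd⟩ := h
  refine ⟨hc.comp (by fun_prop) (fun t ht => ⟨by linarith [ht.2], by linarith [ht.1]⟩),
    (fun t => -t) ⁻¹' N, hN.preimage neg_injective, fun t ht hn => ?_⟩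
  obtain ⟨h1, h2⟩ := hd (-t) ⟨by linarith [ht.2], by linarith [ht.1]⟩ hn
  refine ⟨h1, ?_⟩
  have := h2.scomp t (hasDerivAt_neg t)
  rw [neg_smul, one_smul] at this
  exact this

lemma IsChar.dist_le [CompleteSpace E] (h : IsChar C b a c γ) {B : ℝ} (hB : ∀ x ∈ C, ‖b x‖ ≤ B) {s t : ℝ}
    (hs : s ∈ Icc a c) (ht : t ∈ Icc a c) : dist (γ s) (γ t) ≤ B * |s - t| := by
  wlog hst : t ≤ s generalizing s t with H
  · rw [dist_comm, abs_sub_comm]; exact H ht hs (le_of_not_ge hst)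
  obtain ⟨hc', N, hN, hd⟩ := h.sub ht.1 hs.2
  rw [dist_eq_norm, abs_of_nonneg (sub_nonneg.2 hst)]
  exact norm_sub_le_of_bounded_deriv_off_countable hst hc' hN
    (fun r hr hn => ⟨(hd r hr hn).2, hB _ (hd r hr hn).1⟩)

end Char

/-! ### Mollification, and weak divergences tested against Lipschitz functions. -/

section Mollify

variable {E : Type*} [NormedAddCommGroup E]

/-- A bump function at the origin with outer radius `1 / (n + 1)`. -/
noncomputable def mollifier (E : Type*) [NormedAddCommGroup E] (n : ℕ) : ContDiffBump (0 : E) where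
  rIn := 1 / (2 * ((n : ℝ) + 1))
  rOut := 1 / ((n : ℝ) + 1)
  rIn_pos := by positivity
  rIn_lt_rOut := by
    apply one_div_lt_one_div_of_lt <;> nlinarith [(Nat.cast_nonneg n : (0 : ℝ) ≤ n)]

lemma tendsto_mollifier_rOut :
    Tendsto (fun n => (mollifier E n).rOut) atTop (𝓝 0) :=
  tendsto_one_div_add_atTop_nhds_zero_nat

lemma mollifier_rOut_le (n : ℕ) : (mollifier E n).rOut ≤ 2 * (mollifier E n).rIn := by
  simp only [mollifier]; apply le_of_eq; field_simp

variable [InnerProductSpace ℝ E] [FiniteDimensional ℝ E]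
  [MeasurableSpace E] [BorelSpace E] {μ : Measure E} [μ.IsAddHaarMeasure]

variable {F : Type*} [NormedAddCommGroup F] [NormedSpace ℝ F]

open ContinuousLinearMap in
lemma norm_normed_convolution_le (φ : ContDiffBump (0 : E)) {u : E → F} {K : ℝ}
    (hu : ∀ x, ‖u x‖ ≤ K) (x : E) :
    ‖(φ.normed μ ⋆[lsmul ℝ ℝ, μ] u) x‖ ≤ K := by
  rw [convolution_def]
  calc ‖∫ t, lsmul ℝ ℝ (φ.normed μ t) (u (x - t)) ∂μ‖
      ≤ ∫ t, φ.normed μ t * K ∂μ := by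
        refine norm_integral_le_of_norm_le (φ.integrable_normed.mul_const K)
          (Eventually.of_forall fun t => ?_)
        rw [lsmul_apply, norm_smul, Real.norm_of_nonneg (φ.nonneg_normed t)]
        exact mul_le_mul_of_nonneg_left (hu _) (φ.nonneg_normed t)
    _ = K := by rw [integral_mul_const, φ.integral_normed, one_mul]

-- Rademacher's theorem gives differentiability almost everywhere and the Lipschitz constant
-- dominates the difference quotients, so the derivative may fall on `g` instead of the kernel. The
-- gradients of the mollifications are then averages of `fderiv ℝ g` and inherit its bound.
open ContinuousLinearMap in
lemma fderiv_normed_convolution_of_lipschitz (φ : ContDiffBump (0 : E)) {g : E → ℝ} {L : ℝ≥0}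
    (hg : LipschitzWith L g) (x : E) :
    fderiv ℝ (φ.normed μ ⋆[lsmul ℝ ℝ, μ] g) x = (φ.normed μ ⋆[lsmul ℝ ℝ, μ] fderiv ℝ g) x := by
  have hdiff : ∀ᵐ t ∂μ, DifferentiableAt ℝ g (x - t) :=
    (Measure.measurePreserving_sub_left μ x).quasiMeasurePreserving.ae hg.ae_differentiableAt
  have hsupp : ∀ y : E, Integrable (fun t => φ.normed μ t • g (y - t)) μ := by
    intro y
    refine Continuous.integrable_of_hasCompactSupport ?_ ?_
    · exact (φ.continuous_normed).smul (hg.continuous.comp (by fun_prop))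
    · exact φ.hasCompactSupport_normed.smul_right
  have := (hasFDerivAt_integral_of_dominated_loc_of_lip (μ := μ) (𝕜 := ℝ)
    (F := fun y t => φ.normed μ t • g (y - t)) (x₀ := x)
    (F' := fun t => φ.normed μ t • fderiv ℝ g (x - t)) (s := univ)
    (bound := fun t => φ.normed μ t * L) univ_mem
    (Eventually.of_forall fun y => (hsupp y).aestronglyMeasurable) (hsupp x) ?_ ?_ ?_ ?_).2
  · exact this.fderiv
  · refine (φ.continuous_normed.aestronglyMeasurable).smul ?_
    exact ((measurable_fderiv ℝ g).comp (by fun_prop)).aestronglyMeasurable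
  · refine Eventually.of_forall fun t => ?_
    refine LipschitzOnWith.of_dist_le_mul fun y _ z _ => ?_
    simp only [smul_eq_mul, Real.dist_eq, Real.coe_nnabs]
    rw [← mul_sub, abs_mul, abs_mul, mul_assoc]
    refine mul_le_mul_of_nonneg_left ?_ (abs_nonneg _)
    have := hg.dist_le_mul (y - t) (z - t)
    rw [dist_sub_right, Real.dist_eq] at this
    rwa [abs_of_nonneg L.coe_nonneg]
  · exact φ.integrable_normed.mul_const _
  · filter_upwards [hdiff] with t ht
    have : HasFDerivAt (fun y => g (y - t)) (fderiv ℝ g (x - t)) x := by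
      have := ht.hasFDerivAt.comp x ((hasFDerivAt_id x).sub_const t)
      exact this
    exact this.const_smul (φ.normed μ t)

lemma tsupport_normed_convolution_subset (φ : ContDiffBump (0 : E)) (g : E → ℝ) :
    tsupport (φ.normed μ ⋆[ContinuousLinearMap.lsmul ℝ ℝ, μ] g) ⊆ cthickening φ.rOut (tsupport g) := by
  refine closure_minimal ?_ isClosed_cthickening
  refine (support_convolution_subset (L := ContinuousLinearMap.lsmul ℝ ℝ) (μ := μ)).trans ?_
  rintro x ⟨a, ha, c, hc, rfl⟩
  rw [φ.support_normed_eq] at ha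
  refine mem_cthickening_of_dist_le _ c _ _ (subset_tsupport g hc) ?_
  rw [dist_eq_norm]
  have : ‖a‖ < φ.rOut := by simpa using ha
  simpa using this.le

open ContinuousLinearMap in
/-- A weak divergence may be tested against compactly supported Lipschitz functions. -/
lemma weakDiv_lipschitz {Ω : Set E} (hΩ : IsOpen Ω) {W : E → E} (hW : IntegrableOn W Ω μ)
    {δ : E → ℝ} (hδ : IntegrableOn δ Ω μ)
    (h : ∀ ψ : E → ℝ, ContDiff ℝ ∞ ψ → HasCompactSupport ψ → tsupport ψ ⊆ Ω →
      ∫ x in Ω, fderiv ℝ ψ x (W x) ∂μ = -∫ x in Ω, δ x * ψ x ∂μ)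
    {g : E → ℝ} {L : ℝ≥0} (hg : LipschitzWith L g) (hgc : HasCompactSupport g)
    (hgs : tsupport g ⊆ Ω) :
    ∫ x in Ω, fderiv ℝ g x (W x) ∂μ = -∫ x in Ω, δ x * g x ∂μ := by
  set G : ℕ → E → ℝ := fun n => (mollifier E n).normed μ ⋆[lsmul ℝ ℝ, μ] g with hG
  obtain ⟨r, hr, hrΩ⟩ := hgc.isCompact.exists_cthickening_subset_open hΩ hgs
  obtain ⟨K, hK⟩ := hgc.exists_bound_of_continuous hg.continuous
  -- Mollification enlarges the support by at most `rOut`, so that eventually `G n` is an admissible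
  -- test function.
  have hev : ∀ᶠ n in atTop, ∫ x in Ω, fderiv ℝ (G n) x (W x) ∂μ = -∫ x in Ω, δ x * G n x ∂μ := by
    filter_upwards [(tendsto_mollifier_rOut (E := E)).eventually (gt_mem_nhds hr)] with n hn
    refine h _ ?_ ?_ ?_
    · exact HasCompactSupport.contDiff_convolution_left _ (mollifier E n).hasCompactSupport_normed
        (mollifier E n).contDiff_normed hg.continuous.locallyIntegrable
    · exact HasCompactSupport.convolution _ (mollifier E n).hasCompactSupport_normed hgc
    · exact (tsupport_normed_convolution_subset _ g).trans
        ((cthickening_mono hn.le _).trans hrΩ)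
  have hD : ∀ x, ‖fderiv ℝ g x‖ ≤ L := fun x => norm_fderiv_le_of_lipschitz ℝ hg
  have hmeasD : Measurable (fderiv ℝ g) := measurable_fderiv ℝ g
  have hDloc : LocallyIntegrable (fderiv ℝ g) μ := by
    refine (locallyIntegrable_const (L : ℝ)).mono hmeasD.aestronglyMeasurable
      (Eventually.of_forall fun x => ?_)
    rw [Real.norm_of_nonneg L.coe_nonneg]; exact hD x
  -- The gradients of `G n` are bounded by `L` and converge almost everywhere to that of `g`;
  -- dominated convergence applies because `W` is integrable.
  have lim1 : Tendsto (fun n => ∫ x in Ω, fderiv ℝ (G n) x (W x) ∂μ) atTop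
      (𝓝 (∫ x in Ω, fderiv ℝ g x (W x) ∂μ)) := by
    refine tendsto_integral_of_dominated_convergence (fun x => L * ‖W x‖) ?_ (hW.norm.const_mul _) ?_ ?_
    · intro n
      have : AEStronglyMeasurable (fderiv ℝ (G n)) (μ.restrict Ω) :=
        (measurable_fderiv ℝ (G n)).aestronglyMeasurable
      exact (isBoundedBilinearMap_apply (𝕜 := ℝ)).continuous.comp_aestronglyMeasurable
        (this.prodMk hW.aestronglyMeasurable)
    · intro n
      refine Eventually.of_forall fun x => ?_
      refine (le_opNorm _ _).trans ?_
      gcongr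
      rw [hG, fderiv_normed_convolution_of_lipschitz _ hg]
      exact norm_normed_convolution_le _ hD x
    · have := ContDiffBump.ae_convolution_tendsto_right_of_locallyIntegrable
        (φ := mollifier E) (K := 2) tendsto_mollifier_rOut
        (Eventually.of_forall mollifier_rOut_le) hDloc
      filter_upwards [ae_restrict_of_ae this] with x hx
      simp_rw [hG, fderiv_normed_convolution_of_lipschitz _ hg]
      exact ((ContinuousLinearMap.apply ℝ ℝ (W x)).continuous.tendsto _).comp hx
  have lim2 : Tendsto (fun n => -∫ x in Ω, δ x * G n x ∂μ) atTop
      (𝓝 (-∫ x in Ω, δ x * g x ∂μ)) := by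
    refine Tendsto.neg (tendsto_integral_of_dominated_convergence (fun x => ‖δ x‖ * K) ?_
      (hδ.norm.mul_const _) ?_ ?_)
    · intro n
      refine hδ.aestronglyMeasurable.mul ?_
      have : Continuous (G n) := (HasCompactSupport.contDiff_convolution_left (n := 0) (lsmul ℝ ℝ)
        (mollifier E n).hasCompactSupport_normed
        (mollifier E n).contDiff_normed hg.continuous.locallyIntegrable).continuous
      exact this.aestronglyMeasurable
    · intro n
      refine Eventually.of_forall fun x => ?_
      rw [norm_mul]
      gcongr
      exact norm_normed_convolution_le _ hK x
    · refine Eventually.of_forall fun x => ?_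
      exact ((ContDiffBump.convolution_tendsto_right_of_continuous tendsto_mollifier_rOut
        hg.continuous x)).const_mul _
  exact tendsto_nhds_unique (lim1.congr' hev) lim2

end Mollify

/-! ### Grönwall's estimate for the transport of Lipschitz functions near a stable point. -/

section Flow

variable {E : Type*} [NormedAddCommGroup E] [InnerProductSpace ℝ E] [FiniteDimensional ℝ E]
  [MeasurableSpace E] [BorelSpace E]

/-- A bounded velocity `b`, continuous on an open set `C` of full measure in `Ω`, such that `φ b`
has weak divergence `δ`, together with a two-sided flow `F` of `b`. -/
structure RegularFlow (μ : Measure E) (Ω C : Set E) (φ : E → ℝ) (b : E → E) (δ : E → ℝ)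
    (φmin φmax Γ B T : ℝ) (F : ℝ → E → E) : Prop where
  isOpen : IsOpen Ω
  bdd : Bornology.IsBounded Ω
  isOpen_cells : IsOpen C
  cells_subset : C ⊆ Ω
  ae_mem_cells : ∀ᵐ x ∂μ.restrict Ω, x ∈ C
  φmin_pos : 0 < φmin
  φ_bd : ∀ x ∈ Ω, φmin ≤ φ x ∧ φ x ≤ φmax
  φ_cont : ContinuousOn φ C
  b_cont : ContinuousOn b C
  B_nonneg : 0 ≤ B
  b_bd : ∀ x ∈ C, ‖b x‖ ≤ B
  Γ_nonneg : 0 ≤ Γ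
  δ_int : IntegrableOn δ Ω μ
  δ_bd : ∀ᵐ x ∂μ.restrict Ω, |δ x| ≤ Γ
  weakDiv : ∀ ψ : E → ℝ, ContDiff ℝ ∞ ψ → HasCompactSupport ψ → tsupport ψ ⊆ Ω →
    ∫ x in Ω, fderiv ℝ ψ x (φ x • b x) ∂μ = -∫ x in Ω, δ x * ψ x ∂μ
  T_pos : 0 < T
  flow : ∀ᵐ x ∂μ.restrict Ω, F 0 x = x ∧ (∀ t ∈ Icc (-T) T, F t x ∈ Ω) ∧
    IsChar C b (-T) T (fun t => F t x)

/-- The measure with density `φ` on `Ω`. -/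
noncomputable def weighted (μ : Measure E) (Ω : Set E) (φ : E → ℝ) : Measure E :=
  (μ.restrict Ω).withDensity fun x => ENNReal.ofReal (φ x)

/-- Characteristics issued from a common small ball diverge at most linearly. -/
def Stable (C : Set E) (b : E → E) (x₀ : E) (ρ : ℝ) : Prop :=
  ∃ L : ℝ, 0 ≤ L ∧ ∀ u ∈ Icc (0 : ℝ) 1, ∀ η₁ η₂ : ℝ → E, IsChar C b 0 u η₁ → IsChar C b 0 u η₂ →
    (∀ t ∈ Icc 0 u, η₁ t ∈ ball x₀ ρ) → (∀ t ∈ Icc 0 u, η₂ t ∈ ball x₀ ρ) →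
    dist (η₁ u) (η₂ u) ≤ L * dist (η₁ 0) (η₂ 0)

/-- Starting points of the characteristics that are in `A` at time `t`. -/
def Reach (C : Set E) (b : E → E) (t : ℝ) (A : Set E) : Set E :=
  {x | ∃ η : ℝ → E, IsChar C b 0 t η ∧ η 0 = x ∧ η t ∈ A}

lemma Stable.mono {C : Set E} {b : E → E} {x₀ y : E} {ρ ρ' : ℝ} (h : Stable C b x₀ ρ)
    (hs : ball y ρ' ⊆ ball x₀ ρ) : Stable C b y ρ' := by
  obtain ⟨L, hL, h⟩ := h
  exact ⟨L, hL, fun u hu η₁ η₂ h₁ h₂ k₁ k₂ =>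
    h u hu η₁ η₂ h₁ h₂ (fun t ht => hs (k₁ t ht)) (fun t ht => hs (k₂ t ht))⟩

lemma Reach.mono {C : Set E} {b : E → E} {t : ℝ} {A A' : Set E} (h : A ⊆ A') :
    Reach C b t A ⊆ Reach C b t A' := fun _ ⟨η, h1, h2, h3⟩ => ⟨η, h1, h2, h h3⟩

/-- The function `η 0 ↦ ψ (η u)`, where `η` runs over the characteristics, is Lipschitz. -/
lemma exists_lipschitz_transport {C : Set E} {b : E → E} {B : ℝ}
    (hb : ∀ x ∈ C, ‖b x‖ ≤ B) {y₀ : E} {ρ τ : ℝ} (hρ : 0 < ρ) (hτ1 : τ ≤ 1) (hB : 0 ≤ B)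
    (hτ : B * τ ≤ ρ / 2) (hst : Stable C b y₀ (3 * ρ)) {ψ : E → ℝ} {Lψ : ℝ≥0}
    (hψ : LipschitzWith Lψ ψ) (hψ1 : ∀ x, |ψ x| ≤ 1) (hψs : ∀ x, x ∉ ball y₀ ρ → ψ x = 0) :
    ∃ L' : ℝ≥0, ∀ u ∈ Icc 0 τ, ∃ g : E → ℝ, LipschitzWith L' g ∧
      (∀ x, x ∉ ball y₀ (2 * ρ) → g x = 0) ∧ ∀ η, IsChar C b 0 u η → g (η 0) = ψ (η u) := by
  obtain ⟨L, hL, hst⟩ := hst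
  -- `Lψ * L` compares two characteristics issued from the ball of radius `2ρ`. The term `2 / ρ`
  -- handles a point of the ball of radius `3ρ/2`, where the function is at most `1` in modulus,
  -- against a point outside the ball of radius `2ρ`, where it vanishes: they are at least `ρ/2`
  -- apart.
  refine ⟨Real.toNNReal (Lψ * L + 2 / ρ), fun u hu => ?_⟩
  have hspeed : ∀ η, IsChar C b 0 u η → ∀ s ∈ Icc 0 u, ∀ t ∈ Icc 0 u, dist (η s) (η t) ≤ ρ / 2 := by
    intro η hη s hs t ht
    refine (hη.dist_le hb hs ht).trans (le_trans ?_ hτ)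
    refine mul_le_mul_of_nonneg_left ?_ hB
    rw [abs_le]; constructor <;> linarith [hs.1, hs.2, ht.1, ht.2, hu.2]
  have h0 : (0 : ℝ) ∈ Icc 0 u := ⟨le_rfl, hu.1⟩
  have h1 : u ∈ Icc 0 u := ⟨hu.1, le_rfl⟩
  have hfar : ∀ η, IsChar C b 0 u η → η 0 ∉ ball y₀ (3 / 2 * ρ) → ψ (η u) = 0 := by
    intro η hη hx
    apply hψs
    intro hxu
    apply hx
    have := hspeed η hη 0 h0 u h1
    rw [mem_ball] at *
    linarith [dist_triangle (η 0) (η u) y₀]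
  have hnear : ∀ η, IsChar C b 0 u η → η 0 ∈ ball y₀ (2 * ρ) →
      ∀ t ∈ Icc 0 u, η t ∈ ball y₀ (3 * ρ) := by
    intro η hη hx t ht
    have := hspeed η hη t ht 0 h0
    rw [mem_ball] at *
    linarith [dist_triangle (η t) (η 0) y₀]
  have hlip : ∀ η₁ η₂, IsChar C b 0 u η₁ → IsChar C b 0 u η₂ → η₁ 0 ∈ ball y₀ (2 * ρ) →
      η₂ 0 ∈ ball y₀ (2 * ρ) → |ψ (η₁ u) - ψ (η₂ u)| ≤ Lψ * L * dist (η₁ 0) (η₂ 0) := by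
    intro η₁ η₂ k₁ k₂ m₁ m₂
    have e1 := hst u ⟨hu.1, hu.2.trans hτ1⟩ η₁ η₂ k₁ k₂ (hnear η₁ k₁ m₁) (hnear η₂ k₂ m₂)
    have e2 := hψ.dist_le_mul (η₁ u) (η₂ u)
    rw [Real.dist_eq] at e2
    calc _ ≤ _ := e2
      _ ≤ Lψ * (L * dist (η₁ 0) (η₂ 0)) := by gcongr
      _ = _ := by ring
  classical
  -- The function is first prescribed on `S`, shown to be Lipschitz there, and then extended to the
  -- whole space.
  set S : Set E := {x | ∃ η, IsChar C b 0 u η ∧ η 0 = x} ∪ {x | x ∉ ball y₀ (2 * ρ)} with hS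
  set g₀ : E → ℝ := fun x =>
    if h : ∃ η, IsChar C b 0 u η ∧ η 0 = x then ψ (h.choose u) else 0 with hg₀
  -- The chosen characteristic is immaterial: in the ball of radius `2ρ`, stability at distance zero
  -- gives equal values, and elsewhere `ψ` vanishes at the end of every candidate.
  have hg₀c : ∀ η, IsChar C b 0 u η → g₀ (η 0) = ψ (η u) := by
    intro η hη
    have hex : ∃ η', IsChar C b 0 u η' ∧ η' 0 = η 0 := ⟨η, hη, rfl⟩
    have e : g₀ (η 0) = ψ (hex.choose u) := by simp only [hg₀]; rw [dif_pos hex]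
    rw [e]
    obtain ⟨k1, k2⟩ := hex.choose_spec
    by_cases hx : η 0 ∈ ball y₀ (2 * ρ)
    · have := hlip _ η k1 hη (by rw [k2]; exact hx) hx
      rw [k2, dist_self, mul_zero] at this
      linarith [abs_nonpos_iff.1 this]
    · have hx' : η 0 ∉ ball y₀ (3 / 2 * ρ) := fun h => hx (ball_subset_ball (by linarith) h)
      rw [hfar η hη hx', hfar _ k1 (by rw [k2]; exact hx')]
  have hg₀far : ∀ x, x ∉ ball y₀ (3 / 2 * ρ) → g₀ x = 0 := by
    intro x hx
    by_cases hex : ∃ η, IsChar C b 0 u η ∧ η 0 = x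
    · obtain ⟨η, hη, rfl⟩ := hex
      rw [hg₀c η hη]; exact hfar η hη hx
    · simp only [hg₀]; rw [dif_neg hex]
  have hg₀1 : ∀ x, |g₀ x| ≤ 1 := by
    intro x
    by_cases hex : ∃ η, IsChar C b 0 u η ∧ η 0 = x
    · obtain ⟨η, hη, rfl⟩ := hex
      rw [hg₀c η hη]; exact hψ1 _
    · simp only [hg₀]; rw [dif_neg hex]; simp
  have hA : 0 ≤ Lψ * L := by positivity
  have hC : 0 ≤ 2 / ρ := by positivity
  have hmix : ∀ x y, x ∈ ball y₀ (2 * ρ) → y ∉ ball y₀ (2 * ρ) →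
      |g₀ x - g₀ y| ≤ (Lψ * L + 2 / ρ) * dist x y := by
    intro x y hx hy
    rw [hg₀far y fun h => hy (ball_subset_ball (by linarith) h), sub_zero]
    by_cases hx' : x ∈ ball y₀ (3 / 2 * ρ)
    · have hd : ρ / 2 ≤ dist x y := by
        rw [mem_ball] at hx' hy
        push Not at hy
        linarith [dist_triangle y x y₀, dist_comm x y]
      calc |g₀ x| ≤ 1 := hg₀1 x
        _ = 2 / ρ * (ρ / 2) := by field_simp
        _ ≤ (Lψ * L + 2 / ρ) * dist x y := by gcongr; linarith
    · rw [hg₀far x hx', abs_zero]; positivity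
  have hLip : LipschitzOnWith (Real.toNNReal (Lψ * L + 2 / ρ)) g₀ S := by
    refine LipschitzOnWith.of_dist_le_mul fun x hx y hy => ?_
    rw [Real.coe_toNNReal _ (by positivity), Real.dist_eq]
    by_cases hx2 : x ∈ ball y₀ (2 * ρ)
    · by_cases hy2 : y ∈ ball y₀ (2 * ρ)
      · rcases hx with ⟨η₁, k₁, rfl⟩ | hx
        · rcases hy with ⟨η₂, k₂, rfl⟩ | hy
          · rw [hg₀c _ k₁, hg₀c _ k₂]
            exact (hlip _ _ k₁ k₂ hx2 hy2).trans (by gcongr; linarith)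
          · exact absurd hy2 hy
        · exact absurd hx2 hx
      · exact hmix x y hx2 hy2
    · by_cases hy2 : y ∈ ball y₀ (2 * ρ)
      · rw [abs_sub_comm, dist_comm]; exact hmix y x hy2 hx2
      · rw [hg₀far x fun h => hx2 (ball_subset_ball (by linarith) h),
          hg₀far y fun h => hy2 (ball_subset_ball (by linarith) h)]
        simp only [sub_self, abs_zero]; positivity
  obtain ⟨g, hg, hgS⟩ := hLip.extend_real
  refine ⟨g, hg, fun x hx => ?_, fun η hη => ?_⟩
  · rw [← hgS (Or.inr hx)]
    exact hg₀far x fun h => hx (ball_subset_ball (by linarith) h)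
  · rw [← hgS (Or.inl ⟨η, hη, rfl⟩)]
    exact hg₀c η hη

variable {μ : Measure E} [μ.IsAddHaarMeasure] {Ω C : Set E} {φ : E → ℝ} {b : E → E} {δ : E → ℝ}
  {φmin φmax Γ B T : ℝ} {F : ℝ → E → E}

namespace RegularFlow

variable (H : RegularFlow μ Ω C φ b δ φmin φmax Γ B T F)
include H

/-- All hypotheses are symmetric under time reversal. This reduces negative times to positive ones
and supplies the backward estimates. -/
lemma neg : RegularFlow μ Ω C φ (-b) (-δ) φmin φmax Γ B T (fun t => F (-t)) where
  isOpen := H.isOpen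
  bdd := H.bdd
  isOpen_cells := H.isOpen_cells
  cells_subset := H.cells_subset
  ae_mem_cells := H.ae_mem_cells
  φmin_pos := H.φmin_pos
  φ_bd := H.φ_bd
  φ_cont := H.φ_cont
  b_cont := H.b_cont.neg
  B_nonneg := H.B_nonneg
  b_bd := fun x hx => by rw [Pi.neg_apply, norm_neg]; exact H.b_bd x hx
  Γ_nonneg := H.Γ_nonneg
  δ_int := H.δ_int.neg
  δ_bd := by
    filter_upwards [H.δ_bd] with x hx
    rwa [Pi.neg_apply, abs_neg]
  weakDiv := fun ψ h1 h2 h3 => by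
    have := H.weakDiv ψ h1 h2 h3
    simp only [Pi.neg_apply, smul_neg, map_neg, neg_mul, integral_neg, this]
  T_pos := H.T_pos
  flow := by
    filter_upwards [H.flow] with x ⟨h1, h2, h3⟩
    exact ⟨by rw [neg_zero]; exact h1, fun t ht => h2 _ ⟨by linarith [ht.2], by linarith [ht.1]⟩,
      h3.neg_time⟩

lemma aestronglyMeasurable_of_continuousOn {G : Type*} [TopologicalSpace G]
    [TopologicalSpace.PseudoMetrizableSpace G] [SecondCountableTopologyEither E G] {f : E → G}
    (hf : ContinuousOn f C) : AEStronglyMeasurable f (μ.restrict Ω) := by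
  have h1 : AEStronglyMeasurable f (μ.restrict C) :=
    hf.aestronglyMeasurable H.isOpen_cells.measurableSet
  have h2 : (μ.restrict Ω).restrict C = μ.restrict Ω :=
    Measure.restrict_eq_self_of_ae_mem H.ae_mem_cells
  rw [← h2, Measure.restrict_restrict H.isOpen_cells.measurableSet,
    inter_eq_self_of_subset_left H.cells_subset]
  exact h1

lemma isFiniteMeasure_restrict : IsFiniteMeasure (μ.restrict Ω) :=
  ⟨by rw [Measure.restrict_apply_univ]; exact H.bdd.measure_lt_top⟩

/-- Sets of starting points of characteristics are not known to be measurable, so `A` is arbitrary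
here and in the transport estimates below, which bound outer measures. -/
lemma weighted_le (A : Set E) : weighted μ Ω φ A ≤ ENNReal.ofReal φmax * μ.restrict Ω A := by
  have := H.isFiniteMeasure_restrict
  rw [weighted, withDensity_apply' _ A]
  calc ∫⁻ x in A, ENNReal.ofReal (φ x) ∂μ.restrict Ω
      ≤ ∫⁻ x in A, ENNReal.ofReal φmax ∂μ.restrict Ω := by
        refine lintegral_mono_ae (ae_restrict_of_ae ?_)
        filter_upwards [ae_restrict_mem H.isOpen.measurableSet] with x hx
        exact ENNReal.ofReal_le_ofReal (H.φ_bd x hx).2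
    _ = _ := by rw [setLIntegral_const]

lemma le_weighted (A : Set E) : ENNReal.ofReal φmin * μ.restrict Ω A ≤ weighted μ Ω φ A := by
  have := H.isFiniteMeasure_restrict
  rw [weighted, withDensity_apply' _ A]
  calc _ = ∫⁻ x in A, ENNReal.ofReal φmin ∂μ.restrict Ω := by rw [setLIntegral_const]
    _ ≤ ∫⁻ x in A, ENNReal.ofReal (φ x) ∂μ.restrict Ω := by
        refine lintegral_mono_ae (ae_restrict_of_ae ?_)
        filter_upwards [ae_restrict_mem H.isOpen.measurableSet] with x hx
        exact ENNReal.ofReal_le_ofReal (H.φ_bd x hx).1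

lemma isFiniteMeasure_weighted : IsFiniteMeasure (weighted μ Ω φ) := by
  have := H.isFiniteMeasure_restrict
  exact ⟨(H.weighted_le univ).trans_lt
    (ENNReal.mul_lt_top ENNReal.ofReal_lt_top (measure_lt_top _ _))⟩

/-- A characteristic that starts in the open set `C` remains there for a short time. Since `b` is
continuous on `C`, time `0` cannot be exceptional. -/
lemma hasDerivWithinAt_flow {x : E} (hx : x ∈ C) (h0 : F 0 x = x)
    (hc : IsChar C b (-T) T (fun t => F t x)) :
    HasDerivWithinAt (fun t => F t x) (b x) (Ici 0) 0 := by
  have hT := H.T_pos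
  have hcont : ContinuousWithinAt (fun t => F t x) (Icc (-T) T) 0 :=
    hc.cont 0 ⟨by linarith, hT.le⟩
  have hmem : {t | F t x ∈ C} ∈ 𝓝 (0 : ℝ) := by
    have := hcont.continuousAt (Icc_mem_nhds (by linarith) hT)
    exact this (by simpa only [h0] using H.isOpen_cells.mem_nhds hx)
  obtain ⟨r, hr, hrs⟩ := Metric.mem_nhds_iff.1 hmem
  set a := min (r / 2) T with ha
  have ha0 : 0 < a := lt_min (by linarith) hT
  have haT : a ≤ T := min_le_right _ _
  have har : a < r := (min_le_left _ _).trans_lt (by linarith)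
  obtain ⟨hc', N, hN, hd⟩ := hc.sub (a' := 0) (c' := a) (by linarith) haT
  have hin : ∀ t ∈ Icc 0 a, F t x ∈ C := fun t ht => hrs (by
    rw [mem_ball, Real.dist_eq, sub_zero, abs_of_nonneg ht.1]; linarith [ht.2])
  have := hasDerivWithinAt_of_off_countable ha0.le hc' hN
    (v := fun t => b (F t x)) (fun t ht hn => (hd t ht hn).2) (H.b_cont.comp hc' hin) 0 ⟨le_rfl, ha0.le⟩
  simp only [h0] at this
  exact this.mono_of_mem_nhdsWithin (Icc_mem_nhdsGE ha0)

/-- The functions `g u`, equal to `ψ ∘ F u` almost everywhere, are Lipschitz with compact support in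
`Ω`. The energy `e u = ∫ (g u) φ` therefore has right derivative `∫ ∇(g u) · φ b = -∫ δ (g u)`,
which is at most `Γ / φmin * e u`. -/
lemma exp_bound_of_lipschitz {y₀ : E} {ρ τ : ℝ} (hρ : 0 < ρ) (hτ0 : 0 ≤ τ) (hτ1 : τ ≤ 1) (hτT : τ ≤ T)
    (hτ : B * τ ≤ ρ / 2) (hst : Stable C b y₀ (3 * ρ)) (hΩ : ball y₀ (3 * ρ) ⊆ Ω) {ψ : E → ℝ}
    {Lψ : ℝ≥0} (hψ : LipschitzWith Lψ ψ) (hψ0 : ∀ x, 0 ≤ ψ x) (hψ1 : ∀ x, ψ x ≤ 1)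
    (hψs : ∀ x, x ∉ ball y₀ ρ → ψ x = 0) :
    ∃ g : E → ℝ, Continuous g ∧ (∀ η, IsChar C b 0 τ η → g (η 0) = ψ (η τ)) ∧
      ∫ x in Ω, g x * φ x ∂μ ≤ Real.exp (Γ / φmin * τ) * ∫ x in Ω, ψ x * φ x ∂μ ∧
      (∀ᵐ x ∂μ.restrict Ω, 0 ≤ g x) ∧ IntegrableOn (fun x => g x * φ x) Ω μ ∧
      IntegrableOn (fun x => ψ x * φ x) Ω μ := by
  have := H.isFiniteMeasure_restrict
  have hψabs : ∀ x, |ψ x| ≤ 1 := fun x => by rw [abs_of_nonneg (hψ0 x)]; exact hψ1 x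
  obtain ⟨L', hL'⟩ := exists_lipschitz_transport H.b_bd hρ hτ1 H.B_nonneg hτ hst hψ hψabs hψs
  choose! g hgl hgs hgc using hL'
  have hφm : AEStronglyMeasurable φ (μ.restrict Ω) := H.aestronglyMeasurable_of_continuousOn H.φ_cont
  have hbm : AEStronglyMeasurable b (μ.restrict Ω) := H.aestronglyMeasurable_of_continuousOn H.b_cont
  have hφb : ∀ᵐ x ∂μ.restrict Ω, φ x ∈ Icc φmin φmax := by
    filter_upwards [ae_restrict_mem H.isOpen.measurableSet] with x hx using H.φ_bd x hx
  have hφn : ∀ᵐ x ∂μ.restrict Ω, ‖φ x‖ ≤ φmax := by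
    filter_upwards [hφb] with x hx
    rw [Real.norm_of_nonneg (H.φmin_pos.le.trans hx.1)]; exact hx.2
  -- This replaces the semigroup law, which is not assumed for `F`. The shifted trajectory is some
  -- characteristic issued from `F h x`, and `g u` has the right value on all of them.
  have hae : ∀ᵐ x ∂μ.restrict Ω, ∀ u h, 0 ≤ u → 0 ≤ h → u + h ≤ τ →
      g u (F h x) = ψ (F (u + h) x) := by
    filter_upwards [H.flow] with x ⟨_, _, h3⟩ u h hu hh huh
    have := hgc u ⟨hu, by linarith⟩ _ (h3.shift (s := h) (u := u) (by linarith) (by linarith))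
    simpa [add_comm] using this
  have hae0 : ∀ᵐ x ∂μ.restrict Ω, ∀ u ∈ Icc 0 τ, g u x = ψ (F u x) := by
    filter_upwards [hae, H.flow] with x hx ⟨h1, _⟩ u hu
    have := hx u 0 hu.1 le_rfl (by linarith [hu.2])
    rwa [h1, add_zero] at this
  have hgint : ∀ u ∈ Icc 0 τ, IntegrableOn (fun x => g u x * φ x) Ω μ := by
    intro u hu
    refine Integrable.of_bound (C := 1 * φmax) ((hgl u hu).continuous.aestronglyMeasurable.mul hφm) ?_
    filter_upwards [hae0, hφn] with x hx hx2
    rw [norm_mul, hx u hu]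
    exact mul_le_mul (hψabs _) hx2 (norm_nonneg _) zero_le_one
  have hψint : IntegrableOn (fun x => ψ x * φ x) Ω μ := by
    refine Integrable.of_bound (C := 1 * φmax) (hψ.continuous.aestronglyMeasurable.mul hφm) ?_
    filter_upwards [hφn] with x hx2
    rw [norm_mul]
    exact mul_le_mul (hψabs _) hx2 (norm_nonneg _) zero_le_one
  set e : ℝ → ℝ := fun u => ∫ x in Ω, g u x * φ x ∂μ with he
  set e' : ℝ → ℝ := fun u => -∫ x in Ω, δ x * g u x ∂μ with he'
  have hg0 : ∀ u ∈ Icc 0 τ, ∀ᵐ x ∂μ.restrict Ω, 0 ≤ g u x := by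
    intro u hu
    filter_upwards [hae0] with x hx
    rw [hx u hu]; exact hψ0 _
  have hspeed : ∀ᵐ x ∂μ.restrict Ω, ∀ s ∈ Icc 0 τ, ∀ t ∈ Icc 0 τ,
      |ψ (F s x) - ψ (F t x)| ≤ Lψ * B * |s - t| := by
    filter_upwards [H.flow] with x ⟨_, _, h3⟩ s hs t ht
    have k := h3.dist_le H.b_bd (s := s) (t := t) ⟨by linarith [hs.1], by linarith [hs.2]⟩
      ⟨by linarith [ht.1], by linarith [ht.2]⟩
    have := hψ.dist_le_mul (F s x) (F t x)
    rw [Real.dist_eq] at this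
    calc _ ≤ _ := this
      _ ≤ Lψ * (B * |s - t|) := by gcongr
      _ = _ := by ring
  have hdiff : ∀ s ∈ Icc 0 τ, ∀ t ∈ Icc 0 τ, e s - e t = ∫ x in Ω, (g s x - g t x) * φ x ∂μ := by
    intro s hs t ht
    rw [he, ← integral_sub (hgint s hs) (hgint t ht)]
    simp only [sub_mul]
  have hlip : ∀ s ∈ Icc 0 τ, ∀ t ∈ Icc 0 τ,
      dist (e s) (e t) ≤ Real.toNNReal (Lψ * B * |φmax| * (μ.restrict Ω).real univ) * dist s t := by
    intro s hs t ht
    rw [Real.dist_eq, hdiff s hs t ht, Real.coe_toNNReal _ (by have := H.B_nonneg; positivity),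
      Real.dist_eq]
    rw [show Lψ * B * |φmax| * (μ.restrict Ω).real univ * |s - t| =
      Lψ * B * |s - t| * |φmax| * (μ.restrict Ω).real univ by ring]
    rw [← Real.norm_eq_abs (∫ x in Ω, (g s x - g t x) * φ x ∂μ)]
    refine norm_integral_le_of_norm_le_const ?_
    filter_upwards [hspeed, hae0, hφn] with x h1 h2 h3
    rw [norm_mul, h2 s hs, h2 t ht]
    have := H.B_nonneg
    exact mul_le_mul (h1 s hs t ht) (h3.trans (le_abs_self _)) (norm_nonneg _) (by positivity)
  have hcont : ContinuousOn e (Icc 0 τ) := (LipschitzOnWith.of_dist_le_mul hlip).continuousOn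
  have hWint : IntegrableOn (fun x => φ x • b x) Ω μ := by
    refine Integrable.of_bound (C := φmax * B) (hφm.smul hbm) ?_
    filter_upwards [hφn, H.ae_mem_cells] with x h1 h2
    rw [norm_smul]
    exact mul_le_mul h1 (H.b_bd x h2) (norm_nonneg _) ((norm_nonneg _).trans h1)
  -- By `hae`, the difference quotient of `u ↦ g u x` is that of `g u` along the trajectory of `x`
  -- near time `0`. It converges wherever `g u` is differentiable, that is almost everywhere, and
  -- `hspeed` dominates it.
  have hderiv : ∀ u ∈ Ico 0 τ, Tendsto (fun z => (z - u)⁻¹ * (e z - e u)) (𝓝[>] u) (𝓝 (e' u)) := by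
    intro u hu
    have huI : u ∈ Icc 0 τ := ⟨hu.1, hu.2.le⟩
    have hcs : HasCompactSupport (g u) := by
      refine HasCompactSupport.intro (isCompact_closedBall y₀ (2 * ρ)) fun x hx => ?_
      exact hgs u huI x fun h => hx (ball_subset_closedBall h)
    have hts : tsupport (g u) ⊆ Ω := by
      refine Subset.trans ?_ hΩ
      refine (closure_minimal (fun x hx => ?_) isClosed_closedBall).trans
        (closedBall_subset_ball (show 2 * ρ < 3 * ρ by linarith))
      by_contra hxx
      exact hx (hgs u huI x fun h => hxx (ball_subset_closedBall h))
    have hwd := weakDiv_lipschitz H.isOpen hWint H.δ_int H.weakDiv (hgl u huI) hcs hts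
    rw [he']
    simp only
    rw [← hwd]
    have hev : ∀ᶠ z in 𝓝[>] u, z ∈ Ioc u τ := Ioc_mem_nhdsGT hu.2
    have heq : ∀ᶠ z in 𝓝[>] u, ∫ x in Ω, (z - u)⁻¹ * ((g z x - g u x) * φ x) ∂μ =
        (z - u)⁻¹ * (e z - e u) := by
      filter_upwards [hev] with z hz
      rw [hdiff z ⟨hu.1.trans hz.1.le, hz.2⟩ u huI, integral_const_mul]
    refine Tendsto.congr' heq ?_
    refine tendsto_integral_filter_of_dominated_convergence (fun _ => Lψ * B * |φmax|) ?_ ?_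
      (integrable_const _) ?_
    · filter_upwards [hev] with z hz
      exact (((hgl z ⟨hu.1.trans hz.1.le, hz.2⟩).continuous.sub
        (hgl u huI).continuous).aestronglyMeasurable.mul hφm).const_mul _
    · filter_upwards [hev] with z hz
      have hzI : z ∈ Icc 0 τ := ⟨hu.1.trans hz.1.le, hz.2⟩
      filter_upwards [hspeed, hae0, hφn] with x h1 h2 h3
      rw [norm_mul, norm_mul, h2 z hzI, h2 u huI, norm_inv, Real.norm_eq_abs, Real.norm_eq_abs]
      have hpos : 0 < |z - u| := abs_pos.2 (sub_ne_zero.2 hz.1.ne')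
      calc |z - u|⁻¹ * (|ψ (F z x) - ψ (F u x)| * ‖φ x‖)
          ≤ |z - u|⁻¹ * ((Lψ * B * |z - u|) * |φmax|) := by
            have := h1 z hzI u huI
            have := h3.trans (le_abs_self _)
            have := H.B_nonneg
            gcongr
        _ = _ := by field_simp
    · filter_upwards [hae, hae0, H.flow, H.ae_mem_cells,
        ae_restrict_of_ae (hgl u huI).ae_differentiableAt] with x h1 h2 ⟨h3, h3', h4⟩ h5 h6
      have hd := H.hasDerivWithinAt_flow h5 h3 h4
      have hd2 : HasDerivWithinAt (fun h => g u (F h x)) (fderiv ℝ (g u) x (b x)) (Ici 0) 0 := by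
        have h6' : HasFDerivAt (g u) (fderiv ℝ (g u) x) (F 0 x) := by rw [h3]; exact h6.hasFDerivAt
        exact h6'.comp_hasDerivWithinAt (0 : ℝ) hd
      have hd3 := (hasDerivWithinAt_iff_tendsto_slope' (s := Ioi (0 : ℝ)) (by simp)).1
        (hd2.mono Ioi_subset_Ici_self)
      have hmap : Tendsto (fun z => z - u) (𝓝[>] u) (𝓝[>] 0) := by
        refine tendsto_nhdsWithin_iff.2 ⟨?_, ?_⟩
        · have : Tendsto (fun z => z - u) (𝓝 u) (𝓝 (u - u)) := tendsto_id.sub_const u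
          rw [sub_self] at this
          exact this.mono_left nhdsWithin_le_nhds
        · filter_upwards [self_mem_nhdsWithin] with z hz
          exact sub_pos.2 (mem_Ioi.1 hz)
      have hlim := (hd3.comp hmap).mul_const (φ x)
      rw [map_smul, smul_eq_mul, mul_comm (φ x)]
      refine hlim.congr' ?_
      filter_upwards [hev] with z hz
      have hzI : z ∈ Icc 0 τ := ⟨hu.1.trans hz.1.le, hz.2⟩
      have := h1 u (z - u) hu.1 (by linarith [hz.1]) (by linarith [hz.2])
      simp only [Function.comp, slope_def_field, sub_zero]
      rw [this, add_sub_cancel, h3, h2 z hzI, h2 u huI]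
      ring
  have hbound : ∀ u ∈ Ico 0 τ, e' u ≤ Γ / φmin * e u + 0 := by
    intro u hu
    have huI : u ∈ Icc 0 τ := ⟨hu.1, hu.2.le⟩
    rw [he', he, add_zero]
    simp only
    rw [← integral_const_mul, ← integral_neg]
    have hgm := (hgl u huI).continuous.aestronglyMeasurable (μ := μ.restrict Ω)
    refine integral_mono_ae ?_ ((hgint u huI).const_mul _) ?_
    · refine (Integrable.mono' (g := fun x => ‖δ x‖) H.δ_int.norm
        (H.δ_int.aestronglyMeasurable.mul hgm) ?_).neg
      filter_upwards [hae0] with x h1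
      rw [Pi.mul_apply, norm_mul, h1 u huI]
      exact mul_le_of_le_one_right (norm_nonneg _) (hψabs _)
    · filter_upwards [hg0 u huI, H.δ_bd, hφb] with x h1 h2 h3
      have hφ1 : 1 ≤ φ x / φmin := (one_le_div H.φmin_pos).2 h3.1
      calc -(δ x * g u x) ≤ Γ * g u x := by
            have := neg_abs_le (δ x)
            nlinarith
        _ ≤ Γ * g u x * (φ x / φmin) :=
            le_mul_of_one_le_right (mul_nonneg H.Γ_nonneg h1) hφ1
        _ = _ := by ring
  -- This form of Grönwall's lemma needs only continuity and an upper bound on a right lower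
  -- derivative.
  have hmain := le_gronwallBound_of_liminf_deriv_right_le hcont
    (fun u hu r hr => ((hderiv u hu).eventually (gt_mem_nhds hr)).frequently) le_rfl hbound τ
    ⟨hτ0, le_rfl⟩
  rw [gronwallBound_ε0, sub_zero] at hmain
  have he0 : e 0 = ∫ x in Ω, ψ x * φ x ∂μ := by
    refine integral_congr_ae ?_
    filter_upwards [hae0, H.flow] with x h1 ⟨h2, _⟩
    rw [h1 0 ⟨le_rfl, hτ0⟩, h2]
  refine ⟨g τ, (hgl τ ⟨hτ0, le_rfl⟩).continuous, hgc τ ⟨hτ0, le_rfl⟩, ?_, hg0 τ ⟨hτ0, le_rfl⟩,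
    hgint τ ⟨hτ0, le_rfl⟩, hψint⟩
  rw [← he0, mul_comm]
  exact hmain

end RegularFlow

end Flow

/-! ### Measure of the set of starting points, along trajectories in the good set. -/

section Reach

variable {E : Type*} [NormedAddCommGroup E] [InnerProductSpace ℝ E] [FiniteDimensional ℝ E]
  [MeasurableSpace E] [BorelSpace E]

/-- Points of `Ω` near which characteristics are stable forward and backward in time. -/
def Good (Ω C : Set E) (b : E → E) (ρ : ℝ) (x : E) : Prop :=
  ball x ρ ⊆ Ω ∧ Stable C b x ρ ∧ Stable C (-b) x ρ

/-- The set of all points near which characteristics are stable. -/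
def goodSet (Ω C : Set E) (b : E → E) : Set E := {x | ∃ ρ > 0, Good Ω C b ρ x}

/-- Starting points of the characteristics that remain in the good set and are in `A` at time `t`. -/
def GoodReach (Ω C : Set E) (b : E → E) (t : ℝ) (A : Set E) : Set E :=
  {x | ∃ η : ℝ → E, IsChar C b 0 t η ∧ η 0 = x ∧ η t ∈ A ∧ ∀ s ∈ Icc 0 t, η s ∈ goodSet Ω C b}

variable {Ω C : Set E} {b : E → E}

lemma Good.mono {ρ ρ' : ℝ} {x y : E} (h : Good Ω C b ρ x) (hs : ball y ρ' ⊆ ball x ρ) :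
    Good Ω C b ρ' y := ⟨hs.trans h.1, h.2.1.mono hs, h.2.2.mono hs⟩

lemma isOpen_goodSet : IsOpen (goodSet Ω C b) := by
  rw [Metric.isOpen_iff]
  rintro x ⟨ρ, hρ, h⟩
  refine ⟨ρ / 2, by linarith, fun y hy => ⟨ρ / 2, by linarith, h.mono ?_⟩⟩
  exact ball_subset_ball' (by rw [mem_ball] at hy; linarith)

lemma exists_uniform_good {K : Set E} (hK : IsCompact K) (hg : K ⊆ goodSet Ω C b) :
    ∃ ρ > 0, ∀ x ∈ K, Good Ω C b ρ x := by
  refine hK.induction_on (p := fun s => ∃ ρ > 0, ∀ x ∈ s, Good Ω C b ρ x)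
    ⟨1, one_pos, fun x hx => absurd hx (notMem_empty x)⟩ ?_ ?_ ?_
  · rintro s t hst ⟨ρ, hρ, h⟩
    exact ⟨ρ, hρ, fun x hx => h x (hst hx)⟩
  · rintro s t ⟨ρ, hρ, h⟩ ⟨ρ', hρ', h'⟩
    refine ⟨min ρ ρ', lt_min hρ hρ', fun x hx => ?_⟩
    rcases hx with hx | hx
    · exact (h x hx).mono (ball_subset_ball (min_le_left _ _))
    · exact (h' x hx).mono (ball_subset_ball (min_le_right _ _))
  · intro x hx
    obtain ⟨ρ, hρ, h⟩ := hg hx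
    refine ⟨ball x (ρ / 2), mem_nhdsWithin_of_mem_nhds (ball_mem_nhds x (by linarith)),
      ρ / 2, by linarith, fun y hy => h.mono ?_⟩
    exact ball_subset_ball' (by rw [mem_ball] at hy; linarith)

/-- Characteristics starting close to the origin of a stable characteristic stay close to it. -/
lemma exists_close {B : ℝ} (hb : ∀ x ∈ C, ‖b x‖ ≤ B) (hB : 0 ≤ B) {γ : ℝ → E} {t : ℝ}
    (hγ : IsChar C b 0 t γ) {ρ : ℝ} (hρ : 0 < ρ) (hst : ∀ s ∈ Icc 0 t, Stable C b (γ s) ρ) :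
    ∀ ε > 0, ∃ δ > 0, ∀ u ∈ Icc 0 t, ∀ η, IsChar C b 0 u η → dist (η 0) (γ 0) < δ →
      ∀ s ∈ Icc 0 u, dist (η s) (γ s) < ε := by
  -- A characteristic moves at most `ρ / 4` in time `h`. Hence two characteristics less than `ρ / 2`
  -- apart at the beginning of a step remain in the same stability ball during it. The induction is
  -- on the number of steps.
  set h : ℝ := min 1 (ρ / (4 * (B + 1))) with hh
  have hh0 : 0 < h := lt_min one_pos (by positivity)
  have hh1 : h ≤ 1 := min_le_left _ _
  have hhB : B * h ≤ ρ / 4 := by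
    calc B * h ≤ (B + 1) * (ρ / (4 * (B + 1))) := by
          gcongr
          · linarith
          · exact min_le_right _ _
      _ = ρ / 4 := by field_simp
  have main : ∀ k : ℕ, ∀ ε > 0, ∃ δ > 0, ∀ u ∈ Icc 0 t, u ≤ k * h → ∀ η, IsChar C b 0 u η →
      dist (η 0) (γ 0) < δ → ∀ s ∈ Icc 0 u, dist (η s) (γ s) < ε := by
    intro k
    induction k with
    | zero =>
      intro ε hε
      refine ⟨ε, hε, fun u hu hu0 η _ hd s hs => ?_⟩
      have : s = 0 := le_antisymm (by simpa using hs.2.trans hu0) hs.1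
      rwa [this]
    | succ k ih =>
      intro ε hε
      by_cases hkt : t < k * h
      · obtain ⟨δ, hδ, hd⟩ := ih ε hε
        exact ⟨δ, hδ, fun u hu _ => hd u hu (hu.2.trans hkt.le)⟩
      push Not at hkt
      have hk0 : 0 ≤ (k : ℝ) * h := by positivity
      obtain ⟨L, hL, hstL⟩ := hst (k * h) ⟨hk0, hkt⟩
      -- Respectively: closeness up to the start of the last step, confinement to the stability
      -- ball, and closeness after multiplication by the stability constant `L`.
      set ε₁ : ℝ := min (min ε (ρ / 2)) (ε / (L + 1)) with hε₁
      have hε₁0 : 0 < ε₁ := lt_min (lt_min hε (by linarith)) (by positivity)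
      obtain ⟨δ, hδ, hd⟩ := ih ε₁ hε₁0
      refine ⟨δ, hδ, fun u hu huk η hη h0 s hs => ?_⟩
      rcases le_or_gt s (k * h) with hsk | hsk
      · exact (hd s ⟨hs.1, hs.2.trans hu.2⟩ hsk η (hη.sub le_rfl hs.2) h0 s ⟨hs.1, le_rfl⟩).trans_le
          ((min_le_left _ _).trans (min_le_left _ _))
      have hsu : k * h ≤ u := hsk.le.trans hs.2
      have e1 := hd (k * h) ⟨hk0, hkt⟩ le_rfl η (hη.sub le_rfl hsu) h0 (k * h) ⟨hk0, le_rfl⟩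
      have hdur : s - k * h ≤ h := by push_cast at huk; linarith [hs.2]
      have hst' : s ≤ t := hs.2.trans hu.2
      have c1 := hη.shift (s := k * h) (u := s - k * h) hk0 (by linarith [hs.2])
      have c2 := hγ.shift (s := k * h) (u := s - k * h) hk0 (by linarith)
      have speed : ∀ ξ : ℝ → E, IsChar C b 0 (s - k * h) ξ → ∀ r ∈ Icc 0 (s - k * h),
          dist (ξ r) (ξ 0) ≤ ρ / 4 := by
        intro ξ hξ r hr
        refine (hξ.dist_le hb hr ⟨le_rfl, by linarith⟩).trans (le_trans ?_ hhB)
        rw [sub_zero, abs_of_nonneg hr.1]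
        exact mul_le_mul_of_nonneg_left (hr.2.trans hdur) hB
      have := hstL (s - k * h) ⟨by linarith, hdur.trans hh1⟩ _ _ c1 c2 (fun r hr => ?_)
        (fun r hr => ?_)
      · simp only [add_sub_cancel, add_zero] at this
        calc dist (η s) (γ s) ≤ _ := this
          _ ≤ L * (ε / (L + 1)) := by
            gcongr
            exact e1.le.trans (min_le_right _ _)
          _ < ε := by
            rw [← mul_div_assoc, div_lt_iff₀ (by linarith)]; nlinarith
      · have k1 := speed _ c1 r hr
        have k2 : ε₁ ≤ ρ / 2 := (min_le_left _ _).trans (min_le_right _ _)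
        simp only [add_zero] at k1
        rw [mem_ball]
        linarith [dist_triangle (η (k * h + r)) (η (k * h)) (γ (k * h))]
      · have k1 := speed _ c2 r hr
        simp only [add_zero] at k1
        rw [mem_ball]
        linarith
  intro ε hε
  obtain ⟨k, hk⟩ := exists_nat_ge (t / h)
  obtain ⟨δ, hδ, hd⟩ := main k ε hε
  exact ⟨δ, hδ, fun u hu => hd u hu (hu.2.trans ((div_le_iff₀ hh0).1 hk))⟩

lemma reach_add_subset {s t : ℝ} (hs : 0 ≤ s) (ht : 0 ≤ t) (A : Set E) :
    Reach C b (s + t) A ⊆ Reach C b s (Reach C b t A) := by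
  rintro x ⟨η, hη, h0, hA⟩
  refine ⟨η, hη.sub le_rfl (by linarith), h0, fun r => η (s + r), hη.shift hs le_rfl, by simp, hA⟩

variable {μ : Measure E} [μ.IsAddHaarMeasure] {φ : E → ℝ} {δ : E → ℝ}
  {φmin φmax Γ B T : ℝ} {F : ℝ → E → E}

namespace RegularFlow

variable (H : RegularFlow μ Ω C φ b δ φmin φmax Γ B T F)
include H

lemma lintegral_weighted {g : E → ℝ} (hg : AEStronglyMeasurable g (μ.restrict Ω))
    (hg0 : ∀ᵐ x ∂μ.restrict Ω, 0 ≤ g x) (hi : IntegrableOn (fun x => g x * φ x) Ω μ) :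
    ∫⁻ x, ENNReal.ofReal (g x) ∂weighted μ Ω φ = ENNReal.ofReal (∫ x in Ω, g x * φ x ∂μ) := by
  have hφm : AEStronglyMeasurable φ (μ.restrict Ω) := H.aestronglyMeasurable_of_continuousOn H.φ_cont
  rw [weighted, lintegral_withDensity_eq_lintegral_mul₀ hφm.aemeasurable.ennreal_ofReal
    hg.aemeasurable.ennreal_ofReal, ofReal_integral_eq_lintegral_ofReal hi]
  · refine lintegral_congr_ae ?_
    filter_upwards [hg0] with x hx
    rw [Pi.mul_apply, ENNReal.ofReal_mul hx, mul_comm]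
  · filter_upwards [hg0, ae_restrict_mem H.isOpen.measurableSet] with x hx hx2
    exact mul_nonneg hx (H.φmin_pos.le.trans (H.φ_bd x hx2).1)

/-- The Lipschitz cutoffs `ψ k` vanish off `O` and equal `1` at distance at least `1 / (k + 1)` from
its complement. Starting points that end at this depth satisfy `1 ≤ g`, and Markov's inequality
turns the integral bound into a measure bound. -/
lemma weighted_reach_le_of_isOpen {y₀ : E} {ρ τ : ℝ} (hρ : 0 < ρ) (hτ0 : 0 ≤ τ) (hτ1 : τ ≤ 1)
    (hτT : τ ≤ T) (hτ : B * τ ≤ ρ / 2) (hst : Stable C b y₀ (3 * ρ)) (hΩ : ball y₀ (3 * ρ) ⊆ Ω)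
    {O : Set E} (hO : IsOpen O) (hOs : O ⊆ ball y₀ ρ) :
    weighted μ Ω φ (Reach C b τ O) ≤
      ENNReal.ofReal (Real.exp (Γ / φmin * τ)) * weighted μ Ω φ O := by
  have hδp : ∀ k : ℕ, (0 : ℝ) < 1 / ((k : ℝ) + 1) := fun k => by positivity
  set ψ : ℕ → E → ℝ := fun k x => 1 - (thickenedIndicator (hδp k) Oᶜ x : ℝ) with hψ
  have hti : ∀ k x, (thickenedIndicator (hδp k) Oᶜ x : ℝ) ≤ 1 := fun k x =>
    NNReal.coe_le_one.2 (thickenedIndicator_le_one _ _ _)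
  have hψ0 : ∀ k x, 0 ≤ ψ k x := fun k x => sub_nonneg.2 (hti k x)
  have hψ1 : ∀ k x, ψ k x ≤ 1 := fun k x => sub_le_self _ (NNReal.coe_nonneg _)
  have hψO : ∀ k x, x ∉ O → ψ k x = 0 := fun k x hx => by
    simp only [hψ]; rw [thickenedIndicator_one _ _ hx]; simp
  have hψL : ∀ k, ∃ L : ℝ≥0, LipschitzWith L (ψ k) := by
    intro k
    have h1 := lipschitzWith_thickenedIndicator (hδp k) Oᶜ
    refine ⟨(1 / ((k : ℝ) + 1)).toNNReal⁻¹, LipschitzWith.of_dist_le_mul fun x y => ?_⟩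
    have := h1.dist_le_mul x y
    rw [NNReal.dist_eq] at this
    rw [Real.dist_eq]
    simp only [hψ]
    rw [show (1 - (thickenedIndicator (hδp k) Oᶜ x : ℝ)) - (1 - (thickenedIndicator (hδp k) Oᶜ y : ℝ))
        = -((thickenedIndicator (hδp k) Oᶜ x : ℝ) - thickenedIndicator (hδp k) Oᶜ y) by ring, abs_neg]
    exact this
  set P : ℕ → Set E := fun k => {x | ∃ η : ℝ → E, IsChar C b 0 τ η ∧ η 0 = x ∧ η τ ∈ O ∧
    η τ ∉ thickening (1 / ((k : ℝ) + 1)) Oᶜ} with hP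
  have hPm : Monotone P := by
    rintro k l hkl x ⟨η, h1, h2, h3, h4⟩
    refine ⟨η, h1, h2, h3, fun h => h4 (thickening_mono ?_ _ h)⟩
    exact Nat.one_div_le_one_div hkl
  have hRP : Reach C b τ O ⊆ ⋃ k, P k := by
    rintro x ⟨η, h1, h2, h3⟩
    obtain ⟨r, hr, hrO⟩ := Metric.isOpen_iff.1 hO _ h3
    obtain ⟨k, hk⟩ := exists_nat_one_div_lt hr
    refine mem_iUnion.2 ⟨k, η, h1, h2, h3, fun h => ?_⟩
    obtain ⟨z, hz, hd⟩ := mem_thickening_iff.1 h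
    exact hz (hrO (by rw [mem_ball, dist_comm]; linarith))
  refine (measure_mono hRP).trans ?_
  -- Continuity from below along a monotone sequence requires no measurability of the sets `P k`.
  rw [hPm.measure_iUnion]
  refine iSup_le fun k => ?_
  obtain ⟨L, hL⟩ := hψL k
  obtain ⟨g, hgc, hgη, hint, hg0, hi1, hi2⟩ := H.exp_bound_of_lipschitz hρ hτ0 hτ1 hτT hτ hst hΩ hL
    (hψ0 k) (hψ1 k) (fun x hx => hψO k x fun h => hx (hOs h))
  calc weighted μ Ω φ (P k) ≤ weighted μ Ω φ {x | 1 ≤ ENNReal.ofReal (g x)} := by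
        refine measure_mono ?_
        rintro x ⟨η, h1, rfl, h3, h4⟩
        rw [mem_ofPred_eq, hgη η h1]
        simp only [hψ]
        rw [thickenedIndicator_zero _ _ h4]; simp
    _ ≤ ∫⁻ x, ENNReal.ofReal (g x) ∂weighted μ Ω φ := by
        have := mul_meas_ge_le_lintegral (μ := weighted μ Ω φ)
          (f := fun x => ENNReal.ofReal (g x)) (by fun_prop) 1
        rwa [one_mul] at this
    _ = ENNReal.ofReal (∫ x in Ω, g x * φ x ∂μ) :=
        H.lintegral_weighted hgc.aestronglyMeasurable hg0 hi1
    _ ≤ ENNReal.ofReal (Real.exp (Γ / φmin * τ) * ∫ x in Ω, ψ k x * φ x ∂μ) :=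
        ENNReal.ofReal_le_ofReal hint
    _ = ENNReal.ofReal (Real.exp (Γ / φmin * τ)) * ∫⁻ x, ENNReal.ofReal (ψ k x) ∂weighted μ Ω φ := by
        rw [ENNReal.ofReal_mul (Real.exp_pos _).le, H.lintegral_weighted
          hL.continuous.aestronglyMeasurable (Eventually.of_forall (hψ0 k)) hi2]
    _ ≤ _ := by
        gcongr
        rw [← lintegral_indicator_one hO.measurableSet]
        refine lintegral_mono fun x => ?_
        by_cases hx : x ∈ O
        · rw [indicator_of_mem hx]; simpa using hψ1 k x
        · rw [indicator_of_notMem hx, hψO k x hx]; simp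

/-- Outer regularity of the finite measure `weighted μ Ω φ`; the approximating open sets are cut by
the ball to remain in the stability region. -/
lemma weighted_reach_le {y₀ : E} {ρ τ : ℝ} (hρ : 0 < ρ) (hτ0 : 0 ≤ τ) (hτ1 : τ ≤ 1)
    (hτT : τ ≤ T) (hτ : B * τ ≤ ρ / 2) (hst : Stable C b y₀ (3 * ρ)) (hΩ : ball y₀ (3 * ρ) ⊆ Ω)
    {A : Set E} (hA : A ⊆ ball y₀ ρ) :
    weighted μ Ω φ (Reach C b τ A) ≤
      ENNReal.ofReal (Real.exp (Γ / φmin * τ)) * weighted μ Ω φ A := by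
  have := H.isFiniteMeasure_weighted
  rw [A.measure_eq_iInf_isOpen (weighted μ Ω φ), ENNReal.mul_iInf_of_ne (by simp [Real.exp_pos]) (by simp)]
  refine le_iInf fun O => ?_
  rw [ENNReal.mul_iInf_of_ne (by simp [Real.exp_pos]) (by simp)]
  refine le_iInf fun hAO => ?_
  rw [ENNReal.mul_iInf_of_ne (by simp [Real.exp_pos]) (by simp)]
  refine le_iInf fun hO => ?_
  calc _ ≤ weighted μ Ω φ (Reach C b τ (O ∩ ball y₀ ρ)) :=
        measure_mono (Reach.mono (subset_inter hAO hA))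
    _ ≤ _ := H.weighted_reach_le_of_isOpen hρ hτ0 hτ1 hτT hτ hst hΩ (hO.inter isOpen_ball)
        inter_subset_right
    _ ≤ _ := by gcongr; exact inter_subset_left

/-- The short-time bound is iterated backwards along `γ`. Backward stability confines each
intermediate set of starting points to a small ball around `γ`, and the exponential factors
multiply. -/
lemma exists_weighted_reach_le {γ : ℝ → E} {t : ℝ} (ht : 0 ≤ t) (hγ : IsChar C b 0 t γ)
    (hg : ∀ s ∈ Icc 0 t, γ s ∈ goodSet Ω C b) :
    ∃ r > 0, ∀ A ⊆ ball (γ t) r, weighted μ Ω φ (Reach C b t A) ≤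
      ENNReal.ofReal (Real.exp (Γ / φmin * t)) * weighted μ Ω φ A := by
  obtain ⟨ρ₀, hρ₀, hgood⟩ := exists_uniform_good (isCompact_Icc.image_of_continuousOn hγ.cont)
    (by rintro _ ⟨s, hs, rfl⟩; exact hg s hs)
  replace hgood : ∀ s ∈ Icc 0 t, Good Ω C b ρ₀ (γ s) := fun s hs => hgood _ ⟨s, hs, rfl⟩
  set ρ := ρ₀ / 3 with hρdef
  have hρ : 0 < ρ := by positivity
  have h3ρ : 3 * ρ = ρ₀ := by rw [hρdef]; ring
  -- Applied to reversed curves: a characteristic that ends within `r` of `γ t` is within `ρ` of `γ`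
  -- at all earlier times.
  obtain ⟨r, hr, hclose⟩ := exists_close H.neg.b_bd H.B_nonneg hγ.reverse hρ₀
    (fun s hs => (hgood (t - s) ⟨by linarith [hs.2], by linarith [hs.1]⟩).2.2) ρ hρ
  refine ⟨r, hr, ?_⟩
  -- Every step of length at most `τ` satisfies the three smallness conditions of
  -- `weighted_reach_le`.
  set τ := min (min 1 T) (ρ / (2 * (B + 1))) with hτ
  have hB := H.B_nonneg
  have hτ0 : 0 < τ := lt_min (lt_min one_pos H.T_pos) (by positivity)
  obtain ⟨n, hn⟩ := exists_nat_gt (t / τ)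
  have hn0 : (0 : ℝ) < n := lt_of_le_of_lt (by positivity) hn
  set h := t / n with hh
  have hh0 : 0 ≤ h := by positivity
  have hhτ : h ≤ τ := by
    rw [hh, div_le_iff₀ hn0]; rw [div_lt_iff₀ hτ0] at hn; linarith
  have hnh : n * h = t := by rw [hh]; field_simp
  have hBh : B * h ≤ ρ / 2 := by
    calc B * h ≤ (B + 1) * (ρ / (2 * (B + 1))) := by
          gcongr
          · linarith
          · exact hhτ.trans (min_le_right _ _)
      _ = ρ / 2 := by field_simp
  have main : ∀ k : ℕ, k ≤ n → ∀ A ⊆ ball (γ t) r, weighted μ Ω φ (Reach C b (k * h) A) ≤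
      ENNReal.ofReal (Real.exp (Γ / φmin * (k * h))) * weighted μ Ω φ A := by
    intro k
    induction k with
    | zero =>
      intro _ A _
      simp only [Nat.cast_zero, zero_mul, mul_zero, Real.exp_zero, ENNReal.ofReal_one, one_mul]
      refine measure_mono ?_
      rintro x ⟨η, _, rfl, h⟩
      exact h
    | succ k ih =>
      intro hk A hA
      have hkn : (k : ℝ) * h + h ≤ t := by
        rw [← hnh]
        have : (k : ℝ) + 1 ≤ n := by exact_mod_cast hk
        nlinarith
      have hk0 : 0 ≤ (k : ℝ) * h := by positivity
      have hgk := hgood (t - k * h) ⟨by linarith, by linarith⟩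
      rw [← h3ρ] at hgk
      have hsub : Reach C b (k * h) A ⊆ ball (γ (t - k * h)) ρ := by
        rintro x ⟨η, hη, rfl, hηA⟩
        have := hclose (k * h) ⟨hk0, by linarith⟩ _ hη.reverse
          (by simpa using hA hηA) (k * h) ⟨hk0, le_rfl⟩
        simpa using this
      have heq : ((k + 1 : ℕ) : ℝ) * h = h + k * h := by push_cast; ring
      rw [heq]
      calc _ ≤ weighted μ Ω φ (Reach C b h (Reach C b (k * h) A)) :=
            measure_mono (reach_add_subset hh0 hk0 A)
        _ ≤ ENNReal.ofReal (Real.exp (Γ / φmin * h)) * weighted μ Ω φ (Reach C b (k * h) A) :=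
            H.weighted_reach_le hρ hh0 (hhτ.trans ((min_le_left _ _).trans (min_le_left _ _)))
              (hhτ.trans ((min_le_left _ _).trans (min_le_right _ _))) hBh hgk.2.1 hgk.1 hsub
        _ ≤ ENNReal.ofReal (Real.exp (Γ / φmin * h)) *
            (ENNReal.ofReal (Real.exp (Γ / φmin * (k * h))) * weighted μ Ω φ A) := by
            gcongr; exact ih (Nat.le_of_succ_le hk) A hA
        _ = _ := by
            rw [← mul_assoc, ← ENNReal.ofReal_mul (Real.exp_pos _).le, ← Real.exp_add, ← mul_add]
  have := main n le_rfl
  rwa [hnh] at this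

/-- Transport by characteristics that remain in the good set increases the measure of a set by at
most an exponential factor. -/
lemma weighted_goodReach_le {t : ℝ} (ht : 0 ≤ t) (A : Set E) :
    weighted μ Ω φ (GoodReach Ω C b t A) ≤
      ENNReal.ofReal (Real.exp (Γ / φmin * t)) * weighted μ Ω φ A := by
  set c := ENNReal.ofReal (Real.exp (Γ / φmin * t)) with hc
  set Y : Set E := {y | ∃ η, IsChar C b 0 t η ∧ η t = y ∧ ∀ s ∈ Icc 0 t, η s ∈ goodSet Ω C b} with hY
  have hex : ∀ y : Y, ∃ r > 0, ∀ A ⊆ ball (y : E) r, weighted μ Ω φ (Reach C b t A) ≤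
      c * weighted μ Ω φ A := by
    rintro ⟨y, η, h1, rfl, h3⟩
    exact H.exists_weighted_reach_le ht h1 h3
  choose r hr hrA using hex
  -- The local bounds are glued by the Lindelöf property. The countable cover is then made disjoint,
  -- so that no multiplicity enters the constant.
  obtain ⟨S, hS, hSU⟩ := TopologicalSpace.isOpen_iUnion_countable (fun y : Y => ball (y : E) (r y))
    (fun y => isOpen_ball)
  obtain ⟨U, hU, hcov⟩ : ∃ U : ℕ → Set E, (∀ n, IsOpen (U n) ∧ ∀ A ⊆ U n,
      weighted μ Ω φ (Reach C b t A) ≤ c * weighted μ Ω φ A) ∧ Y ⊆ ⋃ n, U n := by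
    have hYs : Y ⊆ ⋃ y ∈ S, ball (y : E) (r y) := by
      rw [hSU]; exact fun y hy => mem_iUnion.2 ⟨⟨y, hy⟩, mem_ball_self (hr _)⟩
    rcases S.eq_empty_or_nonempty with rfl | hne
    · refine ⟨fun _ => ∅, fun n => ⟨isOpen_empty, fun A hA => ?_⟩, by simpa using hYs⟩
      have : Reach C b t A = ∅ := by
        rw [subset_empty_iff.1 hA]
        exact eq_empty_of_forall_notMem fun x ⟨_, _, _, h⟩ => h
      rw [this]; simp
    · obtain ⟨e, rfl⟩ := hS.exists_eq_range hne
      refine ⟨fun n => ball (e n : E) (r (e n)), fun n => ⟨isOpen_ball, hrA _⟩, ?_⟩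
      rwa [biUnion_range] at hYs
  have hdm : ∀ n, MeasurableSet (disjointed U n) :=
    fun n => MeasurableSet.disjointed (fun n => (hU n).1.measurableSet) n
  calc weighted μ Ω φ (GoodReach Ω C b t A)
      ≤ weighted μ Ω φ (⋃ n, Reach C b t (A ∩ disjointed U n)) := by
        refine measure_mono ?_
        rintro x ⟨η, h1, h2, h3, h4⟩
        have : η t ∈ ⋃ n, disjointed U n := by
          rw [iUnion_disjointed]; exact hcov ⟨η, h1, rfl, h4⟩
        obtain ⟨n, hn⟩ := mem_iUnion.1 this
        exact mem_iUnion.2 ⟨n, η, h1, h2, h3, hn⟩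
    _ ≤ ∑' n, weighted μ Ω φ (Reach C b t (A ∩ disjointed U n)) := measure_iUnion_le _
    _ ≤ ∑' n, c * weighted μ Ω φ (A ∩ disjointed U n) :=
        ENNReal.tsum_le_tsum fun n => (hU n).2 _ (inter_subset_right.trans (disjointed_subset U n))
    -- `A` may fail to be measurable, but the pieces of the cover are measurable, and the
    -- restriction to `A` is countably additive on them.
    _ = c * ∑' n, (weighted μ Ω φ).restrict A (disjointed U n) := by
        rw [ENNReal.tsum_mul_left]
        congr 2
        ext n
        rw [Measure.restrict_apply (hdm n), inter_comm]
    _ = c * (weighted μ Ω φ).restrict A (⋃ n, disjointed U n) := by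
        rw [measure_iUnion (disjoint_disjointed U) hdm]
    _ ≤ c * weighted μ Ω φ A := by
        refine mul_le_mul_right ?_ c
        rw [Measure.restrict_apply (MeasurableSet.iUnion hdm)]
        exact measure_mono inter_subset_right

end RegularFlow

end Reach

/-! ### Almost every trajectory avoids the bad points. -/

section Avoid

variable {E : Type*} [NormedAddCommGroup E] [InnerProductSpace ℝ E] [FiniteDimensional ℝ E]
  [MeasurableSpace E] [BorelSpace E]

/-- Volume of the part of a ball where `k` independent affine functions are small. -/
lemma exists_measure_slab_le (μ : Measure E) [μ.IsAddHaarMeasure] {k : ℕ} {v : Fin k → E}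
    (hv : LinearIndependent ℝ v) (c : Fin k → ℝ) (R : ℝ) :
    ∃ K : ℝ≥0, ∀ w : ℝ, 0 ≤ w →
      μ {x | ‖x‖ ≤ R ∧ ∀ i, |inner ℝ (v i) x - c i| ≤ w} ≤ K * ENNReal.ofReal w ^ k := by
  classical
  set bs := Module.Basis.sumExtend hv with hbs
  have hfin : Finite (Fin k ⊕ Module.Basis.sumExtendIndex hv) := Module.Finite.finite_basis bs
  have : Finite (Module.Basis.sumExtendIndex hv) := Finite.sum_right (Fin k)
  have := Fintype.ofFinite (Module.Basis.sumExtendIndex hv)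
  have hbv : ∀ i, bs (Sum.inl i) = v i := fun i => by
    simp only [hbs, Module.Basis.sumExtend, Module.Basis.coe_reindex, Module.Basis.coe_extend,
      Function.comp_apply]
    rfl
  -- Inner products with a basis completing `v` are linear coordinates. In them the set lies in a
  -- box with `k` sides of length `2 * w` and the others bounded in terms of `R`.
  set Φ₀ : E →ₗ[ℝ] (Fin k ⊕ Module.Basis.sumExtendIndex hv → ℝ) :=
    LinearMap.pi fun j => (innerSL ℝ (bs j)).toLinearMap with hΦ₀
  have hinj : Function.Injective Φ₀ := by
    refine (injective_iff_map_eq_zero Φ₀).2 fun x hx => ?_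
    refine InnerProductSpace.ext_inner_left_basis bs fun j => ?_
    rw [inner_zero_right]
    exact congrFun hx j
  have hdim : Module.finrank ℝ E = Module.finrank ℝ (Fin k ⊕ Module.Basis.sumExtendIndex hv → ℝ) := by
    rw [Module.finrank_fintype_fun_eq_card, Module.finrank_eq_card_basis bs]
  set Φ : E ≃L[ℝ] (Fin k ⊕ Module.Basis.sumExtendIndex hv → ℝ) :=
    (LinearEquiv.ofInjectiveOfFinrankEq Φ₀ hinj hdim).toContinuousLinearEquiv with hΦ
  have hΦa : ∀ x j, Φ x j = inner ℝ (bs j) x := fun x j => rfl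
  have hhaar : (μ.map Φ).IsAddHaarMeasure := Φ.isAddHaarMeasure_map μ
  set a : ℝ≥0 := Measure.addHaarScalarFactor (μ.map Φ) volume with ha
  have hmap : μ.map Φ = a • volume := Measure.isAddLeftInvariant_eq_smul _ _
  refine ⟨a * (2 ^ k * ∏ j : Module.Basis.sumExtendIndex hv,
    (‖bs (Sum.inr j)‖ * R - -(‖bs (Sum.inr j)‖ * R)).toNNReal), fun w hw => ?_⟩
  set lo : Fin k ⊕ Module.Basis.sumExtendIndex hv → ℝ :=
    Sum.elim (fun i => c i - w) (fun j => -(‖bs (Sum.inr j)‖ * R)) with hlo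
  set hi : Fin k ⊕ Module.Basis.sumExtendIndex hv → ℝ :=
    Sum.elim (fun i => c i + w) (fun j => ‖bs (Sum.inr j)‖ * R) with hhi
  calc μ {x | ‖x‖ ≤ R ∧ ∀ i, |inner ℝ (v i) x - c i| ≤ w}
      ≤ μ (Φ ⁻¹' (Icc lo hi)) := by
        refine measure_mono ?_
        rintro x ⟨hx1, hx2⟩
        have key : ∀ j, lo j ≤ Φ x j ∧ Φ x j ≤ hi j := by
          rintro (i | j)
          · have := abs_le.1 (hx2 i)
            rw [hΦa, hbv]
            exact ⟨by simp only [hlo, Sum.elim_inl]; linarith, by simp only [hhi, Sum.elim_inl]; linarith⟩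
          · have := abs_le.1 ((abs_real_inner_le_norm (bs (Sum.inr j)) x).trans
              (mul_le_mul_of_nonneg_left hx1 (norm_nonneg _)))
            exact this
        exact ⟨fun j => (key j).1, fun j => (key j).2⟩
    _ = μ.map Φ (Icc lo hi) := (Measure.map_apply Φ.continuous.measurable measurableSet_Icc).symm
    _ = a * volume (Icc lo hi) := by rw [hmap]; rfl
    _ = _ := by
        rw [Real.volume_Icc_pi, Fintype.prod_sum_type]
        simp only [hlo, hhi, Sum.elim_inl, Sum.elim_inr]
        have : ∀ i : Fin k, c i + w - (c i - w) = 2 * w := fun i => by ring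
        simp only [this, Finset.prod_const, Finset.card_univ, Fintype.card_fin]
        rw [ENNReal.ofReal_mul zero_le_two, mul_pow]
        push_cast
        have hcoe : ∀ x : ℝ, ((x.toNNReal : ℝ≥0) : ℝ≥0∞) = ENNReal.ofReal x := fun _ => rfl
        simp only [hcoe]
        rw [ENNReal.ofReal_ofNat]
        ring

variable {Ω C : Set E} {b : E → E}
variable {μ : Measure E} [μ.IsAddHaarMeasure] {φ : E → ℝ} {δ : E → ℝ}
  {φmin φmax Γ B T : ℝ} {F : ℝ → E → E}

/-- Points whose characteristics `η` leave the good set for the first time at a time `t ≤ T` with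
`p η t`. -/
def ExitReach (Ω C : Set E) (b : E → E) (T : ℝ) (p : (ℝ → E) → ℝ → Prop) : Set E :=
  {x | ∃ η : ℝ → E, ∃ t ∈ Ioc 0 T, η 0 = x ∧ IsChar C b 0 t η ∧
    (∀ s ∈ Ico 0 t, η s ∈ goodSet Ω C b) ∧ p η t}

namespace RegularFlow

variable (H : RegularFlow μ Ω C φ b δ φmin φmax Γ B T F)
include H

/-- Chebyshev-type argument: exits which are preceded by a stay of duration `ε` in a set of measure
`O(ε²)` are negligible. -/
lemma weighted_exitReach_eq_zero {p : (ℝ → E) → ℝ → Prop} {K : ℝ≥0} {ε₀ : ℝ} (hε₀ : 0 < ε₀)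
    (hA : ∀ ε, 0 < ε → ε < ε₀ → ∃ A : Set E,
      weighted μ Ω φ A ≤ K * ENNReal.ofReal ε ^ 2 ∧
      ∀ η t, t ∈ Ioc 0 T → IsChar C b 0 t η → (∀ s ∈ Ico 0 t, η s ∈ goodSet Ω C b) → p η t →
        ∀ s ∈ Ico 0 t, t - ε ≤ s → η s ∈ A) :
    weighted μ Ω φ (ExitReach Ω C b T p) = 0 := by
  have hT := H.T_pos
  set M : ℝ≥0 := (Real.exp (Γ / φmin * T)).toNNReal with hM
  have key : ∀ ε, 0 < ε → ε < ε₀ → weighted μ Ω φ (ExitReach Ω C b T p) ≤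
      ENNReal.ofReal ((T + ε) * M * K * ε) := by
    intro ε hε hεε
    obtain ⟨A, hνA, hA⟩ := hA ε hε hεε
    have hNT : (⌈T / ε⌉₊ : ℝ) * ε ≤ T + ε := by
      have := (Nat.ceil_lt_add_one (show 0 ≤ T / ε by positivity)).le
      calc (⌈T / ε⌉₊ : ℝ) * ε ≤ (T / ε + 1) * ε := by gcongr
        _ = T + ε := by field_simp
    -- At the last grid time before its exit, the curve lies in `A`. The clause `k * ε ≤ T` keeps
    -- the expansion factor below `M`; when it fails the set is empty.
    have hcov : ExitReach Ω C b T p ⊆ ⋃ k ∈ Finset.range ⌈T / ε⌉₊,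
        {x | x ∈ GoodReach Ω C b (k * ε) A ∧ k * ε ≤ T} := by
      rintro x ⟨η, t, ht, h0, hη, hg, hp⟩
      have hk0 : 0 < ⌈t / ε⌉₊ := Nat.ceil_pos.2 (div_pos ht.1 hε)
      -- The largest `k` with `k * ε < t`, which gives `t - ε ≤ k * ε` as well.
      set k := ⌈t / ε⌉₊ - 1 with hk
      have hk1 : k < ⌈t / ε⌉₊ := by omega
      have hkt : k * ε < t := (lt_div_iff₀ hε).1 (Nat.lt_ceil.1 hk1)
      have hkt2 : t - ε ≤ k * ε := by
        have := Nat.le_ceil (t / ε)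
        rw [show ⌈t / ε⌉₊ = k + 1 by omega, div_le_iff₀ hε] at this
        push_cast at this
        linarith
      have hk00 : 0 ≤ (k : ℝ) * ε := by positivity
      have hkN : k < ⌈T / ε⌉₊ := hk1.trans_le (Nat.ceil_mono (by gcongr; exact ht.2))
      refine mem_biUnion (Finset.mem_coe.2 (Finset.mem_range.2 hkN)) ⟨⟨η, hη.sub le_rfl hkt.le, h0,
        hA η t ht hη hg hp _ ⟨hk00, hkt⟩ hkt2, fun s hs => hg s ⟨hs.1, hs.2.trans_lt hkt⟩⟩,
        hkt.le.trans ht.2⟩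
    calc weighted μ Ω φ (ExitReach Ω C b T p)
        ≤ ∑ k ∈ Finset.range ⌈T / ε⌉₊,
            weighted μ Ω φ {x | x ∈ GoodReach Ω C b (k * ε) A ∧ k * ε ≤ T} :=
          (measure_mono hcov).trans (measure_biUnion_finset_le _ _)
      _ ≤ ∑ k ∈ Finset.range ⌈T / ε⌉₊, (M : ℝ≥0∞) * (K * ENNReal.ofReal ε ^ 2) := by
          refine Finset.sum_le_sum fun k _ => ?_
          by_cases hkT : (k : ℝ) * ε ≤ T
          · calc _ ≤ weighted μ Ω φ (GoodReach Ω C b (k * ε) A) := measure_mono fun x hx => hx.1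
              _ ≤ _ := H.weighted_goodReach_le (by positivity) A
              _ ≤ _ := by
                refine mul_le_mul' (ENNReal.ofReal_le_ofReal ?_) hνA
                have : 0 ≤ Γ / φmin := div_nonneg H.Γ_nonneg H.φmin_pos.le
                gcongr
          · simp [hkT]
      _ = ENNReal.ofReal (⌈T / ε⌉₊ * (M * (K * ε ^ 2))) := by
          rw [Finset.sum_const, Finset.card_range, nsmul_eq_mul,
            ENNReal.ofReal_mul (by positivity), ENNReal.ofReal_mul (by positivity),
            ENNReal.ofReal_mul (by positivity), ENNReal.ofReal_pow hε.le]
          simp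
      _ ≤ _ := by
          refine ENNReal.ofReal_le_ofReal ?_
          calc _ = (⌈T / ε⌉₊ * ε) * M * K * ε := by ring
            _ ≤ _ := by gcongr
  have hlim : Tendsto (fun ε : ℝ => ENNReal.ofReal ((T + ε) * M * K * ε)) (𝓝[>] 0) (𝓝 0) := by
    have : Continuous fun ε : ℝ => ENNReal.ofReal ((T + ε) * M * K * ε) :=
      ENNReal.continuous_ofReal.comp (by fun_prop)
    have h := this.tendsto 0
    simp only [mul_zero, ENNReal.ofReal_zero] at h
    exact h.mono_left nhdsWithin_le_nhds
  refine le_antisymm (ge_of_tendsto hlim ?_) bot_le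
  filter_upwards [Ioo_mem_nhdsGT hε₀] with ε hε using key ε hε.1 hε.2

lemma exists_norm_le : ∃ R, 0 ≤ R ∧ ∀ x ∈ Ω, ‖x‖ ≤ R := by
  obtain ⟨R, hR⟩ := H.bdd.exists_norm_le
  exact ⟨|R|, abs_nonneg _, fun x hx => (hR x hx).trans (le_abs_self R)⟩

lemma exists_weighted_slab_le {k : ℕ} {v : Fin k → E} (hv : LinearIndependent ℝ v)
    (c : Fin k → ℝ) : ∃ K : ℝ≥0, ∀ w : ℝ, 0 ≤ w →
      weighted μ Ω φ {x | x ∈ Ω ∧ ∀ i, |inner ℝ (v i) x - c i| ≤ w} ≤ K * ENNReal.ofReal w ^ k := by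
  obtain ⟨R, -, hR⟩ := H.exists_norm_le
  obtain ⟨K, hK⟩ := exists_measure_slab_le μ hv c R
  refine ⟨φmax.toNNReal * K, fun w hw => ?_⟩
  calc _ ≤ ENNReal.ofReal φmax * μ.restrict Ω {x | x ∈ Ω ∧ ∀ i, |inner ℝ (v i) x - c i| ≤ w} :=
        H.weighted_le _
    _ ≤ ENNReal.ofReal φmax * μ {x | ‖x‖ ≤ R ∧ ∀ i, |inner ℝ (v i) x - c i| ≤ w} := by
        refine mul_le_mul_right ((Measure.restrict_apply_le _ _).trans (measure_mono ?_)) _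
        exact fun x hx => ⟨hR x hx.1, hx.2⟩
    _ ≤ _ := by
        rw [ENNReal.coe_mul, mul_assoc]
        exact mul_le_mul_right (hK w hw) _

/-- During the last `ε` units of time the curve is within `B * ε` of both hyperplanes, and two
transverse slabs of this width meet in a set of measure `O(ε²)`. -/
lemma weighted_exit_codim_two {n m : E} (hnm : LinearIndependent ℝ ![n, m]) (c d : ℝ)
    (hn : ‖n‖ = 1) (hm : ‖m‖ = 1) :
    weighted μ Ω φ (ExitReach Ω C b T fun η t => inner ℝ n (η t) = c ∧ inner ℝ m (η t) = d) = 0 := by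
  obtain ⟨K, hK⟩ := H.exists_weighted_slab_le hnm ![c, d]
  have hB := H.B_nonneg
  refine H.weighted_exitReach_eq_zero (K := K * B.toNNReal ^ 2) one_pos fun ε hε _ =>
    ⟨_, (hK (B * ε) (by positivity)).trans (le_of_eq ?_), ?_⟩
  · rw [ENNReal.ofReal_mul hB, mul_pow]
    push_cast
    rw [mul_assoc]; rfl
  · rintro η t ht hη hg ⟨h1, h2⟩ s hs hst
    obtain ⟨ρ, hρ, hgs⟩ := hg s hs
    refine ⟨hgs.1 (mem_ball_self hρ), ?_⟩
    have hd : ‖η s - η t‖ ≤ B * ε := by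
      rw [← dist_eq_norm]
      refine (hη.dist_le H.b_bd ⟨hs.1, hs.2.le⟩ ⟨ht.1.le, le_rfl⟩).trans ?_
      refine mul_le_mul_of_nonneg_left ?_ hB
      rw [abs_le]; constructor <;> linarith [hs.2]
    have hin : ∀ q : E, ‖q‖ = 1 → |inner ℝ q (η s) - inner ℝ q (η t)| ≤ B * ε := by
      intro q hq
      rw [← inner_sub_right]
      refine (abs_real_inner_le_norm _ _).trans ?_
      rw [hq, one_mul]; exact hd
    intro i
    fin_cases i
    · have := hin n hn
      rw [h1] at this
      exact this
    · have := hin m hm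
      rw [h2] at this
      exact this

/-- During the last `ε` units of time the curve is within `B * ε` of its exit point, so its normal
speed is at most `L * B * ε` and its distance to the hyperplane at most `L * B * ε²`. One slab then
suffices. -/
lemma weighted_exit_tangential {n : E} (hn : ‖n‖ = 1) (c : ℝ) {L r : ℝ} (hL : 0 ≤ L) (hr : 0 < r) :
    weighted μ Ω φ (ExitReach Ω C b T fun η t => inner ℝ n (η t) = c ∧
      ∀ x ∈ C, x ∈ ball (η t) r → |inner ℝ n (b x)| ≤ L * ‖x - η t‖) = 0 := by
  have hlin : LinearIndependent ℝ ![n] := by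
    refine linearIndependent_unique_iff.2 fun h => ?_
    have : n = 0 := h
    rw [this, norm_zero] at hn
    exact zero_ne_one hn
  obtain ⟨K, hK⟩ := H.exists_weighted_slab_le hlin ![c]
  have hB := H.B_nonneg
  -- Below this threshold the final portion of the curve stays in the ball where the tangency bound
  -- holds.
  have hε₀ : 0 < r / (B + 1) := by positivity
  refine H.weighted_exitReach_eq_zero (K := K * (L * B).toNNReal) hε₀ fun ε hε hεr =>
    ⟨_, (hK (L * B * ε ^ 2) (by positivity)).trans (le_of_eq ?_), ?_⟩
  · rw [ENNReal.ofReal_mul (by positivity), ENNReal.ofReal_pow hε.le, pow_one]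
    push_cast
    rw [mul_assoc]; rfl
  · rintro η t ht hη hg ⟨h1, h2⟩ s hs hst
    obtain ⟨ρ, hρ, hgs⟩ := hg s hs
    refine ⟨hgs.1 (mem_ball_self hρ), fun i => ?_⟩
    have hi : i = 0 := Subsingleton.elim _ _
    subst hi
    have hd : ∀ q ∈ Icc s t, ‖η q - η t‖ ≤ B * ε := by
      intro q hq
      rw [← dist_eq_norm]
      refine (hη.dist_le H.b_bd ⟨hs.1.trans hq.1, hq.2⟩ ⟨ht.1.le, le_rfl⟩).trans ?_
      refine mul_le_mul_of_nonneg_left ?_ hB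
      rw [abs_le]; constructor <;> linarith [hq.1, hq.2]
    have hBε : B * ε < r := by
      rw [lt_div_iff₀ (by linarith)] at hεr
      nlinarith
    obtain ⟨hc, N, hN, hode⟩ := hη.sub (a' := s) (c' := t) hs.1 le_rfl
    have := norm_sub_le_of_bounded_deriv_off_countable (γ := fun q => inner ℝ n (η q))
      (v := fun q => inner ℝ n (b (η q))) (C := L * (B * ε)) hs.2.le (by fun_prop) hN
      (fun q hq hqN => ?_)
    · rw [Real.norm_eq_abs, abs_sub_comm, h1] at this
      refine this.trans ?_
      calc L * (B * ε) * (t - s) ≤ L * (B * ε) * ε := by gcongr; linarith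
        _ = _ := by ring
    · obtain ⟨k1, k2⟩ := hode q hq hqN
      refine ⟨(innerSL ℝ n).hasFDerivAt.comp_hasDerivAt q k2, ?_⟩
      have hdq := hd q ⟨hq.1.le, hq.2.le⟩
      refine (h2 _ k1 ?_).trans (mul_le_mul_of_nonneg_left hdq hL)
      rw [mem_ball, dist_eq_norm]
      exact hdq.trans_lt hBε

/-- If the bad points either lie on two transverse hyperplanes of a finite family or are points of
tangency with one of them, then almost every trajectory remains in the good set. -/
lemma ae_mem_goodSet {S : Finset (E × ℝ)} (hS : ∀ p ∈ S, ‖p.1‖ = 1) {L : ℝ} (hL : 0 ≤ L)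
    (hC : C ⊆ goodSet Ω C b)
    (hbad : ∀ y ∈ Ω, y ∉ goodSet Ω C b →
      (∃ p ∈ S, ∃ q ∈ S, LinearIndependent ℝ ![p.1, q.1] ∧ inner ℝ p.1 y = p.2 ∧
        inner ℝ q.1 y = q.2) ∨
      (∃ p ∈ S, inner ℝ p.1 y = p.2 ∧ ∃ r > 0, ∀ x ∈ C, x ∈ ball y r →
        |inner ℝ p.1 (b x)| ≤ L * ‖x - y‖)) :
    ∀ᵐ x ∂μ.restrict Ω, ∀ t ∈ Icc 0 T, F t x ∈ goodSet Ω C b := by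
  have hac : ∀ P : Set E, weighted μ Ω φ P = 0 → ∀ᵐ x ∂μ.restrict Ω, x ∉ P := by
    intro P hP
    have := H.le_weighted P
    rw [hP, nonpos_iff_eq_zero, mul_eq_zero] at this
    refine measure_eq_zero_iff_ae_notMem.1 (this.resolve_left ?_)
    simpa using H.φmin_pos
  have h1 : ∀ᵐ x ∂μ.restrict Ω, ∀ p ∈ S, ∀ q ∈ S, LinearIndependent ℝ ![p.1, q.1] →
      x ∉ ExitReach Ω C b T fun η t => inner ℝ p.1 (η t) = p.2 ∧ inner ℝ q.1 (η t) = q.2 := by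
    refine (Finset.eventually_all S).2 fun p hp => (Finset.eventually_all S).2 fun q hq => ?_
    by_cases hl : LinearIndependent ℝ ![p.1, q.1]
    · filter_upwards [hac _ (H.weighted_exit_codim_two hl p.2 q.2 (hS p hp) (hS q hq))] with x hx _
        using hx
    · exact Eventually.of_forall fun x h => absurd h hl
  -- The radius of the tangency bound depends on the bad point; restricting it to the values `1 / (k
  -- + 1)` leaves countably many null sets.
  have h2 : ∀ᵐ x ∂μ.restrict Ω, ∀ p ∈ S, ∀ k : ℕ,
      x ∉ ExitReach Ω C b T fun η t => inner ℝ p.1 (η t) = p.2 ∧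
        ∀ x ∈ C, x ∈ ball (η t) (1 / ((k : ℝ) + 1)) → |inner ℝ p.1 (b x)| ≤ L * ‖x - η t‖ := by
    refine (Finset.eventually_all S).2 fun p hp => ae_all_iff.2 fun k => ?_
    exact hac _ (H.weighted_exit_tangential (hS p hp) p.2 hL (by positivity))
  have hT := H.T_pos
  filter_upwards [h1, h2, H.flow, H.ae_mem_cells] with x k1 k2 ⟨hx0, hxΩ, hxc⟩ hxC
  by_contra hcon
  push Not at hcon
  obtain ⟨t₁, ht₁, hbad₁⟩ := hcon
  have hcont : ContinuousOn (fun t => F t x) (Icc 0 T) :=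
    hxc.cont.mono (Icc_subset_Icc_left (by linarith))
  -- The good set is open, so there is a first bad time. It is positive because the starting point
  -- lies in `C`.
  set Z : Set ℝ := Icc 0 T ∩ (fun t => F t x) ⁻¹' (goodSet Ω C b)ᶜ with hZ
  have hZc : IsCompact Z := by
    refine isCompact_Icc.of_isClosed_subset ?_ inter_subset_left
    exact hcont.preimage_isClosed_of_isClosed isClosed_Icc isOpen_goodSet.isClosed_compl
  obtain ⟨t, htZ, htmin⟩ := hZc.exists_isLeast ⟨t₁, ht₁, hbad₁⟩
  have ht0 : 0 < t := by
    refine lt_of_le_of_ne htZ.1.1 fun h => htZ.2 ?_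
    change F t x ∈ _
    rw [← h, hx0]; exact hC hxC
  have hη : IsChar C b 0 t (fun t => F t x) := hxc.sub (by linarith) htZ.1.2
  have hgood : ∀ s ∈ Ico 0 t, F s x ∈ goodSet Ω C b := by
    intro s hs
    by_contra h
    exact absurd (htmin ⟨⟨hs.1, hs.2.le.trans htZ.1.2⟩, h⟩) (not_le.2 hs.2)
  rcases hbad (F t x) (hxΩ t ⟨by linarith, htZ.1.2⟩) htZ.2 with
    ⟨p, hp, q, hq, hl, e1, e2⟩ | ⟨p, hp, e1, r, hr, e2⟩
  · exact k1 p hp q hq hl ⟨_, t, ⟨ht0, htZ.1.2⟩, hx0, hη, hgood, e1, e2⟩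
  · obtain ⟨k, hk⟩ := exists_nat_one_div_lt hr
    exact k2 p hp k ⟨_, t, ⟨ht0, htZ.1.2⟩, hx0, hη, hgood, e1, fun y hy hyb =>
      e2 y hy (ball_subset_ball hk.le hyb)⟩

end RegularFlow

end Avoid

/-! ### Measurability of the flow and compression of Lebesgue measure. -/

section Transport

variable {E : Type*} [NormedAddCommGroup E] [InnerProductSpace ℝ E] [FiniteDimensional ℝ E]
  [MeasurableSpace E] [BorelSpace E]
variable {Ω C : Set E} {b : E → E}
variable {μ : Measure E} [μ.IsAddHaarMeasure] {φ : E → ℝ} {δ : E → ℝ}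
  {φmin φmax Γ B T : ℝ} {F : ℝ → E → E}

namespace RegularFlow

variable (H : RegularFlow μ Ω C φ b δ φmin φmax Γ B T F)
include H

variable (hgood : ∀ᵐ x ∂μ.restrict Ω, ∀ t ∈ Icc 0 T, F t x ∈ goodSet Ω C b)
include hgood

/-- The exponential of `flowConst` is the expansion of `φ dx`; passing from `dx` to `φ dx` and back
costs `φmax / φmin`. -/
lemma measure_preimage_flow_le {s : ℝ} (hs : s ∈ Icc 0 T) (A : Set E) :
    μ.restrict Ω {x | F s x ∈ A} ≤ ENNReal.ofReal (flowConst φmin φmax Γ T) * μ.restrict Ω A := by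
  have hT := H.T_pos
  have h1 : μ.restrict Ω {x | F s x ∈ A} ≤ μ.restrict Ω (GoodReach Ω C b s A) := by
    refine measure_mono_ae ?_
    filter_upwards [hgood, H.flow] with x h1 ⟨h2, h3, h4⟩ hx
    exact ⟨fun t => F t x, h4.sub (by linarith) hs.2, h2, hx, fun t ht => h1 t ⟨ht.1, ht.2.trans hs.2⟩⟩
  have h2 := (H.le_weighted (GoodReach Ω C b s A)).trans (H.weighted_goodReach_le hs.1 A)
  have h3 := mul_le_mul_right (H.weighted_le A) (ENNReal.ofReal (Real.exp (Γ / φmin * s)))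
  have hm0 : ENNReal.ofReal φmin ≠ 0 := by simpa using H.φmin_pos
  refine h1.trans ?_
  have h4 : μ.restrict Ω (GoodReach Ω C b s A) ≤ (ENNReal.ofReal φmin)⁻¹ *
      (ENNReal.ofReal (Real.exp (Γ / φmin * s)) * (ENNReal.ofReal φmax * μ.restrict Ω A)) := by
    rw [← ENNReal.mul_le_iff_le_inv hm0 ENNReal.ofReal_ne_top]
    exact h2.trans h3
  refine h4.trans ?_
  rw [← mul_assoc, ← mul_assoc]
  refine mul_le_mul_left ?_ _
  rw [← ENNReal.ofReal_inv_of_pos H.φmin_pos, ← ENNReal.ofReal_mul (by have := H.φmin_pos; positivity),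
    ← ENNReal.ofReal_mul (by have := H.φmin_pos; positivity)]
  by_cases hneg : φmax ≤ 0
  · rw [ENNReal.ofReal_of_nonpos]
    · exact bot_le
    · refine mul_nonpos_of_nonneg_of_nonpos ?_ hneg
      have := H.φmin_pos
      positivity
  refine ENNReal.ofReal_le_ofReal ?_
  unfold flowConst
  have h0 := H.φmin_pos
  have hle : Γ / φmin * s ≤ Γ * T / φmin := by
    rw [div_mul_eq_mul_div]
    exact div_le_div_of_nonneg_right (mul_le_mul_of_nonneg_left hs.2 H.Γ_nonneg) h0.le
  push Not at hneg
  calc φmin⁻¹ * Real.exp (Γ / φmin * s) * φmax = φmax / φmin * Real.exp (Γ / φmin * s) := by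
        field_simp
    _ ≤ _ := by gcongr

/-- A flow is given trajectory by trajectory, without any regularity in `x`. Stability along good
trajectories yields joint continuity on a set of full measure, hence joint measurability. -/
lemma exists_continuousOn_flow : ∃ S : Set E, MeasurableSet S ∧ (∀ᵐ x ∂μ.restrict Ω, x ∈ S) ∧
    ContinuousOn (fun p : E × ℝ => F p.2 p.1) (S ×ˢ Icc 0 T) := by
  have hT := H.T_pos
  have hB := H.B_nonneg
  obtain ⟨S, hSae, hSm, hS⟩ := (H.flow.and hgood).exists_measurable_mem
  refine ⟨S, hSm, hSae, ?_⟩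
  rintro ⟨x₀, t₀⟩ ⟨hx₀, ht₀⟩
  obtain ⟨⟨h0, -, hc⟩, hg⟩ := hS x₀ hx₀
  have hγ : IsChar C b 0 T (fun t => F t x₀) := hc.sub (by linarith) le_rfl
  obtain ⟨ρ, hρ, hun⟩ := exists_uniform_good (isCompact_Icc.image_of_continuousOn hγ.cont)
    (by rintro _ ⟨s, hs, rfl⟩; exact hg s hs)
  have hcl := exists_close H.b_bd hB hγ hρ (fun s hs => (hun _ ⟨s, hs, rfl⟩).2.1)
  rw [ContinuousWithinAt, Metric.tendsto_nhdsWithin_nhds]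
  intro ε hε
  obtain ⟨d, hd, hcl⟩ := hcl (ε / 2) (by linarith)
  refine ⟨min d (ε / (2 * (B + 1))), lt_min hd (by positivity), ?_⟩
  rintro ⟨x, t⟩ ⟨hx, ht⟩ hdist
  obtain ⟨⟨k0, -, kc⟩, -⟩ := hS x hx
  rw [Prod.dist_eq, max_lt_iff] at hdist
  have e1 := hcl T ⟨hT.le, le_rfl⟩ (fun t => F t x) (kc.sub (by linarith) le_rfl)
    (by simp only [k0, h0]; exact hdist.1.trans_le (min_le_left _ _)) t ht
  have e2 := hγ.dist_le H.b_bd ht ht₀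
  have e3 : |t - t₀| < ε / (2 * (B + 1)) := hdist.2.trans_le (min_le_right _ _)
  have e4 : B * |t - t₀| ≤ ε / 2 := by
    calc B * |t - t₀| ≤ (B + 1) * (ε / (2 * (B + 1))) := by
          gcongr
          linarith
      _ = ε / 2 := by field_simp
  calc dist (F t x) (F t₀ x₀) ≤ dist (F t x) (F t x₀) + dist (F t x₀) (F t₀ x₀) := dist_triangle _ _ _
    _ < ε := by simp only at e1 e2; linarith

lemma aemeasurable_uncurry_flow {s : ℝ} (hs : s ∈ Icc 0 T) :
    AEMeasurable (fun p : E × ℝ => F p.2 p.1)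
      ((μ.restrict Ω).prod (volume.restrict (Icc 0 s))) := by
  obtain ⟨S, hSm, hSae, hcont⟩ := H.exists_continuousOn_flow hgood
  have h1 := (hcont.mono (prod_mono_right (Icc_subset_Icc_right hs.2))).aemeasurable
    (μ := (μ.restrict Ω).prod volume) (hSm.prod measurableSet_Icc)
  rwa [← Measure.prod_restrict, Measure.restrict_eq_self_of_ae_mem hSae] at h1

lemma aemeasurable_flow {s : ℝ} (hs : s ∈ Icc 0 T) : AEMeasurable (F s) (μ.restrict Ω) := by
  obtain ⟨S, hSm, hSae, hcont⟩ := H.exists_continuousOn_flow hgood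
  have h1 : ContinuousOn (F s) S := by
    have : ContinuousOn (fun x : E => (x, s)) S := by fun_prop
    exact hcont.comp this fun x hx => ⟨hx, hs⟩
  have := h1.aemeasurable (μ := μ.restrict Ω) hSm
  rwa [Measure.restrict_eq_self_of_ae_mem hSae] at this

lemma map_flow_le {s : ℝ} (hs : s ∈ Icc 0 T) :
    (μ.restrict Ω).map (F s) ≤ ENNReal.ofReal (flowConst φmin φmax Γ T) • μ.restrict Ω := by
  refine Measure.le_iff.2 fun A hA => ?_
  rw [Measure.map_apply_of_aemeasurable (H.aemeasurable_flow hgood hs) hA]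
  exact H.measure_preimage_flow_le hgood hs A

lemma quasiMeasurePreserving_ae {s : ℝ} (hs : s ∈ Icc 0 T) :
    (μ.restrict Ω).map (F s) ≪ μ.restrict Ω :=
  (Measure.absolutelyContinuous_of_le_smul (H.map_flow_le hgood hs))

/-- This is `map_flow_le` integrated in time. It makes the composition of an almost everywhere
measurable function with `F` measurable in `(x, t)`. -/
lemma map_uncurry_flow_le {s : ℝ} (hs : s ∈ Icc 0 T) :
    ((μ.restrict Ω).prod (volume.restrict (Icc 0 s))).map (fun p : E × ℝ => F p.2 p.1) ≤
      (ENNReal.ofReal (flowConst φmin φmax Γ T) * ENNReal.ofReal s) • μ.restrict Ω := by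
  have := H.isFiniteMeasure_restrict
  refine Measure.le_iff.2 fun A hA => ?_
  have hm := H.aemeasurable_uncurry_flow hgood hs
  have hlin : ((μ.restrict Ω).prod (volume.restrict (Icc 0 s))).map (fun p : E × ℝ => F p.2 p.1) A =
      ∫⁻ t in Icc 0 s, ∫⁻ x in Ω, A.indicator 1 (F t x) ∂μ := by
    rw [← lintegral_indicator_one hA, lintegral_map' (measurable_one.indicator hA).aemeasurable hm]
    exact lintegral_prod_symm (fun p : E × ℝ => A.indicator 1 (F p.2 p.1))
      ((measurable_one.indicator hA).comp_aemeasurable hm)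
  rw [hlin]
  calc ∫⁻ t in Icc 0 s, ∫⁻ x in Ω, A.indicator 1 (F t x) ∂μ
      ≤ ∫⁻ t in Icc 0 s, ENNReal.ofReal (flowConst φmin φmax Γ T) * μ.restrict Ω A := by
        refine setLIntegral_mono measurable_const fun t ht => ?_
        have htT : t ∈ Icc 0 T := ⟨ht.1, ht.2.trans hs.2⟩
        rw [← lintegral_map' (measurable_one.indicator hA).aemeasurable
          (H.aemeasurable_flow hgood htT), lintegral_indicator_one hA]
        exact H.map_flow_le hgood htT A
    _ = _ := by
        rw [setLIntegral_const, Real.volume_Icc, sub_zero, Measure.smul_apply, smul_eq_mul]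
        ring

lemma lintegral_comp_flow_le {s : ℝ} (hs : s ∈ Icc 0 T) {g : E → ℝ≥0∞}
    (hg : AEMeasurable g (μ.restrict Ω)) :
    ∫⁻ x in Ω, g (F s x) ∂μ ≤ ENNReal.ofReal (flowConst φmin φmax Γ T) * ∫⁻ x in Ω, g x ∂μ := by
  rw [← lintegral_map' (hg.mono_ac (H.quasiMeasurePreserving_ae hgood hs))
    (H.aemeasurable_flow hgood hs)]
  refine (lintegral_mono' (H.map_flow_le hgood hs) le_rfl).trans ?_
  rw [lintegral_smul_measure, smul_eq_mul]

lemma map_uncurry_flow_ac {s : ℝ} (hs : s ∈ Icc 0 T) :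
    ((μ.restrict Ω).prod (volume.restrict (Icc 0 s))).map (fun p : E × ℝ => F p.2 p.1) ≪
      μ.restrict Ω :=
  Measure.absolutelyContinuous_of_le_smul (H.map_uncurry_flow_le hgood hs)

lemma lintegral_lintegral_comp_flow_le {s : ℝ} (hs : s ∈ Icc 0 T) {g : E → ℝ≥0∞}
    (hg : AEMeasurable g (μ.restrict Ω)) :
    ∫⁻ x in Ω, (∫⁻ t in Icc 0 s, g (F t x)) ∂μ ≤
      ENNReal.ofReal (flowConst φmin φmax Γ T) * ENNReal.ofReal s * ∫⁻ x in Ω, g x ∂μ := by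
  have := H.isFiniteMeasure_restrict
  have hm := H.aemeasurable_uncurry_flow hgood hs
  have hg' := hg.mono_ac (H.map_uncurry_flow_ac hgood hs)
  rw [← lintegral_prod (fun p : E × ℝ => g (F p.2 p.1)) (hg'.comp_aemeasurable hm),
    ← lintegral_map' hg' hm]
  refine (lintegral_mono' (H.map_uncurry_flow_le hgood hs) le_rfl).trans ?_
  rw [lintegral_smul_measure, smul_eq_mul]

end RegularFlow

end Transport

/-! ### Convergence of mollifications in `L¹`. -/

section L1Mollify

variable {E : Type*} [NormedAddCommGroup E] [InnerProductSpace ℝ E] [FiniteDimensional ℝ E]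
  [MeasurableSpace E] [BorelSpace E] {μ : Measure E} [μ.IsAddHaarMeasure]
  {G : Type*} [NormedAddCommGroup G] [NormedSpace ℝ G]

open ContinuousLinearMap in
lemma continuous_normed_convolution (φ : ContDiffBump (0 : E)) {u : E → G} (hu : Integrable u μ) :
    Continuous (φ.normed μ ⋆[lsmul ℝ ℝ, μ] u) :=
  (HasCompactSupport.contDiff_convolution_left (n := 0) (lsmul ℝ ℝ) φ.hasCompactSupport_normed
    φ.contDiff_normed hu.locallyIntegrable).continuous

open ContinuousLinearMap in
lemma lintegral_enorm_normed_convolution_le (φ : ContDiffBump (0 : E)) {u : E → G}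
    (hu : Integrable u μ) :
    ∫⁻ x, ‖(φ.normed μ ⋆[lsmul ℝ ℝ, μ] u) x‖ₑ ∂μ ≤ ∫⁻ x, ‖u x‖ₑ ∂μ := by
  have hm : AEMeasurable (fun p : E × E => ‖φ.normed μ p.2‖ₑ * ‖u (p.1 - p.2)‖ₑ) (μ.prod μ) := by
    have h1 : Measurable fun p : E × E => ‖φ.normed μ p.2‖ₑ :=
      (φ.continuous_normed.measurable.comp measurable_snd).enorm
    have h2 : AEMeasurable (fun p : E × E => ‖u (p.1 - p.2)‖ₑ) (μ.prod μ) :=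
      (hu.aestronglyMeasurable.comp_quasiMeasurePreserving
        (quasiMeasurePreserving_sub_of_right_invariant μ μ)).enorm
    exact h1.aemeasurable.mul h2
  have hint : ∫⁻ y, ‖φ.normed μ y‖ₑ ∂μ = 1 := by
    have : ∀ y, ‖φ.normed μ y‖ₑ = ENNReal.ofReal (φ.normed μ y) := fun y =>
      Real.enorm_of_nonneg (φ.nonneg_normed y)
    simp_rw [this]
    rw [← ofReal_integral_eq_lintegral_ofReal φ.integrable_normed
      (Eventually.of_forall φ.nonneg_normed), φ.integral_normed, ENNReal.ofReal_one]
  calc ∫⁻ x, ‖(φ.normed μ ⋆[lsmul ℝ ℝ, μ] u) x‖ₑ ∂μ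
      ≤ ∫⁻ x, ∫⁻ y, ‖φ.normed μ y‖ₑ * ‖u (x - y)‖ₑ ∂μ ∂μ := by
        refine lintegral_mono fun x => ?_
        rw [convolution_def]
        refine (enorm_integral_le_lintegral_enorm _).trans (le_of_eq ?_)
        refine lintegral_congr fun y => ?_
        rw [lsmul_apply, enorm_smul]
    _ = ∫⁻ y, ∫⁻ x, ‖φ.normed μ y‖ₑ * ‖u (x - y)‖ₑ ∂μ ∂μ := lintegral_lintegral_swap hm
    _ = ∫⁻ y, ‖φ.normed μ y‖ₑ * ∫⁻ x, ‖u x‖ₑ ∂μ ∂μ := by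
        refine lintegral_congr fun y => ?_
        rw [lintegral_const_mul' _ _ enorm_ne_top, lintegral_sub_right_eq_self (fun x => ‖u x‖ₑ) y]
    _ = _ := by
        rw [lintegral_mul_const _ φ.continuous_normed.measurable.enorm, hint, one_mul]

open ContinuousLinearMap in
/-- Mollifications of an integrable function converge in `L¹`. -/
lemma tendsto_lintegral_mollifier_sub [CompleteSpace G] {u : E → G} (hu : Integrable u μ) :
    Tendsto (fun n => ∫⁻ x, ‖((mollifier E n).normed μ ⋆[lsmul ℝ ℝ, μ] u) x - u x‖ₑ ∂μ)
      atTop (𝓝 0) := by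
  set U : ℕ → E → G := fun n => (mollifier E n).normed μ ⋆[lsmul ℝ ℝ, μ] u with hU
  have hUm : ∀ n, AEStronglyMeasurable (U n) μ :=
    fun n => (continuous_normed_convolution _ hu).aestronglyMeasurable
  set A := ∫⁻ x, ‖u x‖ₑ ∂μ with hA
  have hAfin : A ≠ ⊤ := hu.2.ne
  have hUA : ∀ n, ∫⁻ x, ‖U n x‖ₑ ∂μ ≤ A := fun n => lintegral_enorm_normed_convolution_le _ hu
  have hae : ∀ᵐ x ∂μ, Tendsto (fun n => U n x) atTop (𝓝 (u x)) :=
    ContDiffBump.ae_convolution_tendsto_right_of_locallyIntegrable (K := 2) tendsto_mollifier_rOut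
      (Eventually.of_forall mollifier_rOut_le) hu.locallyIntegrable
  set D : ℕ → ℝ≥0∞ := fun n => ∫⁻ x, ‖U n x - u x‖ₑ ∂μ with hD
  have hDle : ∀ n, D n ≤ 2 * A := fun n => by
    calc D n ≤ ∫⁻ x, (‖U n x‖ₑ + ‖u x‖ₑ) ∂μ := lintegral_mono fun x => enorm_sub_le
      _ = (∫⁻ x, ‖U n x‖ₑ ∂μ) + A := lintegral_add_right' _ hu.aestronglyMeasurable.enorm
      _ ≤ 2 * A := by rw [two_mul]; gcongr; exact hUA n
  have h2A : 2 * A ≠ ⊤ := ENNReal.mul_ne_top (by simp) hAfin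
  -- Fatou's lemma applied to this nonnegative defect upgrades convergence almost everywhere to `L¹`
  -- convergence, since the norms of `U n` do not exceed that of `u`.
  set f : ℕ → E → ℝ≥0∞ := fun n x => ‖U n x‖ₑ + ‖u x‖ₑ - ‖U n x - u x‖ₑ with hf
  have hfm : ∀ n, AEMeasurable (f n) μ := fun n =>
    (((hUm n).enorm.add hu.aestronglyMeasurable.enorm).sub ((hUm n).sub hu.aestronglyMeasurable).enorm)
  have hfint : ∀ n, ∫⁻ x, f n x ∂μ ≤ 2 * A - D n := fun n => by
    have h1 : (∫⁻ x, f n x ∂μ) + D n ≤ 2 * A := by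
      calc (∫⁻ x, f n x ∂μ) + D n = ∫⁻ x, (f n x + ‖U n x - u x‖ₑ) ∂μ :=
            (lintegral_add_right' _ ((hUm n).sub hu.aestronglyMeasurable).enorm).symm
        _ = ∫⁻ x, (‖U n x‖ₑ + ‖u x‖ₑ) ∂μ := by
            refine lintegral_congr fun x => tsub_add_cancel_of_le enorm_sub_le
        _ = (∫⁻ x, ‖U n x‖ₑ ∂μ) + A := lintegral_add_right' _ hu.aestronglyMeasurable.enorm
        _ ≤ 2 * A := by rw [two_mul]; gcongr; exact hUA n
    exact ENNReal.le_sub_of_add_le_right ((hDle n).trans_lt h2A.lt_top).ne h1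
  have hliminf : 2 * A ≤ liminf (fun n => 2 * A - D n) atTop := by
    calc 2 * A = ∫⁻ x, liminf (fun n => f n x) atTop ∂μ := by
          rw [hA, ← lintegral_const_mul' _ _ (by simp)]
          refine lintegral_congr_ae ?_
          filter_upwards [hae] with x hx
          have h1 : Tendsto (fun n => f n x) atTop (𝓝 (‖u x‖ₑ + ‖u x‖ₑ - ‖u x - u x‖ₑ)) := by
            refine ENNReal.Tendsto.sub (hx.enorm.add tendsto_const_nhds) (hx.sub_const _).enorm ?_
            exact Or.inr (by simp)
          rw [h1.liminf_eq]; simp [two_mul]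
      _ ≤ liminf (fun n => ∫⁻ x, f n x ∂μ) atTop := lintegral_liminf_le' hfm
      _ ≤ _ := liminf_le_liminf (Eventually.of_forall hfint)
  have hlim : Tendsto (fun n => 2 * A - D n) atTop (𝓝 (2 * A)) := by
    refine tendsto_of_le_liminf_of_limsup_le hliminf ?_
    exact limsup_le_of_le (h := Eventually.of_forall fun n => tsub_le_self)
  have h3 : Tendsto (fun n => 2 * A - (2 * A - D n)) atTop (𝓝 (2 * A - 2 * A)) :=
    ENNReal.Tendsto.sub tendsto_const_nhds hlim (Or.inl h2A)
  rw [tsub_self] at h3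
  exact h3.congr fun n => ENNReal.sub_sub_cancel h2A (hDle n)

end L1Mollify

/-! ### Interior smooth approximation of Sobolev functions. -/

section Sobolev

variable {d : ℕ}

open ContinuousLinearMap in
/-- Interior approximation of a Sobolev function by smooth functions. -/
lemma exists_smooth_approx {Ω : Set (EuclideanSpace ℝ (Fin d))} (hΩ : IsOpen Ω)
    {f : EuclideanSpace ℝ (Fin d) → ℝ} {g : EuclideanSpace ℝ (Fin d) → EuclideanSpace ℝ (Fin d)}
    (hf : IntegrableOn f Ω) (hg : IntegrableOn g Ω) (hw : IsWeakGrad Ω f g)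
    {Q : Set (EuclideanSpace ℝ (Fin d))} (hQ : IsCompact Q) (hQΩ : Q ⊆ Ω) :
    ∃ u : ℕ → EuclideanSpace ℝ (Fin d) → ℝ, (∀ n, ContDiff ℝ 1 (u n)) ∧
      Tendsto (fun n => ∫⁻ x in Q, ‖u n x - f x‖ₑ) atTop (𝓝 0) ∧
      Tendsto (fun n => ∫⁻ x in Q, ‖fderiv ℝ (u n) x - innerSL ℝ (g x)‖ₑ) atTop (𝓝 0) := by
  set f₀ : EuclideanSpace ℝ (Fin d) → ℝ := Ω.indicator f with hf₀
  set g₀ : EuclideanSpace ℝ (Fin d) → EuclideanSpace ℝ (Fin d) := Ω.indicator g with hg₀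
  have hf₀i : Integrable f₀ := hf.integrable_indicator hΩ.measurableSet
  have hg₀i : Integrable g₀ := hg.integrable_indicator hΩ.measurableSet
  set ρ : ℕ → EuclideanSpace ℝ (Fin d) → ℝ :=
    fun n => (mollifier (EuclideanSpace ℝ (Fin d)) n).normed volume with hρ
  set u : ℕ → EuclideanSpace ℝ (Fin d) → ℝ := fun n => ρ n ⋆[lsmul ℝ ℝ, volume] f₀ with hu
  have hρs : ∀ n, ContDiff ℝ ∞ (ρ n) := fun n => ContDiffBump.contDiff_normed _
  have hρc : ∀ n, HasCompactSupport (ρ n) := fun n => ContDiffBump.hasCompactSupport_normed _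
  obtain ⟨r, hr, hrΩ⟩ := hQ.exists_cthickening_subset_open hΩ hQΩ
  -- For `x ∈ Q` and a small radius, `y ↦ ρ n (x - y)` is a test function on `Ω`. The weak gradient
  -- identity for it says that the gradient of the mollification is the mollified weak gradient.
  have hgrad : ∀ n, (mollifier (EuclideanSpace ℝ (Fin d)) n).rOut < r → ∀ x ∈ Q,
      fderiv ℝ (u n) x = innerSL ℝ ((ρ n ⋆[lsmul ℝ ℝ, volume] g₀) x) := by
    intro n hn x hx
    have hder := (hρc n).hasFDerivAt_convolution_left (lsmul ℝ ℝ)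
      ((hρs n).of_le (by simp)) hf₀i.locallyIntegrable x
    have hex1 : ConvolutionExistsAt (fderiv ℝ (ρ n)) f₀ x (precompL (EuclideanSpace ℝ (Fin d)) (lsmul ℝ ℝ)) volume :=
      ((hρc n).fderiv ℝ).convolutionExists_left _ ((hρs n).continuous_fderiv (by simp))
        hf₀i.locallyIntegrable x
    have hex2 : ConvolutionExistsAt (ρ n) g₀ x (lsmul ℝ ℝ) volume :=
      (hρc n).convolutionExists_left _ (hρs n).continuous hg₀i.locallyIntegrable x
    rw [hder.fderiv]
    set ψ : EuclideanSpace ℝ (Fin d) → ℝ := fun y => ρ n (x - y) with hψ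
    have hψd : ∀ y v, fderiv ℝ ψ y v = -fderiv ℝ (ρ n) (x - y) v := by
      intro y v
      have h1 : HasFDerivAt ψ ((fderiv ℝ (ρ n) (x - y)).comp (-ContinuousLinearMap.id ℝ _)) y :=
        ((hρs n).differentiable (by simp) (x - y)).hasFDerivAt.comp y
          ((hasFDerivAt_id y).const_sub x)
      rw [h1.fderiv]; simp
    have hψT : IsTestFun Ω ψ := by
      refine ⟨(hρs n).comp (by fun_prop), ?_, ?_⟩
      · exact (hρc n).comp_homeomorph (Homeomorph.subLeft x)
      · refine Subset.trans ?_ hrΩ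
        refine (closure_minimal (fun y hy => ?_) isClosed_closedBall).trans
          ((closedBall_subset_closedBall hn.le).trans (closedBall_subset_cthickening hx r))
        have : x - y ∈ Function.support (ρ n) := hy
        rw [hρ, ContDiffBump.support_normed_eq, mem_ball, dist_zero_right] at this
        rw [mem_closedBall, dist_comm, dist_eq_norm]
        exact this.le
    have hcoord : ∀ i : Fin d, (fderiv ℝ (ρ n) ⋆[precompL (EuclideanSpace ℝ (Fin d)) (lsmul ℝ ℝ), volume] f₀) x
        (EuclideanSpace.single i 1) = (ρ n ⋆[lsmul ℝ ℝ, volume] g₀) x i := by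
      intro i
      have hL : (fderiv ℝ (ρ n) ⋆[precompL (EuclideanSpace ℝ (Fin d)) (lsmul ℝ ℝ), volume] f₀) x
          (EuclideanSpace.single i 1) = -∫ y in Ω, f y * fderiv ℝ ψ y (EuclideanSpace.single i 1) := by
        rw [convolution_eq_swap, ContinuousLinearMap.integral_apply, ← integral_neg, ← integral_indicator hΩ.measurableSet]
        · refine integral_congr_ae (Eventually.of_forall fun y => ?_)
          by_cases hy : y ∈ Ω
          · simp [indicator_of_mem hy, hf₀, hψd, precompL_apply, mul_comm]
          · simp [indicator_of_notMem hy, hf₀]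
        · exact hex1.integrable_swap
      have hR : (ρ n ⋆[lsmul ℝ ℝ, volume] g₀) x i = ∫ y in Ω, g y i * ψ y := by
        have h1 : (ρ n ⋆[lsmul ℝ ℝ, volume] g₀) x i =
            ∫ y, (lsmul ℝ ℝ (ρ n (x - y)) (g₀ y)) i := by
          rw [convolution_eq_swap]
          exact ((EuclideanSpace.proj (𝕜 := ℝ) i).integral_comp_comm hex2.integrable_swap).symm
        rw [h1, ← integral_indicator hΩ.measurableSet]
        refine integral_congr_ae (Eventually.of_forall fun y => ?_)
        by_cases hy : y ∈ Ω
        · simp [indicator_of_mem hy, hg₀, hψ, mul_comm]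
        · simp [indicator_of_notMem hy, hg₀]
      rw [hL, hR, hw.2.2 ψ hψT i, neg_neg]
    refine ContinuousLinearMap.coe_injective ((EuclideanSpace.basisFun (Fin d) ℝ).toBasis.ext fun i => ?_)
    simp only [OrthonormalBasis.coe_toBasis, EuclideanSpace.basisFun_apply, ContinuousLinearMap.coe_coe]
    rw [hcoord i, innerSL_apply_apply, EuclideanSpace.inner_single_right]
    simp
  obtain ⟨N, hN⟩ := eventually_atTop.1 ((tendsto_mollifier_rOut
    (E := EuclideanSpace ℝ (Fin d))).eventually (gt_mem_nhds hr))
  refine ⟨fun n => u (n + N), fun n => ?_, ?_, ?_⟩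
  · exact (hρc _).contDiff_convolution_left _ ((hρs _).of_le (by simp)) hf₀i.locallyIntegrable
  · have h1 := (tendsto_add_atTop_iff_nat N).2 (tendsto_lintegral_mollifier_sub hf₀i)
    refine tendsto_of_tendsto_of_tendsto_of_le_of_le tendsto_const_nhds h1 (fun _ => bot_le) fun n => ?_
    refine le_trans (le_of_eq ?_) (setLIntegral_le_lintegral Q _)
    refine setLIntegral_congr_fun hQ.measurableSet fun x hx => ?_
    simp only [hf₀, indicator_of_mem (hQΩ hx)]; rfl
  · have h1 := (tendsto_add_atTop_iff_nat N).2 (tendsto_lintegral_mollifier_sub hg₀i)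
    refine tendsto_of_tendsto_of_tendsto_of_le_of_le tendsto_const_nhds h1 (fun _ => bot_le) fun n => ?_
    refine le_trans (le_of_eq ?_) (setLIntegral_le_lintegral Q _)
    refine setLIntegral_congr_fun hQ.measurableSet fun x hx => ?_
    simp only
    rw [hgrad _ (hN _ (Nat.le_add_left _ _)) x hx, ← map_sub, ← ofReal_norm, innerSL_apply_norm,
      ofReal_norm]
    simp only [hg₀, indicator_of_mem (hQΩ hx)]; rfl

end Sobolev

/-! ### Increments of a Sobolev function along the flow. -/

section Increment

variable {E : Type*} [NormedAddCommGroup E] [InnerProductSpace ℝ E] [FiniteDimensional ℝ E]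
  [MeasurableSpace E] [BorelSpace E]
variable {Ω C : Set E} {b : E → E}
variable {μ : Measure E} [μ.IsAddHaarMeasure] {φ : E → ℝ} {δ : E → ℝ}
  {φmin φmax Γ B T : ℝ} {F : ℝ → E → E}

lemma IsChar.enorm_sub_le {γ : ℝ → E} {s : ℝ} (hs : 0 ≤ s) (hγ : IsChar C b 0 s γ)
    (hb : ∀ x ∈ C, ‖b x‖ ≤ B) {u : E → ℝ} (hu : ContDiff ℝ 1 u) :
    ‖u (γ s) - u (γ 0)‖ₑ ≤ ∫⁻ t in Icc 0 s, ‖fderiv ℝ u (γ t) (b (γ t))‖ₑ := by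
  obtain ⟨hc, N, hN, hd⟩ := hγ
  obtain ⟨K, hK⟩ := isCompact_Icc.exists_bound_of_continuousOn
    ((hu.continuous_fderiv one_ne_zero).comp_continuousOn hc)
  have := (integral_bounded_deriv_off_countable (γ := fun t => u (γ t))
    (v := fun t => fderiv ℝ u (γ t) (b (γ t))) (C := K * B) hs (hu.continuous.comp_continuousOn hc) hN
    (fun t ht hn => ?_)).2
  · rw [← this, intervalIntegral.integral_of_le hs]
    refine (enorm_integral_le_lintegral_enorm _).trans ?_
    exact lintegral_mono_set Ioc_subset_Icc_self
  · obtain ⟨h1, h2⟩ := hd t ht hn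
    refine ⟨((hu.differentiable one_ne_zero _).hasFDerivAt).comp_hasDerivAt t h2, ?_⟩
    have hKt := hK t ⟨ht.1.le, ht.2.le⟩
    exact (ContinuousLinearMap.le_opNorm _ _).trans
      (mul_le_mul hKt (hb _ h1) (norm_nonneg _) ((norm_nonneg _).trans hKt))

lemma IsChar.ae_mem {γ : ℝ → E} {s : ℝ} (hγ : IsChar C b 0 s γ) :
    ∀ᵐ t ∂(volume.restrict (Icc 0 s)), γ t ∈ C := by
  obtain ⟨hc, N, hN, hd⟩ := hγ
  rw [← restrict_Ioo_eq_restrict_Icc]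
  filter_upwards [ae_restrict_mem measurableSet_Ioo,
    ae_restrict_of_ae (hN.ae_notMem volume)] with t h1 h2 using (hd t h1 h2).1

/-- Countably many compact subsets of an open set that absorb all compact subsets. -/
lemma exists_compact_absorbing {Ω : Set E} (hΩ : IsOpen Ω) (hb : Bornology.IsBounded Ω) :
    ∃ Q : ℕ → Set E, (∀ k, IsCompact (Q k) ∧ Q k ⊆ Ω) ∧
      ∀ K, IsCompact K → K ⊆ Ω → ∃ k, K ⊆ Q k := by
  have hsub : ∀ k : ℕ, (thickening (1 / ((k : ℝ) + 1)) Ωᶜ)ᶜ ⊆ Ω := fun k =>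
    compl_subset_comm.1 (self_subset_thickening (by positivity) _)
  refine ⟨fun k => (thickening (1 / ((k : ℝ) + 1)) Ωᶜ)ᶜ, fun k => ⟨?_, hsub k⟩, fun K hK hKΩ => ?_⟩
  · exact isCompact_of_isClosed_isBounded isOpen_thickening.isClosed_compl (hb.subset (hsub k))
  · obtain ⟨r, hr, hd⟩ := (disjoint_compl_right_iff_subset.2 hKΩ).exists_thickenings hK
      hΩ.isClosed_compl
    obtain ⟨k, hk⟩ := exists_nat_one_div_lt hr
    refine ⟨k, fun x hx hx' => ?_⟩
    exact disjoint_left.1 hd (self_subset_thickening hr K hx) (thickening_mono hk.le _ hx')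

namespace RegularFlow

variable (H : RegularFlow μ Ω C φ b δ φmin φmax Γ B T F)
include H

variable (hgood : ∀ᵐ x ∂μ.restrict Ω, ∀ t ∈ Icc 0 T, F t x ∈ goodSet Ω C b)
include hgood

/-- For smooth `u n` this is the fundamental theorem of calculus along each characteristic. The
errors made at the two ends and along the trajectory have integrals in `x` that tend to zero,
because the flow compresses measure by a bounded factor. Approximation is only interior, so
trajectories are sorted by a compact set `Q k` that contains them. -/
lemma ae_enorm_increment_le {f : E → ℝ} {Df : E → E →L[ℝ] ℝ}
    (hfm : AEStronglyMeasurable f (μ.restrict Ω)) (hDm : AEStronglyMeasurable Df (μ.restrict Ω))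
    (happ : ∀ Q : Set E, IsCompact Q → Q ⊆ Ω → ∃ u : ℕ → E → ℝ, (∀ n, ContDiff ℝ 1 (u n)) ∧
      Tendsto (fun n => ∫⁻ x in Q, ‖u n x - f x‖ₑ ∂μ) atTop (𝓝 0) ∧
      Tendsto (fun n => ∫⁻ x in Q, ‖fderiv ℝ (u n) x - Df x‖ₑ ∂μ) atTop (𝓝 0))
    {s : ℝ} (hs : s ∈ Icc 0 T) :
    ∀ᵐ x ∂μ.restrict Ω, ‖f (F s x) - f x‖ₑ ≤ ∫⁻ t in Icc 0 s, ‖Df (F t x) (b (F t x))‖ₑ := by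
  have := H.isFiniteMeasure_restrict
  have hT := H.T_pos
  obtain ⟨Q, hQ, hQabs⟩ := exists_compact_absorbing H.isOpen H.bdd
  have key : ∀ k, ∀ᵐ x ∂μ.restrict Ω, (∀ t ∈ Icc 0 s, F t x ∈ Q k) →
      ‖f (F s x) - f x‖ₑ ≤ ∫⁻ t in Icc 0 s, ‖Df (F t x) (b (F t x))‖ₑ := by
    intro k
    obtain ⟨u, hu, hlim1, hlim2⟩ := happ (Q k) (hQ k).1 (hQ k).2
    have hQm := (hQ k).1.measurableSet
    set p : ℕ → E → ℝ≥0∞ := fun n => (Q k).indicator fun x => ‖u n x - f x‖ₑ with hp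
    set q : ℕ → E → ℝ≥0∞ := fun n => (Q k).indicator fun x =>
      ENNReal.ofReal B * ‖fderiv ℝ (u n) x - Df x‖ₑ with hq
    have hpm : ∀ n, AEMeasurable (p n) (μ.restrict Ω) := fun n =>
      (((hu n).continuous.aestronglyMeasurable.sub hfm).enorm).indicator hQm
    have hqm : ∀ n, AEMeasurable (q n) (μ.restrict Ω) := fun n =>
      (((((hu n).continuous_fderiv one_ne_zero).aestronglyMeasurable.sub hDm).enorm).const_mul
        _).indicator hQm
    have hrr : (μ.restrict Ω).restrict (Q k) = μ.restrict (Q k) := by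
      rw [Measure.restrict_restrict hQm, inter_eq_self_of_subset_left (hQ k).2]
    have hpi : ∀ n, ∫⁻ x in Ω, p n x ∂μ = ∫⁻ x in Q k, ‖u n x - f x‖ₑ ∂μ := fun n => by
      rw [lintegral_indicator hQm, hrr]
    have hqi : ∀ n, ∫⁻ x in Ω, q n x ∂μ =
        ENNReal.ofReal B * ∫⁻ x in Q k, ‖fderiv ℝ (u n) x - Df x‖ₑ ∂μ := fun n => by
      rw [lintegral_indicator hQm, hrr, lintegral_const_mul' _ _ ENNReal.ofReal_ne_top]
    have hflow := H.aemeasurable_flow hgood hs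
    have hflow2 := H.aemeasurable_uncurry_flow hgood hs
    have hqprod : ∀ n, AEMeasurable (fun z : E × ℝ => q n (F z.2 z.1))
        ((μ.restrict Ω).prod (volume.restrict (Icc 0 s))) := fun n =>
      ((hqm n).mono_ac (H.map_uncurry_flow_ac hgood hs)).comp_aemeasurable hflow2
    set w : ℕ → E → ℝ≥0∞ := fun n x => p n (F s x) + p n x + ∫⁻ t in Icc 0 s, q n (F t x) with hw
    have hpF : ∀ n, AEMeasurable (fun x => p n (F s x)) (μ.restrict Ω) := fun n =>
      ((hpm n).mono_ac (H.quasiMeasurePreserving_ae hgood hs)).comp_aemeasurable hflow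
    have hwm : ∀ n, AEMeasurable (w n) (μ.restrict Ω) := fun n =>
      ((hpF n).add (hpm n)).add (hqprod n).lintegral_prod_right'
    set c := ENNReal.ofReal (flowConst φmin φmax Γ T) with hc
    have hwint : ∀ n, ∫⁻ x in Ω, w n x ∂μ ≤ c * (∫⁻ x in Q k, ‖u n x - f x‖ₑ ∂μ) +
        (∫⁻ x in Q k, ‖u n x - f x‖ₑ ∂μ) + c * ENNReal.ofReal s *
        (ENNReal.ofReal B * ∫⁻ x in Q k, ‖fderiv ℝ (u n) x - Df x‖ₑ ∂μ) := fun n => by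
      rw [← hpi, ← hqi]
      simp only [hw]
      rw [lintegral_add_left' (f := fun x => p n (F s x) + p n x) ((hpF n).add (hpm n)),
        lintegral_add_left' (f := fun x => p n (F s x)) (hpF n)]
      gcongr
      · exact H.lintegral_comp_flow_le hgood hs (hpm n)
      · exact H.lintegral_lintegral_comp_flow_le hgood hs (hqm n)
    have hlim : Tendsto (fun n => ∫⁻ x in Ω, w n x ∂μ) atTop (𝓝 0) := by
      refine tendsto_of_tendsto_of_tendsto_of_le_of_le tendsto_const_nhds ?_ (fun _ => bot_le) hwint
      have h1 := ENNReal.Tendsto.const_mul (a := c) hlim1 (Or.inr ENNReal.ofReal_ne_top)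
      have h2 := ENNReal.Tendsto.const_mul (a := c * ENNReal.ofReal s)
        (ENNReal.Tendsto.const_mul (a := ENNReal.ofReal B) hlim2 (Or.inr ENNReal.ofReal_ne_top))
        (Or.inr (ENNReal.mul_ne_top ENNReal.ofReal_ne_top ENNReal.ofReal_ne_top))
      have := (h1.add hlim1).add h2
      simpa using this
    -- By Fatou's lemma. A lower limit suffices, because the quantity that `w n x` dominates does
    -- not depend on `n`.
    have hzero : ∀ᵐ x ∂μ.restrict Ω, liminf (fun n => w n x) atTop = 0 := by
      have h1 : ∫⁻ x in Ω, liminf (fun n => w n x) atTop ∂μ = 0 := by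
        refine le_antisymm ((lintegral_liminf_le' hwm).trans ?_) bot_le
        rw [hlim.liminf_eq]
      have hlm : AEMeasurable (fun x => liminf (fun n => w n x) atTop) (μ.restrict Ω) := by
        simp_rw [liminf_eq_iSup_iInf_of_nat']
        exact AEMeasurable.iSup fun n => AEMeasurable.iInf fun i => hwm (i + n)
      have h2 := (lintegral_eq_zero_iff' hlm).1 h1
      filter_upwards [h2] with x hx using hx
    have hslice : ∀ᵐ x ∂μ.restrict Ω, ∀ n,
        AEMeasurable (fun t => q n (F t x)) (volume.restrict (Icc 0 s)) :=
      ae_all_iff.2 fun n =>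
        (hqprod n).aestronglyMeasurable.prodMk_left.mono fun _ h => h.aemeasurable
    filter_upwards [hzero, hslice, H.flow] with x h1 h2 ⟨h3, _, h4⟩ hxQ
    have hch : IsChar C b 0 s (fun t => F t x) := h4.sub (by linarith) hs.2
    have hle : ∀ n, ‖f (F s x) - f x‖ₑ - (∫⁻ t in Icc 0 s, ‖Df (F t x) (b (F t x))‖ₑ) ≤ w n x := by
      intro n
      rw [tsub_le_iff_right]
      have e1 := hch.enorm_sub_le hs.1 H.b_bd (hu n)
      simp only [h3] at e1
      have e2 : ∫⁻ t in Icc 0 s, ‖fderiv ℝ (u n) (F t x) (b (F t x))‖ₑ ≤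
          (∫⁻ t in Icc 0 s, ‖Df (F t x) (b (F t x))‖ₑ) + ∫⁻ t in Icc 0 s, q n (F t x) := by
        rw [← lintegral_add_right' _ (h2 n)]
        refine lintegral_mono_ae ?_
        filter_upwards [hch.ae_mem, ae_restrict_mem measurableSet_Icc] with t ht htI
        have hqe : q n (F t x) = ENNReal.ofReal B * ‖fderiv ℝ (u n) (F t x) - Df (F t x)‖ₑ :=
          indicator_of_mem (hxQ t htI) _
        rw [hqe]
        calc ‖fderiv ℝ (u n) (F t x) (b (F t x))‖ₑ
            = ‖Df (F t x) (b (F t x)) + (fderiv ℝ (u n) (F t x) - Df (F t x)) (b (F t x))‖ₑ := by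
              simp
          _ ≤ ‖Df (F t x) (b (F t x))‖ₑ + ‖(fderiv ℝ (u n) (F t x) - Df (F t x)) (b (F t x))‖ₑ :=
              enorm_add_le _ _
          _ ≤ _ := by
              gcongr
              refine (ContinuousLinearMap.le_opENorm _ _).trans ?_
              rw [mul_comm]
              gcongr
              rw [← ofReal_norm]
              exact ENNReal.ofReal_le_ofReal (H.b_bd _ ht)
      have hp1 : p n (F s x) = ‖u n (F s x) - f (F s x)‖ₑ := indicator_of_mem (hxQ s ⟨hs.1, le_rfl⟩) _
      have hp2 : p n x = ‖u n x - f x‖ₑ := by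
        have := hxQ 0 ⟨le_rfl, hs.1⟩
        rw [h3] at this
        exact indicator_of_mem this _
      calc ‖f (F s x) - f x‖ₑ
          = ‖(u n x - f x) + ((u n (F s x) - u n x) - (u n (F s x) - f (F s x)))‖ₑ := by
            congr 1; ring
        _ ≤ ‖u n x - f x‖ₑ + (‖u n (F s x) - u n x‖ₑ + ‖u n (F s x) - f (F s x)‖ₑ) :=
            (enorm_add_le _ _).trans (by gcongr; exact enorm_sub_le)
        _ ≤ p n x + (((∫⁻ t in Icc 0 s, ‖Df (F t x) (b (F t x))‖ₑ) +
            ∫⁻ t in Icc 0 s, q n (F t x)) + p n (F s x)) := by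
            rw [hp1, hp2]
            gcongr
            exact e1.trans e2
        _ = _ := by simp only [hw]; ring
    have : ‖f (F s x) - f x‖ₑ - (∫⁻ t in Icc 0 s, ‖Df (F t x) (b (F t x))‖ₑ) ≤ 0 := by
      rw [← h1]
      exact le_liminf_of_le (by isBoundedDefault) (Eventually.of_forall hle)
    exact tsub_eq_zero_iff_le.1 (le_antisymm this bot_le)
  filter_upwards [ae_all_iff.2 key, H.flow] with x h1 ⟨_, h3, h4⟩
  have hc : ContinuousOn (fun t => F t x) (Icc 0 s) :=
    h4.cont.mono (Icc_subset_Icc (by linarith) hs.2)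
  obtain ⟨k, hk⟩ := hQabs _ (isCompact_Icc.image_of_continuousOn hc) (by
    rintro _ ⟨t, ht, rfl⟩
    exact h3 t ⟨by linarith [ht.1], ht.2.trans hs.2⟩)
  exact h1 k fun t ht => hk ⟨t, ht, rfl⟩

/-- Jensen's inequality in time produces `s ^ (p - 1)`, and the space-time bound on the flow one
more factor `s` together with `flowConst`. The `p`-th root leaves `s` and `flowConst ^ (1 / p)`. -/
lemma eLpNorm_increment_le {f : E → ℝ} {h : E → ℝ}
    (hhm : AEStronglyMeasurable h (μ.restrict Ω))
    {s : ℝ} (hs : s ∈ Icc 0 T)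
    (hinc : ∀ᵐ x ∂μ.restrict Ω, ‖f (F s x) - f x‖ₑ ≤ ∫⁻ t in Icc 0 s, ‖h (F t x)‖ₑ)
    {α : ℝ≥0∞} (hα1 : 1 ≤ α) (hα : α ≠ ⊤) :
    eLpNorm (fun x => f (F s x) - f x) α (μ.restrict Ω) ≤
      ENNReal.ofReal (flowConst φmin φmax Γ T) ^ (1 / α.toReal) * ENNReal.ofReal s *
        eLpNorm h α (μ.restrict Ω) := by
  have := H.isFiniteMeasure_restrict
  have hα0 : α ≠ 0 := (zero_lt_one.trans_le hα1).ne'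
  set p := α.toReal with hp
  have hp1 : 1 ≤ p := by
    rw [hp, ← ENNReal.toReal_one]; exact ENNReal.toReal_mono hα hα1
  have hp0 : 0 < p := zero_lt_one.trans_le hp1
  set c := ENNReal.ofReal (flowConst φmin φmax Γ T) with hc
  have hprod : AEStronglyMeasurable (fun z : E × ℝ => h (F z.2 z.1))
      ((μ.restrict Ω).prod (volume.restrict (Icc 0 s))) :=
    (hhm.mono_ac (H.map_uncurry_flow_ac hgood hs)).comp_aemeasurable
      (H.aemeasurable_uncurry_flow hgood hs)
  have hjensen : ∀ᵐ x ∂μ.restrict Ω, (∫⁻ t in Icc 0 s, ‖h (F t x)‖ₑ) ^ p ≤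
      ENNReal.ofReal s ^ (p - 1) * ∫⁻ t in Icc 0 s, ‖h (F t x)‖ₑ ^ p := by
    filter_upwards [hprod.prodMk_left] with x hx
    have h1 := eLpNorm'_le_eLpNorm'_mul_rpow_measure_univ zero_lt_one hp1 hx
    simp only [eLpNorm', Measure.restrict_apply_univ, Real.volume_Icc, sub_zero, ENNReal.rpow_one,
      div_one] at h1
    calc _ ≤ _ := ENNReal.rpow_le_rpow h1 hp0.le
      _ = _ := by
        rw [ENNReal.mul_rpow_of_nonneg _ _ hp0.le, ← ENNReal.rpow_mul, ← ENNReal.rpow_mul,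
          one_div_mul_cancel hp0.ne', ENNReal.rpow_one, mul_comm]
        congr 2
        field_simp
  rw [eLpNorm_eq_lintegral_rpow_enorm_toReal hα0 hα, eLpNorm_eq_lintegral_rpow_enorm_toReal hα0 hα]
  have hmain : ∫⁻ x in Ω, ‖f (F s x) - f x‖ₑ ^ p ∂μ ≤
      c * ENNReal.ofReal s ^ p * ∫⁻ x in Ω, ‖h x‖ₑ ^ p ∂μ := by
    calc ∫⁻ x in Ω, ‖f (F s x) - f x‖ₑ ^ p ∂μ
        ≤ ∫⁻ x in Ω, (ENNReal.ofReal s ^ (p - 1) * ∫⁻ t in Icc 0 s, ‖h (F t x)‖ₑ ^ p) ∂μ := by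
          refine lintegral_mono_ae ?_
          filter_upwards [hinc, hjensen] with x h1 h2
          exact (ENNReal.rpow_le_rpow h1 hp0.le).trans h2
      _ = ENNReal.ofReal s ^ (p - 1) * ∫⁻ x in Ω, (∫⁻ t in Icc 0 s, ‖h (F t x)‖ₑ ^ p) ∂μ :=
          lintegral_const_mul' _ _ (ENNReal.rpow_ne_top_of_nonneg (by linarith) ENNReal.ofReal_ne_top)
      _ ≤ ENNReal.ofReal s ^ (p - 1) * (c * ENNReal.ofReal s * ∫⁻ x in Ω, ‖h x‖ₑ ^ p ∂μ) := by
          gcongr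
          exact H.lintegral_lintegral_comp_flow_le hgood hs (hhm.enorm.pow_const p)
      _ = c * (ENNReal.ofReal s ^ (p - 1) * ENNReal.ofReal s) * ∫⁻ x in Ω, ‖h x‖ₑ ^ p ∂μ := by ring
      _ = _ := by
          congr 2
          rcases hs.1.eq_or_lt with h0 | h0
          · rw [← h0]; simp [ENNReal.zero_rpow_of_pos hp0]
          · have hne : ENNReal.ofReal s ≠ 0 := by simpa using h0
            conv_lhs => rw [← ENNReal.rpow_one (ENNReal.ofReal s), ← ENNReal.rpow_mul, one_mul]
            rw [← ENNReal.rpow_add _ _ hne ENNReal.ofReal_ne_top]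
            simp
  calc _ ≤ _ := ENNReal.rpow_le_rpow hmain (by positivity)
    _ = _ := by
      rw [ENNReal.mul_rpow_of_nonneg _ _ (by positivity), ENNReal.mul_rpow_of_nonneg _ _ (by positivity),
        ← ENNReal.rpow_mul, mul_one_div_cancel hp0.ne', ENNReal.rpow_one]

lemma aestronglyMeasurable_increment {f : E → ℝ} (hf : AEStronglyMeasurable f (μ.restrict Ω))
    {s : ℝ} (hs : s ∈ Icc 0 T) :
    AEStronglyMeasurable (fun x => f (F s x) - f x) (μ.restrict Ω) :=
  ((hf.mono_ac (H.quasiMeasurePreserving_ae hgood hs)).comp_aemeasurable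
    (H.aemeasurable_flow hgood hs)).sub hf

end RegularFlow

end Increment

/-! ### Continuity of the normal component across a hyperplane. -/

section NormalTrace

variable {E : Type*} [NormedAddCommGroup E] [InnerProductSpace ℝ E] [FiniteDimensional ℝ E]
  [MeasurableSpace E] [BorelSpace E] {μ : Measure E} [μ.IsAddHaarMeasure]

/-- A hyperplane is a slab of width zero, exhausted by balls. -/
lemma ae_inner_ne {n : E} (hn : ‖n‖ = 1) (c : ℝ) : ∀ᵐ x ∂μ, inner ℝ n x ≠ c := by
  have hlin : LinearIndependent ℝ ![n] := by
    refine linearIndependent_unique_iff.2 fun h => ?_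
    have : n = 0 := h
    rw [this, norm_zero] at hn
    exact zero_ne_one hn
  have key : ∀ k : ℕ, ∀ᵐ x ∂μ, ¬(‖x‖ ≤ k ∧ inner ℝ n x = c) := by
    intro k
    obtain ⟨K, hK⟩ := exists_measure_slab_le μ hlin ![c] k
    have := hK 0 le_rfl
    rw [ENNReal.ofReal_zero, pow_one, mul_zero, nonpos_iff_eq_zero] at this
    refine measure_mono_null (fun x hx => ?_) this
    have hx' : ‖x‖ ≤ k ∧ inner ℝ n x = c := not_not.1 hx
    refine ⟨hx'.1, fun i => ?_⟩
    have hi : i = 0 := Subsingleton.elim _ _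
    subst hi
    change |inner ℝ n x - c| ≤ 0
    rw [hx'.2, sub_self, abs_zero]
  filter_upwards [ae_all_iff.2 key] with x hx h
  obtain ⟨k, hk⟩ := exists_nat_ge ‖x‖
  exact hx k ⟨hk, h⟩

lemma measurePreserving_of_involutive {R : E →ₗ[ℝ] E} (hR : ∀ x, R (R x) = x) :
    MeasurePreserving R μ μ := by
  have hdet : LinearMap.det R * LinearMap.det R = 1 := by
    rw [← LinearMap.det_comp, show R ∘ₗ R = LinearMap.id from LinearMap.ext hR, LinearMap.det_id]
  have habs : |(LinearMap.det R)⁻¹| = 1 := by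
    rcases mul_self_eq_one_iff.1 hdet with h | h <;> rw [h] <;> norm_num
  refine ⟨(LinearMap.continuous_of_finiteDimensional R).measurable, ?_⟩
  rw [Measure.map_linearMap_addHaar_eq_smul_addHaar μ (fun h => by rw [h] at hdet; simp at hdet),
    habs]
  simp

/-- A radial bump function. -/
noncomputable def radialBump (w : E) : ℝ := Real.smoothTransition (1 - ‖w‖ ^ 2)

/-- The radial profile of the gradient of `radialBump`. -/
noncomputable def radialSlope (w : E) : ℝ := deriv Real.smoothTransition (1 - ‖w‖ ^ 2)

lemma contDiff_radialBump : ContDiff ℝ ∞ (radialBump : E → ℝ) :=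
  Real.smoothTransition.contDiff.comp (contDiff_const.sub (contDiff_norm_sq ℝ))

lemma continuous_radialSlope : Continuous (radialSlope : E → ℝ) := by
  have h : Continuous (deriv Real.smoothTransition) :=
    (Real.smoothTransition.contDiff (n := 1)).continuous_deriv le_rfl
  exact h.comp (by fun_prop)

lemma hasFDerivAt_radialBump (w : E) :
    HasFDerivAt radialBump (radialSlope w • -((2 : ℝ) • innerSL ℝ w)) w := by
  have h1 : HasDerivAt Real.smoothTransition (radialSlope w) (1 - ‖w‖ ^ 2) :=
    ((Real.smoothTransition.contDiff (n := 1)).differentiable one_ne_zero _).hasDerivAt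
  have h2 : HasFDerivAt (fun w : E => 1 - ‖w‖ ^ 2) (-((2 : ℝ) • innerSL ℝ w)) w := by
    have := (hasStrictFDerivAt_norm_sq w).hasFDerivAt.const_sub (1 : ℝ)
    refine this.congr_fderiv ?_
    ext v
    simp [two_smul]
  exact h1.comp_hasFDerivAt w h2

lemma radialSlope_nonneg (w : E) : 0 ≤ radialSlope w :=
  Real.smoothTransition.monotone.deriv_nonneg

lemma radialBump_eq_zero {w : E} (hw : 1 ≤ ‖w‖) : radialBump w = 0 :=
  Real.smoothTransition.zero_of_nonpos (by nlinarith)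

lemma radialSlope_eq_zero {w : E} (hw : 1 < ‖w‖) : radialSlope w = 0 := by
  have : Real.smoothTransition =ᶠ[𝓝 (1 - ‖w‖ ^ 2)] fun _ => 0 := by
    filter_upwards [gt_mem_nhds (show 1 - ‖w‖ ^ 2 < 0 by nlinarith)] with t ht
    exact Real.smoothTransition.zero_of_nonpos ht.le
  rw [radialSlope, this.deriv_eq, deriv_const]

lemma hasCompactSupport_radialSlope_mul (u : E → ℝ) :
    HasCompactSupport fun w => radialSlope w * u w := by
  refine HasCompactSupport.intro (isCompact_closedBall 0 1) fun w hw => ?_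
  rw [mem_closedBall, dist_zero_right, not_le] at hw
  rw [radialSlope_eq_zero hw, zero_mul]

/-- Otherwise the continuous nonnegative integrand would vanish identically, and `radialBump` would
be constant on the line spanned by `n`, although it is `1` at `0` and `0` at `n`. -/
lemma integral_radialSlope_pos {n : E} (hn : ‖n‖ = 1) :
    0 < ∫ w, radialSlope w * |inner ℝ n w| ∂μ := by
  have hc : Continuous fun w : E => radialSlope w * |inner ℝ n w| := by
    have := continuous_radialSlope (E := E)
    fun_prop
  by_contra hneg
  have hzero : ∀ w : E, radialSlope w * |inner ℝ n w| = 0 := by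
    intro w
    by_contra hw
    exact hneg (hc.integral_pos_of_hasCompactSupport_nonneg_nonzero
      (hasCompactSupport_radialSlope_mul _)
      (fun w => mul_nonneg (radialSlope_nonneg w) (abs_nonneg _)) hw)
  have hder : ∀ t : ℝ, HasDerivAt (fun t : ℝ => radialBump (t • n)) 0 t := by
    intro t
    have h1 := (hasFDerivAt_radialBump (t • n)).comp_hasDerivAt t ((hasDerivAt_id t).smul_const n)
    have h2 := hzero (t • n)
    have h3 : inner ℝ n (t • n) = t := by
      rw [inner_smul_right, real_inner_self_eq_norm_sq, hn]; ring
    have h3' : inner ℝ (t • n) n = t := by rw [real_inner_comm, h3]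
    rw [h3] at h2
    have h4 : radialSlope (t • n) * t = 0 := by
      rcases mul_eq_zero.1 h2 with h | h
      · rw [h, zero_mul]
      · rw [abs_eq_zero.1 h, mul_zero]
    refine h1.congr_deriv ?_
    simp only [one_smul, smul_apply, neg_apply,
      innerSL_apply_apply, h3', smul_eq_mul]
    linear_combination (-2) * h4
  have := is_const_of_deriv_eq_zero (fun t => (hder t).differentiableAt) (fun t => (hder t).deriv) 0 1
  rw [zero_smul, one_smul, radialBump_eq_zero hn.ge, radialBump, norm_zero] at this
  norm_num at this

/-- With `R` the reflection fixing `n` and changing the sign of its orthogonal complement, averaging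
over `w`, `-w`, `R w`, `-R w` cancels the tangential components and leaves the normal jump. -/
lemma integral_radial_jump {n : E} (hn : ‖n‖ = 1) (ap am : E) :
    ∫ w, radialSlope w * inner ℝ w (if 0 < inner ℝ n w then ap else am) ∂μ =
      inner ℝ n (ap - am) / 2 * ∫ w, radialSlope w * |inner ℝ n w| ∂μ := by
  classical
  set A : E → E := fun w => if 0 < inner ℝ n w then ap else am with hA
  set I : E → ℝ := fun w => radialSlope w * inner ℝ w (A w) with hI
  have hAm : Measurable A := Measurable.ite (measurableSet_lt measurable_const (by fun_prop))
    measurable_const measurable_const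
  have hInt : Integrable I μ := by
    have hm : AEStronglyMeasurable I μ :=
      (continuous_radialSlope.measurable.mul (measurable_id.inner hAm)).aestronglyMeasurable
    have hg : Integrable (fun w : E => radialSlope w * (‖w‖ * (‖ap‖ + ‖am‖))) μ := by
      refine Continuous.integrable_of_hasCompactSupport ?_ (hasCompactSupport_radialSlope_mul _)
      have := continuous_radialSlope (E := E)
      fun_prop
    refine hg.mono' hm (Eventually.of_forall fun w => ?_)
    rw [norm_mul, Real.norm_of_nonneg (radialSlope_nonneg w)]
    refine mul_le_mul_of_nonneg_left ((norm_inner_le_norm _ _).trans ?_) (radialSlope_nonneg w)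
    refine mul_le_mul_of_nonneg_left ?_ (norm_nonneg _)
    simp only [hA]
    split_ifs <;> linarith [norm_nonneg ap, norm_nonneg am]
  set R : E →ₗ[ℝ] E := (2 : ℝ) • ((innerSL ℝ n).toLinearMap.smulRight n) - LinearMap.id with hR
  have hRa : ∀ w, R w = (2 * inner ℝ n w) • n - w := by
    intro w
    simp [hR, smul_smul]
  have hnn : inner ℝ n n = (1 : ℝ) := by rw [real_inner_self_eq_norm_sq, hn]; ring
  have hRn : ∀ w, inner ℝ n (R w) = inner ℝ n w := by
    intro w
    rw [hRa, inner_sub_right, inner_smul_right, hnn]; ring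
  have hRR : ∀ w, R (R w) = w := by
    intro w
    rw [hRa, hRn, hRa]; abel
  have hRnorm : ∀ w, ‖R w‖ = ‖w‖ := by
    intro w
    have : ‖R w‖ ^ 2 = ‖w‖ ^ 2 := by
      rw [hRa, norm_sub_sq_real, norm_smul, hn, inner_smul_left]
      simp only [Real.norm_eq_abs, mul_one, sq_abs, conj_trivial]
      ring
    exact (sq_eq_sq₀ (norm_nonneg _) (norm_nonneg _)).1 this
  have hslope : ∀ v w : E, ‖v‖ = ‖w‖ → radialSlope v = radialSlope w := by
    intro v w h
    rw [radialSlope, radialSlope, h]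
  have hRmp : MeasurePreserving R μ μ := measurePreserving_of_involutive hRR
  have hRi : ∀ f : E → ℝ, ∫ w, f (R w) ∂μ = ∫ w, f w ∂μ := by
    intro f
    have he : MeasurableEmbedding R :=
      ((Equiv.toHomeomorph ⟨R, R, hRR, hRR⟩ (fun s => by
        have hc : Continuous R := LinearMap.continuous_of_finiteDimensional R
        refine ⟨fun h => ?_, fun h => h.preimage hc⟩
        have := h.preimage hc
        rw [← preimage_comp] at this
        rwa [show (⇑(⟨R, R, hRR, hRR⟩ : E ≃ E) ∘ ⇑R) = id from funext hRR, preimage_id] at this)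
        ).measurableEmbedding)
    exact hRmp.integral_comp he f
  have hIR : Integrable (fun w => I (R w)) μ := hRmp.integrable_comp_of_integrable hInt
  have hIneg : Integrable (fun w => I (-w)) μ := hInt.comp_neg
  have hIRneg : Integrable (fun w => I (-R w)) μ := by
    exact hRmp.integrable_comp_of_integrable hIneg
  have hsum : ∀ w, (I w + I (-w)) + (I (R w) + I (-R w)) =
      (2 * inner ℝ n (ap - am)) * (radialSlope w * |inner ℝ n w|) := by
    intro w
    have e1 : radialSlope (-w) = radialSlope w := hslope _ _ (norm_neg w)
    have e2 : radialSlope (R w) = radialSlope w := hslope _ _ (hRnorm w)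
    have e3 : radialSlope (-R w) = radialSlope w := hslope _ _ (by rw [norm_neg, hRnorm])
    simp only [hI, hA, e1, e2, e3, inner_neg_right, hRn, inner_neg_left]
    have e4 : ∀ a, inner ℝ (R w) a = 2 * inner ℝ n w * inner ℝ n a - inner ℝ w a := by
      intro a
      rw [hRa, inner_sub_left, inner_smul_left]; simp
    rw [inner_sub_right]
    rcases lt_trichotomy (inner ℝ n w) 0 with h | h | h
    · rw [abs_of_neg h, if_neg (by linarith), if_pos (by linarith), e4, e4]; ring
    · rw [h, abs_zero, if_neg (by linarith), if_neg (by linarith)]; ring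
    · rw [abs_of_pos h, if_pos h, if_neg (by linarith), e4, e4]; ring
  have h4 : 4 * ∫ w, I w ∂μ = (2 * inner ℝ n (ap - am)) * ∫ w, radialSlope w * |inner ℝ n w| ∂μ := by
    have h := integral_congr_ae (μ := μ) (Eventually.of_forall hsum)
    have i1 : Integrable (fun w => I w + I (-w)) μ := hInt.add hIneg
    have i2 : Integrable (fun w => I (R w) + I (-R w)) μ := hIR.add hIRneg
    rw [integral_const_mul, integral_add i1 i2, integral_add hInt hIneg,
      integral_add hIR hIRneg, hRi I, hRi (fun w => I (-w)), integral_neg_eq_self I] at h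
    linarith
  linarith

/-- The normal component of a field with bounded weak divergence is continuous across a
hyperplane on both sides of which the field is continuous. -/
lemma normal_trace_eq {Ω : Set E} {W : E → E} {δ : E → ℝ} {Γ : ℝ}
    (hδ : ∀ᵐ x ∂μ.restrict Ω, |δ x| ≤ Γ) (hΓ : 0 ≤ Γ)
    (hdiv : ∀ ψ : E → ℝ, ContDiff ℝ ∞ ψ → HasCompactSupport ψ → tsupport ψ ⊆ Ω →
      ∫ x in Ω, fderiv ℝ ψ x (W x) ∂μ = -∫ x in Ω, δ x * ψ x ∂μ)
    {x₀ n : E} (hn : ‖n‖ = 1) {ρ : ℝ} (hρ : 0 < ρ) (hball : ball x₀ ρ ⊆ Ω) {Wp Wm : E → E}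
    (hWp : Continuous Wp) (hWm : Continuous Wm)
    (hp : ∀ x ∈ ball x₀ ρ, inner ℝ n x₀ < inner ℝ n x → W x = Wp x)
    (hm : ∀ x ∈ ball x₀ ρ, inner ℝ n x < inner ℝ n x₀ → W x = Wm x) :
    inner ℝ n (Wp x₀) = inner ℝ n (Wm x₀) := by
  classical
  set V : E → E := fun x => if inner ℝ n x₀ < inner ℝ n x then Wp x else Wm x with hV
  have hVm : Measurable V := Measurable.ite (measurableSet_lt measurable_const (by fun_prop))
    hWp.measurable hWm.measurable
  set J : ℝ → ℝ := fun ε => ∫ w, radialSlope w * inner ℝ w (V (x₀ + ε • w)) ∂μ with hJ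
  set m := Module.finrank ℝ E
  -- The bump is rescaled to radius `ε` around `x₀`. Its gradient costs a factor `1/ε` which the
  -- bounded divergence does not compensate, so `J ε = O(ε)`, whereas `J ε` tends to a multiple of
  -- the normal jump.
  have hbound : ∀ ε, 0 < ε → ε < ρ → |J ε| ≤ Γ * ε / 2 * ∫ w : E, |radialBump w| ∂μ := by
    intro ε hε hερ
    set ψ : E → ℝ := fun x => radialBump (ε⁻¹ • (x - x₀)) with hψ
    have hscale : ∀ x, ‖ε⁻¹ • (x - x₀)‖ = dist x x₀ / ε := by
      intro x
      rw [norm_smul, norm_inv, Real.norm_of_nonneg hε.le, dist_eq_norm, div_eq_inv_mul]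
    have hψd : ∀ x v, fderiv ℝ ψ x v =
        -(2 * ε⁻¹) * (radialSlope (ε⁻¹ • (x - x₀)) * inner ℝ (ε⁻¹ • (x - x₀)) v) := by
      intro x v
      have h1 := (hasFDerivAt_radialBump (ε⁻¹ • (x - x₀))).comp x
        (((hasFDerivAt_id x).sub_const x₀).const_smul ε⁻¹)
      have h2 : fderiv ℝ ψ x = _ := h1.fderiv
      rw [h2]
      simp [inner_smul_left, inner_sub_left]
      ring
    have hψ0 : ∀ x, x ∉ closedBall x₀ ε → ψ x = 0 := by
      intro x hx
      rw [mem_closedBall, not_le] at hx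
      exact radialBump_eq_zero (by rw [hscale, le_div_iff₀ hε]; linarith)
    have hts : tsupport ψ ⊆ closedBall x₀ ε := closure_minimal (fun x hx => by
      by_contra h; exact hx (hψ0 x h)) isClosed_closedBall
    have hd := hdiv ψ (contDiff_radialBump.comp (by fun_prop))
      (HasCompactSupport.intro (isCompact_closedBall x₀ ε) hψ0)
      (hts.trans ((closedBall_subset_ball hερ).trans hball))
    have hfar : ∀ x, x ∉ ball x₀ ρ → radialSlope (ε⁻¹ • (x - x₀)) = 0 := by
      intro x hx
      rw [mem_ball, not_lt] at hx
      exact radialSlope_eq_zero (by rw [hscale, lt_div_iff₀ hε]; linarith)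
    have hsc : ∀ f : E → ℝ, ∫ x, f (ε⁻¹ • (x - x₀)) ∂μ = ε ^ m * ∫ w, f w ∂μ := by
      intro f
      rw [integral_sub_right_eq_self (fun x => f (ε⁻¹ • x)) x₀, Measure.integral_comp_smul, inv_pow,
        inv_inv, abs_of_nonneg (by positivity), smul_eq_mul]
    have hL : ∫ x in Ω, fderiv ℝ ψ x (W x) ∂μ = -(2 * ε⁻¹) * (ε ^ m * J ε) := by
      have h1 : ∫ x in Ω, fderiv ℝ ψ x (W x) ∂μ = ∫ x in Ω, fderiv ℝ ψ x (V x) ∂μ := by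
        refine integral_congr_ae (ae_restrict_of_ae ?_)
        filter_upwards [ae_inner_ne (μ := μ) hn (inner ℝ n x₀)] with x hx
        by_cases hxb : x ∈ ball x₀ ρ
        · rcases lt_or_gt_of_ne hx with h | h
          · simp only [hV, if_neg (not_lt.2 h.le), hm x hxb h]
          · simp only [hV, if_pos h, hp x hxb h]
        · rw [hψd, hψd, hfar x hxb]; simp
      have h2 : ∫ x in Ω, fderiv ℝ ψ x (V x) ∂μ = ∫ x, fderiv ℝ ψ x (V x) ∂μ := by
        refine setIntegral_eq_integral_of_forall_compl_eq_zero fun x hx => ?_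
        rw [hψd, hfar x fun h => hx (hball h)]; simp
      rw [h1, h2]
      simp_rw [hψd]
      rw [integral_const_mul, hJ, ← hsc]
      congr 1
      refine integral_congr_ae (Eventually.of_forall fun x => ?_)
      simp only
      rw [smul_smul, mul_inv_cancel₀ hε.ne', one_smul, add_sub_cancel]
    have hRb : |∫ x in Ω, δ x * ψ x ∂μ| ≤ Γ * (ε ^ m * ∫ w : E, |radialBump w| ∂μ) := by
      rw [← hsc (fun w => |radialBump w|), ← integral_const_mul]
      have hcont : Continuous fun x : E => Γ * |radialBump (ε⁻¹ • (x - x₀))| := by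
        have := (contDiff_radialBump (E := E)).continuous
        fun_prop
      have hint : Integrable (fun x : E => Γ * |radialBump (ε⁻¹ • (x - x₀))|) μ := by
        refine hcont.integrable_of_hasCompactSupport
          (HasCompactSupport.intro (isCompact_closedBall x₀ ε) fun x hx => ?_)
        have : radialBump (ε⁻¹ • (x - x₀)) = 0 := hψ0 x hx
        rw [this, abs_zero, mul_zero]
      calc |∫ x in Ω, δ x * ψ x ∂μ| ≤ ∫ x in Ω, Γ * |radialBump (ε⁻¹ • (x - x₀))| ∂μ := by
            refine norm_integral_le_of_norm_le (f := fun x => δ x * ψ x) hint.integrableOn ?_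
            filter_upwards [hδ] with x hx
            rw [norm_mul]
            exact mul_le_mul_of_nonneg_right hx (abs_nonneg _)
        _ ≤ _ := setIntegral_le_integral hint (Eventually.of_forall fun x => by positivity)
    rw [hL] at hd
    have hεm : 0 < ε ^ m := by positivity
    have h5 : |-(2 * ε⁻¹) * (ε ^ m * J ε)| = ε ^ m * (2 * ε⁻¹ * |J ε|) := by
      rw [abs_mul, abs_mul, abs_neg, abs_of_pos hεm, abs_of_pos (by positivity)]; ring
    rw [← abs_neg, ← hd, h5] at hRb
    have h6 : 2 * ε⁻¹ * |J ε| ≤ Γ * ∫ w : E, |radialBump w| ∂μ := by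
      refine le_of_mul_le_mul_left ?_ hεm
      linarith
    calc |J ε| = ε / 2 * (2 * ε⁻¹ * |J ε|) := by field_simp
      _ ≤ ε / 2 * (Γ * ∫ w : E, |radialBump w| ∂μ) := by gcongr
      _ = _ := by ring
  have hlim1 : Tendsto J (𝓝[>] 0) (𝓝 0) := by
    refine squeeze_zero_norm' (a := fun ε => Γ * ε / 2 * ∫ w : E, |radialBump w| ∂μ) ?_ ?_
    · filter_upwards [Ioo_mem_nhdsGT hρ] with ε hε using hbound ε hε.1 hε.2
    · have : Continuous fun ε : ℝ => Γ * ε / 2 * ∫ w : E, |radialBump w| ∂μ := by fun_prop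
      have h := this.tendsto 0
      simp only [mul_zero, zero_div, zero_mul] at h
      exact h.mono_left nhdsWithin_le_nhds
  have hlim2 : Tendsto J (𝓝[>] 0) (𝓝 (∫ w, radialSlope w *
      inner ℝ w (if 0 < inner ℝ n w then Wp x₀ else Wm x₀) ∂μ)) := by
    obtain ⟨Kp, hKp⟩ := (isCompact_closedBall x₀ 1).exists_bound_of_continuousOn hWp.continuousOn
    obtain ⟨Km, hKm⟩ := (isCompact_closedBall x₀ 1).exists_bound_of_continuousOn hWm.continuousOn
    refine tendsto_integral_filter_of_dominated_convergence
      (fun w => radialSlope w * (‖w‖ * max Kp Km)) ?_ ?_ ?_ ?_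
    · refine Eventually.of_forall fun ε => ?_
      exact (continuous_radialSlope.measurable.mul (measurable_id.inner
        (hVm.comp (by fun_prop)))).aestronglyMeasurable
    · filter_upwards [Ioo_mem_nhdsGT (zero_lt_one' ℝ)] with ε hε
      refine Eventually.of_forall fun w => ?_
      rw [norm_mul, Real.norm_of_nonneg (radialSlope_nonneg w)]
      by_cases hw : 1 < ‖w‖
      · rw [radialSlope_eq_zero hw, zero_mul, zero_mul]
      · have hin : x₀ + ε • w ∈ closedBall x₀ 1 := by
          rw [mem_closedBall, dist_eq_norm, add_sub_cancel_left, norm_smul, Real.norm_of_nonneg hε.1.le]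
          push Not at hw
          nlinarith [hε.1, hε.2, norm_nonneg w]
        refine mul_le_mul_of_nonneg_left ((norm_inner_le_norm _ _).trans ?_) (radialSlope_nonneg w)
        refine mul_le_mul_of_nonneg_left ?_ (norm_nonneg _)
        simp only [hV]
        split_ifs
        · exact (hKp _ hin).trans (le_max_left _ _)
        · exact (hKm _ hin).trans (le_max_right _ _)
    · refine Continuous.integrable_of_hasCompactSupport ?_ (hasCompactSupport_radialSlope_mul _)
      have := continuous_radialSlope (E := E)
      fun_prop
    · refine Eventually.of_forall fun w => ?_
      have hside : ∀ ε : ℝ, 0 < ε → (inner ℝ n x₀ < inner ℝ n (x₀ + ε • w) ↔ 0 < inner ℝ n w) := by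
        intro ε hε
        rw [inner_add_right, inner_smul_right, lt_add_iff_pos_right, mul_pos_iff_of_pos_left hε]
      have hpt : ∀ Z : E → E, Continuous Z →
          Tendsto (fun ε : ℝ => radialSlope w * inner ℝ w (Z (x₀ + ε • w))) (𝓝[>] 0)
            (𝓝 (radialSlope w * inner ℝ w (Z x₀))) := by
        intro Z hZ
        have hc : Continuous fun ε : ℝ => radialSlope w * inner ℝ w (Z (x₀ + ε • w)) := by fun_prop
        have h := hc.tendsto 0
        rw [zero_smul, add_zero] at h
        exact h.mono_left nhdsWithin_le_nhds
      by_cases h : 0 < inner ℝ n w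
      · rw [if_pos h]
        refine (hpt Wp hWp).congr' ?_
        filter_upwards [self_mem_nhdsWithin] with ε hε
        simp only [hV, if_pos ((hside ε hε).2 h)]
      · rw [if_neg h]
        refine (hpt Wm hWm).congr' ?_
        filter_upwards [self_mem_nhdsWithin] with ε hε
        simp only [hV, if_neg fun hh => h ((hside ε hε).1 hh)]
  have := tendsto_nhds_unique hlim2 hlim1
  rw [integral_radial_jump hn, mul_eq_zero] at this
  have h0 := this.resolve_right (integral_radialSlope_pos (μ := μ) hn).ne'
  rw [inner_sub_right] at h0
  linarith

end NormalTrace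

/-! ### Classification of the points of the faces. -/

section Classification

variable {E : Type*} [NormedAddCommGroup E] [InnerProductSpace ℝ E] [FiniteDimensional ℝ E]
  [MeasurableSpace E] [BorelSpace E] {Ω C : Set E} {b : E → E} {x₀ : E} {ρ : ℝ} {L : ℝ≥0}

lemma stable_of_lipschitz {w : E → E} (hw : LipschitzWith L w)
    (h : ∀ x ∈ C, x ∈ ball x₀ ρ → b x = w x) : Stable C b x₀ ρ := by
  refine ⟨Real.exp L, (Real.exp_pos _).le, fun u hu η₁ η₂ h₁ h₂ k₁ k₂ => ?_⟩
  obtain ⟨c₁, N₁, hN₁, d₁⟩ := h₁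
  obtain ⟨c₂, N₂, hN₂, d₂⟩ := h₂
  have hd : ∀ {η : ℝ → E} {N : Set ℝ}, (∀ t ∈ Ioo 0 u, t ∉ N → η t ∈ C ∧ HasDerivAt η (b (η t)) t) →
      (∀ t ∈ Icc 0 u, η t ∈ ball x₀ ρ) → ∀ t ∈ Ioo 0 u, t ∉ N → HasDerivAt η (w (η t)) t := by
    intro η N hη hk t ht htN
    obtain ⟨m, hm⟩ := hη t ht htN
    rwa [h _ m (hk t ⟨ht.1.le, ht.2.le⟩)] at hm
  refine (dist_le_of_trajectories_off_countable hw hu.1 c₁ c₂ hN₁ hN₂ (hd d₁ k₁) (hd d₂ k₂)).trans ?_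
  rw [mul_comm]
  gcongr
  rw [sub_zero]
  exact mul_le_of_le_one_right L.2 hu.2

lemma stable_of_crossing {n : E} (hn : ‖n‖ = 1) {c κ B : ℝ} (hκ : 0 < κ) {wp wm : E → E}
    (hwp : LipschitzWith L wp) (hwm : LipschitzWith L wm)
    (h : ∀ x ∈ C, x ∈ ball x₀ ρ → ‖b x‖ ≤ B ∧ κ ≤ inner ℝ n (b x) ∧
      (c < inner ℝ n x → b x = wp x) ∧ (inner ℝ n x < c → b x = wm x)) : Stable C b x₀ ρ := by
  refine ⟨(1 + 2 * |B| / κ) * Real.exp L, by positivity, fun u hu η₁ η₂ h₁ h₂ k₁ k₂ => ?_⟩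
  obtain ⟨c₁, N₁, hN₁, d₁⟩ := h₁
  obtain ⟨c₂, N₂, hN₂, d₂⟩ := h₂
  refine (crossing_stability hn hκ hwp hwm hu.1 hN₁ hN₂ c₁ c₂
    (fun t ht htN => ⟨(d₁ t ht htN).2, h _ (d₁ t ht htN).1 (k₁ t ⟨ht.1.le, ht.2.le⟩)⟩)
    (fun t ht htN => ⟨(d₂ t ht htN).2, h _ (d₂ t ht htN).1 (k₂ t ⟨ht.1.le, ht.2.le⟩)⟩)).trans ?_
  gcongr
  exact mul_le_of_le_one_right L.2 hu.2

lemma good_of_lipschitz (hΩ : ball x₀ ρ ⊆ Ω) {w : E → E} (hw : LipschitzWith L w)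
    (h : ∀ x ∈ C, x ∈ ball x₀ ρ → b x = w x) : Good Ω C b ρ x₀ :=
  ⟨hΩ, stable_of_lipschitz hw h, stable_of_lipschitz hw.neg fun x hx hx' => by
    rw [Pi.neg_apply, Pi.neg_apply, h x hx hx']⟩

lemma good_of_crossing (hΩ : ball x₀ ρ ⊆ Ω) {n : E} (hn : ‖n‖ = 1) {c κ B : ℝ} (hκ : 0 < κ)
    {wp wm : E → E} (hwp : LipschitzWith L wp) (hwm : LipschitzWith L wm)
    (h : ∀ x ∈ C, x ∈ ball x₀ ρ → ‖b x‖ ≤ B ∧ κ ≤ inner ℝ n (b x) ∧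
      (c < inner ℝ n x → b x = wp x) ∧ (inner ℝ n x < c → b x = wm x)) : Good Ω C b ρ x₀ := by
  refine ⟨hΩ, stable_of_crossing hn hκ hwp hwm h, ?_⟩
  -- Backward in time the hyperplane is crossed along `-n`, so the two sides exchange their roles.
  refine stable_of_crossing (n := -n) (c := -c) (B := B) (by rwa [norm_neg]) hκ hwm.neg hwp.neg
    fun x hx hx' => ?_
  obtain ⟨h1, h2, h3, h4⟩ := h x hx hx'
  simp only [Pi.neg_apply, norm_neg, inner_neg_right, inner_neg_left, neg_inj, neg_neg]
  exact ⟨h1, h2, fun hh => h4 (by linarith), fun hh => h3 (by linarith)⟩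

lemma exists_cell_of_isPreconnected {M : Finset (Set E)} (hMo : ∀ K ∈ M, IsOpen K)
    (hMd : ∀ K ∈ M, ∀ K' ∈ M, K ≠ K' → Disjoint K K') {s : Set E} (hs : IsPreconnected s)
    (hne : s.Nonempty) (hsub : s ⊆ ⋃ K ∈ M, K) : ∃ K ∈ M, s ⊆ K := by
  classical
  obtain ⟨x, hx⟩ := hne
  obtain ⟨K, hK, hxK⟩ := mem_iUnion₂.1 (hsub hx)
  refine ⟨K, hK, hs.subset_left_of_subset_union (hMo K hK)
    (isOpen_biUnion fun K' hK' => hMo K' (Finset.mem_of_mem_erase hK') :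
      IsOpen (⋃ K' ∈ M.erase K, K')) ?_ ?_ ⟨x, hx, hxK⟩⟩
  · exact disjoint_iUnion₂_right.2 fun K' hK' =>
      hMd K hK K' (Finset.mem_of_mem_erase hK') (Finset.ne_of_mem_erase hK').symm
  · intro y hy
    obtain ⟨K', hK', hyK'⟩ := mem_iUnion₂.1 (hsub hy)
    by_cases h : K' = K
    · exact Or.inl (h ▸ hyK')
    · exact Or.inr (mem_iUnion₂.2 ⟨K', Finset.mem_erase.2 ⟨h, hK'⟩, hyK'⟩)

/-- The open half ball is convex and covered by disjoint open cells, hence contained in one of them.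
A cell containing a point of the hyperplane in the ball is open, so it meets the half ball and is
that same cell; this accounts for the non-strict inequality. -/
lemma exists_cell_halfBall {M : Finset (Set E)} (hMo : ∀ K ∈ M, IsOpen K)
    (hMd : ∀ K ∈ M, ∀ K' ∈ M, K ≠ K' → Disjoint K K') {n : E} (hn : ‖n‖ = 1) (hρ : 0 < ρ)
    (hcov : ∀ x ∈ ball x₀ ρ, inner ℝ n x ≠ inner ℝ n x₀ → x ∈ ⋃ K ∈ M, K) :
    ∃ K ∈ M, (∀ x ∈ ball x₀ ρ, inner ℝ n x₀ < inner ℝ n x → x ∈ K) ∧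
      ∀ x ∈ ⋃ K ∈ M, K, x ∈ ball x₀ ρ → inner ℝ n x₀ ≤ inner ℝ n x → x ∈ K := by
  have hnn : inner ℝ n n = (1 : ℝ) := by rw [real_inner_self_eq_norm_sq, hn]; ring
  have hconv : Convex ℝ (ball x₀ ρ ∩ {x | inner ℝ n x₀ < inner ℝ n x}) :=
    (convex_ball x₀ ρ).inter (convex_halfSpace_gt (innerSL ℝ n).isLinear _)
  obtain ⟨K, hK, hsub⟩ := exists_cell_of_isPreconnected hMo hMd hconv.isPreconnected
    ⟨x₀ + (ρ / 2) • n, by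
      rw [mem_ball, dist_eq_norm, add_sub_cancel_left, norm_smul, hn, Real.norm_of_nonneg (by linarith)]
      linarith, by
      change inner ℝ n x₀ < inner ℝ n (x₀ + (ρ / 2) • n)
      rw [inner_add_right, inner_smul_right, hnn]; linarith⟩
    (fun x hx => hcov x hx.1 (ne_of_gt hx.2))
  refine ⟨K, hK, fun x hx hx' => hsub ⟨hx, hx'⟩, fun x hx hxb hle => ?_⟩
  obtain ⟨K', hK', hxK'⟩ := mem_iUnion₂.1 hx
  by_cases hKK : K' = K
  · exact hKK ▸ hxK'
  exfalso
  have hc : Continuous fun t : ℝ => x + t • n := by fun_prop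
  have hev : ∀ᶠ t in 𝓝 (0 : ℝ), x + t • n ∈ K' ∩ ball x₀ ρ := by
    refine hc.continuousAt.eventually_mem ?_
    rw [zero_smul, add_zero]
    exact ((hMo K' hK').inter isOpen_ball).mem_nhds ⟨hxK', hxb⟩
  obtain ⟨t, ht, htpos⟩ := ((hev.filter_mono nhdsWithin_le_nhds).and
    (self_mem_nhdsWithin : ∀ᶠ t in 𝓝[>] (0 : ℝ), t ∈ Ioi 0)).exists
  refine disjoint_left.1 (hMd K' hK' K hK hKK) ht.1 (hsub ⟨ht.2, ?_⟩)
  change inner ℝ n x₀ < inner ℝ n (x + t • n)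
  rw [inner_add_right, inner_smul_right, hnn]
  have : 0 < t := htpos
  linarith

variable {μ : Measure E} [μ.IsAddHaarMeasure] {φ δ : E → ℝ} {φmin φmax Γ B T : ℝ} {F : ℝ → E → E}

lemma RegularFlow.mem_goodSet_of_mem {M : Finset (Set E)}
    (H : RegularFlow μ Ω (⋃ K ∈ M, K) φ b δ φmin φmax Γ B T F) (hMo : ∀ K ∈ M, IsOpen K)
    {bK : Set E → E → E} (hbL : ∀ K ∈ M, LipschitzWith L (bK K))
    (hbE : ∀ K ∈ M, EqOn b (bK K) K) :
    ⋃ K ∈ M, K ⊆ goodSet Ω (⋃ K ∈ M, K) b := by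
  intro x hx
  obtain ⟨K, hK, hxK⟩ := mem_iUnion₂.1 hx
  obtain ⟨ρ, hρ, hball⟩ := Metric.isOpen_iff.1 (hMo K hK) x hxK
  have hsub : ball x ρ ⊆ ⋃ K ∈ M, K := fun y hy => mem_iUnion₂.2 ⟨K, hK, hball hy⟩
  exact ⟨ρ, hρ, good_of_lipschitz (hsub.trans H.cells_subset) (hbL K hK)
    fun y _ hy => hbE K hK (hball hy)⟩

/-- Near a point where a single hyperplane separates the cells, either all characteristics cross
the hyperplane in the same direction, or the field is tangential there. -/
lemma RegularFlow.mem_goodSet_or_tangential {M : Finset (Set E)}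
    (H : RegularFlow μ Ω (⋃ K ∈ M, K) φ b δ φmin φmax Γ B T F) (hMo : ∀ K ∈ M, IsOpen K)
    (hMd : ∀ K ∈ M, ∀ K' ∈ M, K ≠ K' → Disjoint K K') {bK : Set E → E → E}
    (hbL : ∀ K ∈ M, LipschitzWith L (bK K)) (hbE : ∀ K ∈ M, EqOn b (bK K) K)
    {φK : Set E → E → ℝ} (hφc : ∀ K ∈ M, Continuous (φK K)) (hφpos : ∀ K ∈ M, ∀ x, 0 < φK K x)
    (hφE : ∀ K ∈ M, EqOn φ (φK K) K) {n : E} (hn : ‖n‖ = 1) (hρ : 0 < ρ) (hball : ball x₀ ρ ⊆ Ω)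
    (hcov : ∀ x ∈ ball x₀ ρ, inner ℝ n x ≠ inner ℝ n x₀ → x ∈ ⋃ K ∈ M, K) :
    x₀ ∈ goodSet Ω (⋃ K ∈ M, K) b ∨
      ∃ r > 0, ∀ x ∈ ⋃ K ∈ M, K, x ∈ ball x₀ r → |inner ℝ n (b x)| ≤ L * ‖x - x₀‖ := by
  obtain ⟨P, hP, hP1, hP2⟩ := exists_cell_halfBall hMo hMd hn hρ hcov
  obtain ⟨Q, hQ, hQ1, hQ2⟩ := exists_cell_halfBall (n := -n) hMo hMd (by rwa [norm_neg]) hρ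
    (fun x hx h => hcov x hx fun h' => h (by rw [inner_neg_left, inner_neg_left, h']))
  simp only [inner_neg_left, neg_lt_neg_iff, neg_le_neg_iff] at hQ1 hQ2
  -- It is `φ b` whose normal component is continuous. As `φK` is positive, the one-sided normal
  -- components of `b` at least have the same sign.
  have htr : inner ℝ n (φK P x₀ • bK P x₀) = inner ℝ n (φK Q x₀ • bK Q x₀) :=
    normal_trace_eq (W := fun x => φ x • b x) H.δ_bd H.Γ_nonneg H.weakDiv hn hρ hball
      (Wp := fun x => φK P x • bK P x) (Wm := fun x => φK Q x • bK Q x)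
      ((hφc P hP).smul (hbL P hP).continuous) ((hφc Q hQ).smul (hbL Q hQ).continuous)
      (fun x hx h => by simp only [hφE P hP (hP1 x hx h), hbE P hP (hP1 x hx h)])
      (fun x hx h => by simp only [hφE Q hQ (hQ1 x hx h), hbE Q hQ (hQ1 x hx h)])
  rw [inner_smul_right, inner_smul_right] at htr
  have hp := hφpos P hP x₀
  have hq := hφpos Q hQ x₀
  have hside : ∀ x ∈ ⋃ K ∈ M, K, x ∈ ball x₀ ρ → (inner ℝ n x₀ < inner ℝ n x → b x = bK P x) ∧
      (inner ℝ n x < inner ℝ n x₀ → b x = bK Q x) := fun x _ hxb =>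
    ⟨fun h => hbE P hP (hP1 x hxb h), fun h => hbE Q hQ (hQ1 x hxb h)⟩
  have hval : ∀ x ∈ ⋃ K ∈ M, K, x ∈ ball x₀ ρ → b x = bK P x ∨ b x = bK Q x := fun x hx hxb =>
    (le_total (inner ℝ n x₀) (inner ℝ n x)).imp (fun h => hbE P hP (hP2 x hx hxb h))
      (fun h => hbE Q hQ (hQ2 x hx hxb h))
  have hcross : ∀ m : E, (∀ K ∈ M, 0 < inner ℝ m (bK K x₀) → ∀ᶠ x in 𝓝 x₀,
      inner ℝ m (bK K x₀) / 2 ≤ inner ℝ m (bK K x)) := by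
    intro m K hK h
    have hc : Continuous fun x => inner ℝ m (bK K x) := by
      have := (hbL K hK).continuous
      fun_prop
    exact hc.continuousAt.eventually_const_le (half_lt_self h)
  have hgood : ∀ m : E, 0 < inner ℝ m (bK P x₀) → 0 < inner ℝ m (bK Q x₀) →
      ∃ κ > 0, ∃ r > 0, r ≤ ρ ∧ ∀ x ∈ ⋃ K ∈ M, K, x ∈ ball x₀ r → κ ≤ inner ℝ m (b x) := by
    intro m h1 h2
    obtain ⟨r, hr, hr'⟩ := Metric.eventually_nhds_iff_ball.1
      ((hcross m P hP h1).and (hcross m Q hQ h2))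
    refine ⟨min (inner ℝ m (bK P x₀) / 2) (inner ℝ m (bK Q x₀) / 2), by positivity, min r ρ,
      lt_min hr hρ, min_le_right _ _, fun x hx hxb => ?_⟩
    have hxr := hr' x (ball_subset_ball (min_le_left _ _) hxb)
    rcases hval x hx (ball_subset_ball (min_le_right _ _) hxb) with h | h <;> rw [h]
    · exact (min_le_left _ _).trans hxr.1
    · exact (min_le_right _ _).trans hxr.2
  rcases lt_trichotomy (inner ℝ n (bK P x₀)) 0 with h | h | h
  · left
    have h' : inner ℝ n (bK Q x₀) < 0 := by
      by_contra hh
      push Not at hh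
      nlinarith
    obtain ⟨κ, hκ, r, hr, hrρ, hk⟩ := hgood (-n) (by rw [inner_neg_left]; linarith)
      (by rw [inner_neg_left]; linarith)
    have hsub := ball_subset_ball (x := x₀) hrρ
    refine ⟨r, hr, good_of_crossing (n := -n) (c := -inner ℝ n x₀) (hsub.trans hball)
      (by rwa [norm_neg]) hκ (hbL Q hQ) (hbL P hP)
      fun x hx hxr => ⟨H.b_bd x hx, hk x hx hxr, fun hh => ?_, fun hh => ?_⟩⟩
    · rw [inner_neg_left] at hh
      exact (hside x hx (hsub hxr)).2 (by linarith)
    · rw [inner_neg_left] at hh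
      exact (hside x hx (hsub hxr)).1 (by linarith)
  · right
    have h' : inner ℝ n (bK Q x₀) = 0 := by
      rw [h, mul_zero, eq_comm, mul_eq_zero] at htr
      exact htr.resolve_left hq.ne'
    have hle : ∀ K ∈ M, inner ℝ n (bK K x₀) = 0 → ∀ x, |inner ℝ n (bK K x)| ≤ L * ‖x - x₀‖ := by
      intro K hK hK0 x
      rw [← sub_zero (inner ℝ n (bK K x)), ← hK0, ← inner_sub_right]
      refine (abs_real_inner_le_norm _ _).trans ?_
      rw [hn, one_mul]
      exact (hbL K hK).norm_sub_le _ _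
    refine ⟨ρ, hρ, fun x hx hxr => ?_⟩
    rcases hval x hx hxr with hb | hb <;> rw [hb]
    · exact hle P hP h x
    · exact hle Q hQ h' x
  · left
    have h' : 0 < inner ℝ n (bK Q x₀) := by
      by_contra hh
      push Not at hh
      nlinarith [mul_pos hp h]
    obtain ⟨κ, hκ, r, hr, hrρ, hk⟩ := hgood n h h'
    have hsub := ball_subset_ball (x := x₀) hrρ
    exact ⟨r, hr, good_of_crossing (hsub.trans hball) hn hκ (hbL P hP) (hbL Q hQ)
      fun x hx hxr => ⟨H.b_bd x hx, hk x hx hxr, hside x hx (hsub hxr)⟩⟩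

/-- At a point outside the cells, either two hyperplanes of `S` are transverse, or all those of `S`
through the point coincide. In the second case the others miss a neighbourhood, where a single
hyperplane separates the cells. -/
theorem RegularFlow.ae_mem_goodSet_of_cells {M : Finset (Set E)}
    (H : RegularFlow μ Ω (⋃ K ∈ M, K) φ b δ φmin φmax Γ B T F) (hMo : ∀ K ∈ M, IsOpen K)
    (hMd : ∀ K ∈ M, ∀ K' ∈ M, K ≠ K' → Disjoint K K') {bK : Set E → E → E}
    (hbL : ∀ K ∈ M, LipschitzWith L (bK K)) (hbE : ∀ K ∈ M, EqOn b (bK K) K)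
    {φK : Set E → E → ℝ} (hφc : ∀ K ∈ M, Continuous (φK K)) (hφpos : ∀ K ∈ M, ∀ x, 0 < φK K x)
    (hφE : ∀ K ∈ M, EqOn φ (φK K) K) {S : Finset (E × ℝ)} (hS : ∀ p ∈ S, ‖p.1‖ = 1)
    (hcov : ∀ x ∈ Ω, x ∉ ⋃ K ∈ M, K → ∃ p ∈ S, inner ℝ p.1 x = p.2) :
    ∀ᵐ x ∂μ.restrict Ω, ∀ t ∈ Icc 0 T, F t x ∈ goodSet Ω (⋃ K ∈ M, K) b := by
  have hC := H.mem_goodSet_of_mem hMo hbL hbE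
  refine H.ae_mem_goodSet hS L.2 hC fun y hy hyg => ?_
  obtain ⟨p, hp, hpy⟩ := hcov y hy fun h => hyg (hC h)
  by_cases hex : ∃ q ∈ S, LinearIndependent ℝ ![p.1, q.1] ∧ inner ℝ q.1 y = q.2
  · obtain ⟨q, hq, hli, hqy⟩ := hex
    exact Or.inl ⟨p, hp, q, hq, hli, hpy, hqy⟩
  right
  refine ⟨p, hp, hpy, ?_⟩
  push Not at hex
  have hpn : p.1 ≠ 0 := fun h => by simpa [h] using hS p hp
  have hpar : ∀ q ∈ S, inner ℝ q.1 y = q.2 → ∀ x, inner ℝ q.1 x = q.2 → inner ℝ p.1 x = inner ℝ p.1 y := by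
    intro q hq hqy x hqx
    have h1 : ¬ LinearIndependent ℝ ![p.1, q.1] := fun h => hex q hq h hqy
    rw [LinearIndependent.pair_iff' hpn] at h1
    push Not at h1
    obtain ⟨a, ha⟩ := h1
    have ha0 : a ≠ 0 := by
      rintro rfl
      have := hS q hq
      rw [← ha, zero_smul, norm_zero] at this
      exact zero_ne_one this
    rw [← hqy, ← ha, inner_smul_left, inner_smul_left] at hqx
    exact mul_left_cancel₀ (by simpa using ha0) hqx
  have hev : ∀ᶠ x in 𝓝 y, x ∈ Ω ∧ ∀ q ∈ S, inner ℝ q.1 y ≠ q.2 → inner ℝ q.1 x ≠ q.2 := by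
    refine (H.isOpen.eventually_mem hy).and ((Filter.eventually_all_finset S).2 fun q _ => ?_)
    by_cases hq : inner ℝ q.1 y = q.2
    · exact Eventually.of_forall fun x h => absurd hq h
    · have hc : Continuous fun x => inner ℝ q.1 x := by fun_prop
      filter_upwards [hc.continuousAt.eventually_ne hq] with x hx _ using hx
  obtain ⟨ρ, hρ, hball⟩ := Metric.eventually_nhds_iff_ball.1 hev
  refine (H.mem_goodSet_or_tangential hMo hMd hbL hbE hφc hφpos hφE (hS p hp) hρ
    (fun x hx => (hball x hx).1) fun x hx hne => ?_).resolve_left hyg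
  by_contra hxC
  obtain ⟨q, hq, hqx⟩ := hcov x (hball x hx).1 hxC
  by_cases hqy : inner ℝ q.1 y = q.2
  · exact hne (hpar q hq hqy x hqx)
  · exact (hball x hx).2 q hq hqy hqx

end Classification

/-! ### Frontiers of polytopes lie in finitely many hyperplanes. -/

section Polytopes

variable {E : Type*} [NormedAddCommGroup E] [InnerProductSpace ℝ E] [FiniteDimensional ℝ E]

/-- `A` is contained in a finite union of hyperplanes. -/
def InHyperplanes (A : Set E) : Prop :=
  ∃ S : Finset (E × ℝ), (∀ p ∈ S, ‖p.1‖ = 1) ∧ ∀ x ∈ A, ∃ p ∈ S, inner ℝ p.1 x = p.2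

lemma InHyperplanes.mono {A A' : Set E} (h : InHyperplanes A') (hs : A ⊆ A') : InHyperplanes A := by
  obtain ⟨S, h1, h2⟩ := h
  exact ⟨S, h1, fun x hx => h2 x (hs hx)⟩

lemma InHyperplanes.biUnion {ι : Type*} (I : Finset ι) {A : ι → Set E}
    (h : ∀ i ∈ I, InHyperplanes (A i)) : InHyperplanes (⋃ i ∈ I, A i) := by
  classical
  choose! S h1 h2 using h
  refine ⟨I.biUnion S, fun p hp => ?_, fun x hx => ?_⟩
  · obtain ⟨i, hi, hp⟩ := Finset.mem_biUnion.1 hp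
    exact h1 i hi p hp
  · obtain ⟨i, hi, hx⟩ := mem_iUnion₂.1 hx
    obtain ⟨p, hp, hpx⟩ := h2 i hi x hx
    exact ⟨p, Finset.mem_biUnion.2 ⟨i, hi, hp⟩, hpx⟩

lemma inHyperplanes_affineSubspace {Q : AffineSubspace ℝ E} (hne : (Q : Set E).Nonempty)
    (hQ : Q ≠ ⊤) : InHyperplanes (Q : Set E) := by
  rw [Ne, ← AffineSubspace.direction_eq_top_iff_of_nonempty hne,
    ← Submodule.orthogonal_eq_bot_iff, ← Ne, Submodule.ne_bot_iff] at hQ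
  obtain ⟨v, hv, hv0⟩ := hQ
  obtain ⟨y, hy⟩ := hne
  refine ⟨{(‖v‖⁻¹ • v, inner ℝ (‖v‖⁻¹ • v) y)}, fun p hp => ?_, fun x hx => ?_⟩
  · rw [Finset.mem_singleton.1 hp, norm_smul, norm_inv, norm_norm,
      inv_mul_cancel₀ (norm_ne_zero_iff.2 hv0)]
  · refine ⟨_, Finset.mem_singleton_self _, ?_⟩
    have := (Submodule.mem_orthogonal' _ _).1 hv (x - y) (AffineSubspace.vsub_mem_direction hx hy)
    rw [inner_sub_right, sub_eq_zero] at this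
    simp only [inner_smul_left, this]

/-- A supporting hyperplane at `x` bounds all vertices, so a convex combination equal to `x` charges
only vertices lying on it; these form `Q`. When `P` does not span the space, `P` itself serves. -/
lemma exists_affineSpan_of_mem_frontier_convexHull (P : Finset E) {x : E}
    (hx : x ∈ frontier (convexHull ℝ (P : Set E))) :
    ∃ Q ⊆ P, x ∈ affineSpan ℝ (Q : Set E) ∧ affineSpan ℝ (Q : Set E) ≠ ⊤ := by
  classical
  have hcl : IsClosed (convexHull ℝ (P : Set E)) := P.finite_toSet.isClosed_convexHull ℝ
  rw [hcl.frontier_eq] at hx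
  obtain ⟨hxP, hxi⟩ := hx
  by_cases htop : affineSpan ℝ (P : Set E) = ⊤
  swap
  · exact ⟨P, subset_rfl, convexHull_subset_affineSpan _ hxP, htop⟩
  have hconv := convex_convexHull ℝ (P : Set E)
  have hint := interior_convexHull_nonempty_iff_affineSpan_eq_top.2 htop
  obtain ⟨f, hf⟩ := geometric_hahn_banach_open_point hconv.interior isOpen_interior hxi
  have hle : ∀ p ∈ P, f p ≤ f x := by
    intro p hp
    have h1 : p ∈ closure (interior (convexHull ℝ (P : Set E))) := by
      rw [hconv.closure_interior_eq_closure_of_nonempty_interior hint]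
      exact subset_closure (subset_convexHull ℝ _ hp)
    exact closure_minimal (fun a ha => (hf a ha).le) (isClosed_le f.continuous continuous_const) h1
  obtain ⟨w, hw0, hw1, hwx⟩ := Finset.mem_convexHull'.1 hxP
  have hfx : ∑ p ∈ P, w p * (f x - f p) = 0 := by
    simp only [mul_sub]
    rw [Finset.sum_sub_distrib, ← Finset.sum_mul, hw1, one_mul, sub_eq_zero]
    conv_lhs => rw [← hwx]
    simp
  have hz := (Finset.sum_eq_zero_iff_of_nonneg
    fun p hp => mul_nonneg (hw0 p hp) (sub_nonneg.2 (hle p hp))).1 hfx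
  have hw : ∀ p ∈ P, p ∉ P.filter (fun p => f p = f x) → w p = 0 := by
    intro p hp hp'
    refine (mul_eq_zero.1 (hz p hp)).resolve_right fun h => hp' ?_
    exact Finset.mem_filter.2 ⟨hp, by linarith⟩
  refine ⟨P.filter (fun p => f p = f x), Finset.filter_subset _ _, ?_, fun htop' => ?_⟩
  · refine convexHull_subset_affineSpan _ (Finset.mem_convexHull'.2
      ⟨w, fun p hp => hw0 p (Finset.mem_of_mem_filter p hp), ?_, ?_⟩)
    · rw [← hw1]
      exact Finset.sum_subset (Finset.filter_subset _ _) hw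
    · refine (Finset.sum_subset (Finset.filter_subset _ _) fun p hp hp' => ?_).trans hwx
      rw [hw p hp hp', zero_smul]
  · obtain ⟨a, ha⟩ := hint
    have hsub : affineSpan ℝ (P.filter (fun p => f p = f x) : Set E) ≤
        AffineSubspace.mk' x (LinearMap.ker f.toLinearMap) := by
      rw [affineSpan_le]
      intro p hp
      have := (Finset.mem_filter.1 (Finset.mem_coe.1 hp)).2
      rw [SetLike.mem_coe, AffineSubspace.mem_mk', vsub_eq_sub, LinearMap.mem_ker]
      simp [this]
    have h2 : a ∈ AffineSubspace.mk' x (LinearMap.ker f.toLinearMap) :=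
      hsub (htop' ▸ AffineSubspace.mem_top ℝ E a)
    rw [AffineSubspace.mem_mk', vsub_eq_sub, LinearMap.mem_ker] at h2
    have h3 : f a = f x := by simpa [sub_eq_zero] using h2
    exact (hf a ha).ne h3

lemma inHyperplanes_frontier_convexHull (P : Finset E) :
    InHyperplanes (frontier (convexHull ℝ (P : Set E))) := by
  classical
  refine (InHyperplanes.biUnion (P.powerset.filter fun Q : Finset E => Q.Nonempty ∧
    affineSpan ℝ (Q : Set E) ≠ ⊤) (A := fun Q : Finset E => (affineSpan ℝ (Q : Set E) : Set E)) fun Q hQ => ?_).mono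
    fun x hx => ?_
  · obtain ⟨-, h1, h2⟩ := Finset.mem_filter.1 hQ
    exact inHyperplanes_affineSubspace ((affineSpan_nonempty ℝ).2 h1) h2
  · obtain ⟨Q, hQP, hxQ, hQ⟩ := exists_affineSpan_of_mem_frontier_convexHull P hx
    refine mem_iUnion₂.2 ⟨Q, Finset.mem_filter.2 ⟨Finset.mem_powerset.2 hQP, ?_, hQ⟩, hxQ⟩
    exact (affineSpan_nonempty ℝ).1 ⟨x, hxQ⟩

lemma frontier_biUnion_finset_subset {ι X : Type*} [TopologicalSpace X] (I : Finset ι) (A : ι → Set X) :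
    frontier (⋃ i ∈ I, A i) ⊆ ⋃ i ∈ I, frontier (A i) := by
  intro x hx
  rw [frontier, I.closure_biUnion] at hx
  obtain ⟨i, hi, hxi⟩ := mem_iUnion₂.1 hx.1
  exact mem_iUnion₂.2 ⟨i, hi, hxi, fun h => hx.2 (interior_mono (subset_biUnion_of_mem hi) h)⟩

end Polytopes

/-! ### Polytopal meshes and Lipschitz extension of the velocity of a cell. -/

section Polytopal

variable {d : ℕ} {K : Set (EuclideanSpace ℝ (Fin d))}

lemma _root_.IsPolytopal.isOpen (h : IsPolytopal K) : IsOpen K := by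
  obtain ⟨S, rfl⟩ := h
  exact isOpen_interior

lemma _root_.IsPolytopal.isBounded (h : IsPolytopal K) : Bornology.IsBounded K := by
  obtain ⟨S, rfl⟩ := h
  refine Bornology.IsBounded.subset ?_ interior_subset
  exact (Bornology.isBounded_biUnion S.finite_toSet).2 fun P _ =>
    (P.finite_toSet.isCompact_convexHull ℝ).isBounded

lemma _root_.IsPolytopal.inHyperplanes_frontier (h : IsPolytopal K) : InHyperplanes (frontier K) := by
  obtain ⟨S, rfl⟩ := h
  exact (InHyperplanes.biUnion S fun P _ => inHyperplanes_frontier_convexHull P).mono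
    (frontier_interior_subset.trans (frontier_biUnion_finset_subset S _))

variable {Ω : Set (EuclideanSpace ℝ (Fin d))} {M : Finset (Set (EuclideanSpace ℝ (Fin d)))}

lemma _root_.IsPolytopalMesh.inHyperplanes_sdiff (h : IsPolytopalMesh Ω M) :
    InHyperplanes (Ω \ ⋃ K ∈ M, K) := by
  refine (InHyperplanes.biUnion M fun K hK => (h.polytopal K hK).inHyperplanes_frontier).mono ?_
  rintro x ⟨hx, hx'⟩
  obtain ⟨K, hK, hxK⟩ := mem_iUnion₂.1 (h.cover hx)
  refine mem_iUnion₂.2 ⟨K, hK, ?_⟩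
  rw [(h.polytopal K hK).isOpen.frontier_eq]
  exact ⟨hxK, fun h => hx' (mem_iUnion₂.2 ⟨K, hK, h⟩)⟩

lemma _root_.IsPolytopalMesh.ae_mem (h : IsPolytopalMesh Ω M) :
    ∀ᵐ x ∂volume.restrict Ω, x ∈ ⋃ K ∈ M, K := by
  obtain ⟨S, hS, hcov⟩ := h.inHyperplanes_sdiff
  have : ∀ᵐ x, ∀ p ∈ S, inner ℝ p.1 x ≠ p.2 :=
    (Filter.eventually_all_finset S).2 fun p hp => ae_inner_ne (hS p hp) p.2
  rw [ae_restrict_iff' h.domain.isOpen.measurableSet]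
  filter_upwards [this] with x hx hxΩ
  by_contra hxC
  obtain ⟨p, hp, hpx⟩ := hcov x ⟨hxΩ, hxC⟩
  exact hx p hp hpx

lemma contDiff_eval_mvPolynomial (p : MvPolynomial (Fin d) ℝ) :
    ContDiff ℝ ∞ fun x : EuclideanSpace ℝ (Fin d) => MvPolynomial.eval (fun j => x j) p := by
  induction p using MvPolynomial.induction_on with
  | C a => simpa using contDiff_const
  | add p q hp hq => simpa using hp.add hq
  | mul_X p i hp =>
    simp only [map_mul, MvPolynomial.eval_X]
    exact hp.mul (contDiff_euclidean.1 contDiff_id i)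

/-- On a bounded cell, the quotient of the piecewise smooth data is Lipschitz. -/
lemma exists_lipschitz_extension_quotient {φ φK : EuclideanSpace ℝ (Fin d) → ℝ}
    {V : EuclideanSpace ℝ (Fin d) → EuclideanSpace ℝ (Fin d)} {φmin : ℝ} (hmin : 0 < φmin)
    (hK : Bornology.IsBounded K) (hφK : ContDiff ℝ ∞ φK) (hφ : EqOn φ φK K)
    (hbd : ∀ x ∈ K, φmin ≤ φ x) {p : Fin d → MvPolynomial (Fin d) ℝ}
    (hp : ∀ x ∈ K, ∀ i, V x i = MvPolynomial.eval (fun j => x j) (p i)) :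
    ∃ (L : ℝ≥0) (w : EuclideanSpace ℝ (Fin d) → EuclideanSpace ℝ (Fin d)),
      LipschitzWith L w ∧ EqOn (fun x => (φ x)⁻¹ • V x) w K := by
  set W : EuclideanSpace ℝ (Fin d) → EuclideanSpace ℝ (Fin d) :=
    fun x => WithLp.toLp 2 fun i => MvPolynomial.eval (fun j => x j) (p i) with hW
  have hWc : ContDiff ℝ ∞ W := contDiff_euclidean.2 fun i => contDiff_eval_mvPolynomial (p i)
  have hcl : ∀ x ∈ closure K, φmin ≤ φK x := by
    intro x hx
    exact closure_minimal (fun y hy => (hbd y hy).trans_eq (hφ hy))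
      (isClosed_le continuous_const hφK.continuous) hx
  have hloc : LocallyLipschitzOn (closure K) fun x => (φK x)⁻¹ • W x := by
    intro x hx
    have h1 : ContDiffAt ℝ 1 (fun x => (φK x)⁻¹ • W x) x :=
      (((hφK.of_le (by simp)).contDiffAt).inv (hmin.trans_le (hcl x hx)).ne').smul
        (hWc.of_le (by simp)).contDiffAt
    obtain ⟨C, t, ht, hC⟩ := h1.exists_lipschitzOnWith
    exact ⟨C, t, mem_nhdsWithin_of_mem_nhds ht, hC⟩
  -- A cell need not be convex, so a gradient bound on it would not suffice; compactness of its
  -- closure upgrades the local Lipschitz property.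
  obtain ⟨C, hC⟩ := hloc.exists_lipschitzOnWith_of_compact hK.isCompact_closure
  obtain ⟨w, hw, hwE⟩ := (hC.mono subset_closure).extend_finite_dimension
  refine ⟨_, w, hw, fun x hx => ?_⟩
  rw [← hwE hx]
  simp only [hφ hx]
  congr 1
  ext i
  exact hp x hx i

end Polytopal

/-! ### The estimate for nonnegative times. -/

section Sobolev

variable {d : ℕ} {Ω C : Set (EuclideanSpace ℝ (Fin d))} {φ δ : EuclideanSpace ℝ (Fin d) → ℝ}
  {b : EuclideanSpace ℝ (Fin d) → EuclideanSpace ℝ (Fin d)} {φmin φmax Γ B T : ℝ}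
  {F : ℝ → EuclideanSpace ℝ (Fin d) → EuclideanSpace ℝ (Fin d)}

theorem RegularFlow.eLpNorm_sobolev_increment_le
    (H : RegularFlow volume Ω C φ b δ φmin φmax Γ B T F)
    (hgood : ∀ᵐ x ∂volume.restrict Ω, ∀ t ∈ Icc 0 T, F t x ∈ goodSet Ω C b)
    {r α : ℝ≥0∞} (hr : 1 ≤ r) (hα : 1 ≤ α) (hrα : 1 / α = 1 / 2 + 1 / r)
    {f : EuclideanSpace ℝ (Fin d) → ℝ}
    {g : EuclideanSpace ℝ (Fin d) → EuclideanSpace ℝ (Fin d)} (hf : IsSobolev Ω r f g)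
    {s : ℝ} (hs : s ∈ Icc 0 T) :
    AEStronglyMeasurable (fun x => f (F s x) - f x) (volume.restrict Ω) ∧
      eLpNorm (fun x => f (F s x) - f x) α (volume.restrict Ω) ≤
        ENNReal.ofReal (flowConst φmin φmax Γ T) ^ (1 / α.toReal) * ENNReal.ofReal s *
          (eLpNorm b 2 (volume.restrict Ω) * eLpNorm g r (volume.restrict Ω)) := by
  have := H.isFiniteMeasure_restrict
  -- The exponent relation forces `1 / α ≥ 1 / 2`.
  have hα' : α ≠ ⊤ := by
    rintro rfl
    rw [ENNReal.div_top, eq_comm, add_eq_zero] at hrα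
    simp at hrα
  have hbm : AEStronglyMeasurable b (volume.restrict Ω) :=
    H.aestronglyMeasurable_of_continuousOn H.b_cont
  have hgm := hf.memLp_grad.aestronglyMeasurable
  have hfi : IntegrableOn f Ω := hf.memLp_fun.integrable hr
  have hgi : IntegrableOn g Ω := hf.memLp_grad.integrable hr
  refine ⟨H.aestronglyMeasurable_increment hgood hf.memLp_fun.aestronglyMeasurable hs, ?_⟩
  have hinc := H.ae_enorm_increment_le hgood (Df := fun x => innerSL ℝ (g x))
    hf.memLp_fun.aestronglyMeasurable
    ((innerSL ℝ).continuous.comp_aestronglyMeasurable hgm)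
    (fun Q hQ hQΩ => exists_smooth_approx H.isOpen hfi hgi hf.weakGrad hQ hQΩ) hs
  have hH : ENNReal.HolderTriple 2 r α := ⟨by simpa only [one_div] using hrα.symm⟩
  refine (H.eLpNorm_increment_le hgood (h := fun x => inner ℝ (g x) (b x)) (hgm.inner hbm) hs
    hinc hα hα').trans ?_
  gcongr
  have := eLpNorm_le_eLpNorm_mul_eLpNorm_of_nnnorm hbm hgm (fun y z => inner ℝ z y) 1
    (Eventually.of_forall fun x => by
      rw [one_mul, mul_comm]; exact nnnorm_inner_le_nnnorm _ _) (p := 2) (q := r) (r := α)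
  simpa using this

end Sobolev

/-! ### From mesh data to a regular flow. -/

section Mesh

variable {d : ℕ} {Ω : Set (EuclideanSpace ℝ (Fin d))} {M : Finset (Set (EuclideanSpace ℝ (Fin d)))}
  {φ : EuclideanSpace ℝ (Fin d) → ℝ} {φmin φmax : ℝ}
  {V : EuclideanSpace ℝ (Fin d) → EuclideanSpace ℝ (Fin d)}

lemma exists_cell_data (hM : IsPolytopalMesh Ω M) (hφmin : 0 < φmin) (hφ : IsPiecewiseSmooth M φ)
    (hφ_bd : ∀ x ∈ Ω, φmin ≤ φ x ∧ φ x ≤ φmax) (hV : IsPiecewisePolynomial M V) :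
    ∃ (L : ℝ≥0) (bK : Set (EuclideanSpace ℝ (Fin d)) → EuclideanSpace ℝ (Fin d) →
        EuclideanSpace ℝ (Fin d)) (φK : Set (EuclideanSpace ℝ (Fin d)) → EuclideanSpace ℝ (Fin d) → ℝ),
      (∀ K ∈ M, LipschitzWith L (bK K)) ∧
      (∀ K ∈ M, EqOn (fun x => (φ x)⁻¹ • V x) (bK K) K) ∧ (∀ K ∈ M, Continuous (φK K)) ∧
      (∀ K ∈ M, ∀ x, 0 < φK K x) ∧ ∀ K ∈ M, EqOn φ (φK K) K := by
  choose! φK hφc hφE using hφ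
  choose! p hp using hV
  have hbd : ∀ K ∈ M, ∀ x ∈ K, φmin ≤ φ x := fun K hK x hx => (hφ_bd x (hM.subset K hK hx)).1
  have hex : ∀ K ∈ M, ∃ (L : ℝ≥0) (w : EuclideanSpace ℝ (Fin d) → EuclideanSpace ℝ (Fin d)),
      LipschitzWith L w ∧ EqOn (fun x => (φ x)⁻¹ • V x) w K := fun K hK =>
    exists_lipschitz_extension_quotient hφmin (hM.polytopal K hK).isBounded (hφc K hK) (hφE K hK)
      (hbd K hK) (hp K hK)
  choose! L bK hbL hbE using hex
  -- Truncation from below makes the extension of `φ` positive on the whole space without changing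
  -- it on the cell.
  refine ⟨M.sup L, bK, fun K x => max (φK K x) φmin,
    fun K hK => (hbL K hK).weaken (Finset.le_sup hK), hbE,
    fun K hK => (hφc K hK).continuous.max continuous_const,
    fun K _ x => hφmin.trans_le (le_max_right _ _), fun K hK x hx => ?_⟩
  simp only
  rw [← hφE K hK hx, max_eq_left (hbd K hK x hx)]

lemma exists_regularFlow (hM : IsPolytopalMesh Ω M) (hφmin : 0 < φmin) (hφ : IsPiecewiseSmooth M φ)
    (hφ_bd : ∀ x ∈ Ω, φmin ≤ φ x ∧ φ x ≤ φmax) {divV : EuclideanSpace ℝ (Fin d) → ℝ} {Γ : ℝ}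
    (hΓ0 : 0 ≤ Γ) (hV : IsPiecewisePolynomial M V) (hV_div : IsHDiv Ω V divV)
    (hΓ : ∀ᵐ x ∂volume.restrict Ω, |divV x| ≤ Γ) {T : ℝ} (hT : 0 < T)
    {F : ℝ → EuclideanSpace ℝ (Fin d) → EuclideanSpace ℝ (Fin d)} (hF : IsFlow Ω M φ V T F) :
    ∃ B, RegularFlow volume Ω (⋃ K ∈ M, K) φ (fun x => (φ x)⁻¹ • V x) divV φmin φmax Γ B T F := by
  obtain ⟨L, bK, φK, hbL, hbE, hφc, -, hφE⟩ := exists_cell_data hM hφmin hφ hφ_bd hV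
  have hMo : ∀ K ∈ M, IsOpen K := fun K hK => (hM.polytopal K hK).isOpen
  have hbdΩ := hM.domain.isBounded
  have hfin : IsFiniteMeasure (volume.restrict Ω) :=
    ⟨by rw [Measure.restrict_apply_univ]; exact hbdΩ.measure_lt_top⟩
  have hloc : ∀ {Y : Type} [TopologicalSpace Y] {u : EuclideanSpace ℝ (Fin d) → Y}
      {uK : Set (EuclideanSpace ℝ (Fin d)) → EuclideanSpace ℝ (Fin d) → Y},
      (∀ K ∈ M, Continuous (uK K)) → (∀ K ∈ M, EqOn u (uK K) K) →
      ContinuousOn u (⋃ K ∈ M, K) := by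
    intro Y _ u uK hc hE x hx
    obtain ⟨K, hK, hxK⟩ := mem_iUnion₂.1 hx
    refine ContinuousAt.continuousWithinAt ?_
    exact ((hc K hK).continuousAt).congr
      ((hE K hK).symm.eventuallyEq_of_mem ((hMo K hK).mem_nhds hxK))
  have hbb : Bornology.IsBounded ((fun x => (φ x)⁻¹ • V x) '' ⋃ K ∈ M, K) := by
    rw [image_iUnion₂]
    refine (Bornology.isBounded_biUnion M.finite_toSet).2 fun K hK => ?_
    rw [(hbE K hK).image_eq]
    exact (hbL K hK).isBounded_image (hM.polytopal K hK).isBounded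
  obtain ⟨B, hB⟩ := isBounded_iff_forall_norm_le.1 hbb
  refine ⟨max B 0, ?_⟩
  exact
    { isOpen := hM.domain.isOpen
      bdd := hbdΩ
      isOpen_cells := isOpen_biUnion hMo
      cells_subset := iUnion₂_subset hM.subset
      ae_mem_cells := hM.ae_mem
      φmin_pos := hφmin
      φ_bd := hφ_bd
      φ_cont := hloc hφc hφE
      b_cont := hloc (fun K hK => (hbL K hK).continuous) hbE
      B_nonneg := le_max_right _ _
      b_bd := fun x hx => (hB _ (mem_image_of_mem _ hx)).trans (le_max_left _ _)
      Γ_nonneg := hΓ0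
      δ_int := hV_div.memLp_div.integrable one_le_two
      δ_bd := hΓ
      weakDiv := fun ψ h1 h2 h3 => by
        rw [← hV_div.weakDiv ψ ⟨h1, h2, h3⟩]
        refine setIntegral_congr_fun hM.domain.isOpen.measurableSet fun x hx => ?_
        rw [smul_inv_smul₀ (hφmin.trans_le (hφ_bd x hx).1).ne']
      T_pos := hT
      flow := by
        filter_upwards [hF] with x hx
        obtain ⟨Lx, hLx⟩ := hx.lipschitz
        obtain ⟨N, hN, hode⟩ := hx.ode
        refine ⟨hx.init, hx.mem, hLx.continuousOn, N, hN, fun t ht htN => ?_⟩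
        obtain ⟨⟨K, hK, hxK⟩, hd⟩ := hode t ht htN
        exact ⟨mem_iUnion₂.2 ⟨K, hK, hxK⟩, hd⟩ }

end Mesh

end PolyFlow

/-! ### The theorem. -/

theorem lemma5p3 {d : ℕ} (Ω : Set (EuclideanSpace ℝ (Fin d)))
    (M : Finset (Set (EuclideanSpace ℝ (Fin d)))) (hM : IsPolytopalMesh Ω M)
    (φ : EuclideanSpace ℝ (Fin d) → ℝ) (φmin φmax : ℝ) (hφmin : 0 < φmin)
    (hφ : IsPiecewiseSmooth M φ) (hφ_bd : ∀ x ∈ Ω, φmin ≤ φ x ∧ φ x ≤ φmax)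
    (V : EuclideanSpace ℝ (Fin d) → EuclideanSpace ℝ (Fin d))
    (divV : EuclideanSpace ℝ (Fin d) → ℝ) (Γ : ℝ)
    (hV : IsPiecewisePolynomial M V) (hV_div : IsHDiv Ω V divV)
    (hΓ : ∀ᵐ x ∂(volume.restrict Ω), |divV x| ≤ Γ)
    (hV_bdry : ZeroNormalTrace Ω V divV)
    (T : ℝ) (hT : 0 < T)
    (F : ℝ → EuclideanSpace ℝ (Fin d) → EuclideanSpace ℝ (Fin d))
    (hF : IsFlow Ω M φ V T F)
    (r α : ℝ≥0∞) (hr : 1 ≤ r) (hα : 1 ≤ α) (hrα : 1 / α = 1 / 2 + 1 / r)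
    (f : EuclideanSpace ℝ (Fin d) → ℝ)
    (gradf : EuclideanSpace ℝ (Fin d) → EuclideanSpace ℝ (Fin d))
    (hf : IsSobolev Ω r f gradf)
    (s : ℝ) (hs : s ∈ Icc (-T) T) :
    MemLp (fun x => f (F s x) - f x) α (volume.restrict Ω) ∧
      eLpNorm (fun x => f (F s x) - f x) α (volume.restrict Ω) ≤
        ENNReal.ofReal (flowConst φmin φmax Γ T ^ (1 / α.toReal) / φmin * |s|) *
          eLpNorm V 2 (volume.restrict Ω) * eLpNorm gradf r (volume.restrict Ω) := by
  -- The signs of `Γ` and `φmax` are deduced from a point of `Ω`, so the empty domain is treated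
  -- apart.
  rcases Ω.eq_empty_or_nonempty with hΩ | ⟨x₀, hx₀⟩
  · rw [hΩ, Measure.restrict_empty]
    simp
  have hΓ0 : 0 ≤ Γ := by
    have : (ae (volume.restrict Ω)).NeBot := by
      rw [ae_neBot, Ne, Measure.restrict_eq_zero]
      exact (hM.domain.isOpen.measure_pos volume ⟨x₀, hx₀⟩).ne'
    obtain ⟨x, hx⟩ := hΓ.exists
    exact (abs_nonneg _).trans hx
  have hc0 : 0 ≤ flowConst φmin φmax Γ T := by
    have := hφmin.le.trans ((hφ_bd x₀ hx₀).1.trans (hφ_bd x₀ hx₀).2)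
    unfold flowConst
    positivity
  obtain ⟨B, H⟩ := PolyFlow.exists_regularFlow hM hφmin hφ hφ_bd hΓ0 hV hV_div hΓ hT hF
  obtain ⟨L, bK, φK, hbL, hbE, hφc, hφpos, hφE⟩ := PolyFlow.exists_cell_data hM hφmin hφ hφ_bd hV
  obtain ⟨S, hS, hcov⟩ := hM.inHyperplanes_sdiff
  have hMo : ∀ K ∈ M, IsOpen K := fun K hK => (hM.polytopal K hK).isOpen
  set b : EuclideanSpace ℝ (Fin d) → EuclideanSpace ℝ (Fin d) := fun x => (φ x)⁻¹ • V x with hb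
  have key : AEStronglyMeasurable (fun x => f (F s x) - f x) (volume.restrict Ω) ∧
      eLpNorm (fun x => f (F s x) - f x) α (volume.restrict Ω) ≤
        ENNReal.ofReal (flowConst φmin φmax Γ T) ^ (1 / α.toReal) * ENNReal.ofReal |s| *
          (eLpNorm b 2 (volume.restrict Ω) * eLpNorm gradf r (volume.restrict Ω)) := by
    rcases le_total 0 s with h0 | h0
    · rw [abs_of_nonneg h0]
      exact H.eLpNorm_sobolev_increment_le (H.ae_mem_goodSet_of_cells hMo hM.disjoint hbL hbE hφc
        hφpos hφE hS fun x hx hx' => hcov x ⟨hx, hx'⟩) hr hα hrα hf ⟨h0, hs.2⟩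
    · rw [abs_of_nonpos h0]
      -- A negative time `s` for `b` is the positive time `-s` for `-b`; the norm of `-b` is that of
      -- `b`.
      have := H.neg.eLpNorm_sobolev_increment_le (H.neg.ae_mem_goodSet_of_cells hMo hM.disjoint
        (bK := fun K => -bK K) (fun K hK => (hbL K hK).neg)
        (fun K hK x hx => congrArg Neg.neg (hbE K hK hx)) hφc hφpos hφE hS
        fun x hx hx' => hcov x ⟨hx, hx'⟩) hr hα hrα hf (s := -s) ⟨by linarith, by linarith [hs.1]⟩
      simpa only [neg_neg, eLpNorm_neg] using this
  have hbV : eLpNorm b 2 (volume.restrict Ω) ≤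
      ENNReal.ofReal φmin⁻¹ * eLpNorm V 2 (volume.restrict Ω) := by
    refine eLpNorm_le_mul_eLpNorm_of_ae_le_mul ?_ 2
    filter_upwards [ae_restrict_mem hM.domain.isOpen.measurableSet] with x hx
    have h1 := (hφ_bd x hx).1
    rw [hb, norm_smul, norm_inv, Real.norm_of_nonneg (hφmin.le.trans h1)]
    gcongr
  have hle : eLpNorm (fun x => f (F s x) - f x) α (volume.restrict Ω) ≤
      ENNReal.ofReal (flowConst φmin φmax Γ T ^ (1 / α.toReal) / φmin * |s|) *
        eLpNorm V 2 (volume.restrict Ω) * eLpNorm gradf r (volume.restrict Ω) := by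
    refine key.2.trans ?_
    rw [ENNReal.ofReal_mul (by positivity), div_eq_mul_inv _ φmin,
      ENNReal.ofReal_mul (by positivity),
      ← ENNReal.ofReal_rpow_of_nonneg hc0 (by positivity)]
    calc _ ≤ ENNReal.ofReal (flowConst φmin φmax Γ T) ^ (1 / α.toReal) * ENNReal.ofReal |s| *
          ((ENNReal.ofReal φmin⁻¹ * eLpNorm V 2 (volume.restrict Ω)) *
            eLpNorm gradf r (volume.restrict Ω)) := by gcongr
      _ = _ := by ring
  refine ⟨⟨key.1, hle.trans_lt ?_⟩, hle⟩
  exact ENNReal.mul_lt_top (ENNReal.mul_lt_top ENNReal.ofReal_lt_top hV_div.memLp_field.2)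
    hf.memLp_grad.2
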